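/- **Setting.** Let $B_0>0$, let $\mathbb T^3=(\mathbb R/2\pi\mathbb Z)^3$, and let $\mu:\mathbb R^3\to\mathbb R$ be a spatially homogeneous equilibrium of the Vlasov–Poisson system in the uniform magnetic field $\mathbf B=(0,0,B_0)^T$, that is, $(\mathbf v\times\mathbf B)\cdot\nabla_{\mathbf v}\mu=0$. Let $f_0(\mathbf x,\mathbf v)$ be a function on $\mathbb T^3\times\mathbb R^3$. Assume that $\mu$ and $f_0$ are of class $C^3$ and that their derivatives of order at most $3$ are $O((1+|\mathbf v|)^{-4})$ (uniformly in $\mathbf x$). Let $(f,U)$ be a classical solution on $[0,\infty)$ of the linearized system $$\partial_t f+\mathbf v\cdot\nabla_{\mathbf x}f+B_0(v_2\partial_{v_1}f-v_1\partial_{v_2}f)+\mathbf E\cdot\nabla_{\mathbf v}\mu=0,\qquad \Delta_{\mathbf x}U=-\int_{\mathbb R^3}f\,d\mathbf v,\qquad \mathbf E=-\nabla_{\mathbf x}U,$$ with $f(0)=f_0$; here $f$ is continuous on $[0,\infty)\times\mathbb T^3\times\mathbb R^3$, $C^1$ for $t>0$ and integrable in $\mathbf v$, $U(t,\cdot)$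 is $C^2$ on $\mathbb T^3$, and $\mathbf E$ is continuous in $(t,\mathbf x)$. Write $\hat h(\mathbf k)=\int_{\mathbb T^3}e^{-i\mathbf k\cdot\mathbf x}h(\mathbf x)\,d\mathbf x$ for $\mathbf k\in\mathbb Z^3$, $\hat\mu(\xi)=\int_{\mathbb R^3}e^{-i\xi\cdot\mathbf v}\mu(\mathbf v)\,d\mathbf v$, and $L[F](\lambda)=\int_0^\infty e^{-\lambda t}F(t)\,dt$. Let $R(\alpha)=\begin{pmatrix}\cos\alpha&\sin\alpha\\-\sin\alpha&\cos\alpha\end{pmatrix}$ and $$\tilde R(t)=\begin{pmatrix}\frac1{B_0}\left(R(\frac\pi2-B_0t)-R(\frac\pi2)\right)&0\\0&t\end{pmatrix},\qquad P(\mathbf k,\lambda)=\mathbf k\cdot\Big(I+\int_0^\infty e^{-\lambda t}\,\hat\mu(\tilde R(t)\mathbf k)\,\tilde R(t)\,dt\Big)\mathbf k .$$ Let $S(t,\mathbf x)=\int f_0(\mathbf y^{-1}(t;\mathbf x,\mathbf v),\mathbf u^{-1}(t;\mathbf v))\,d\mathbf v$ be the free-streaming density, where $(\mathbf y^{-1},\mathbf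 u^{-1})$ is the inverse of the time-$t$ flow $(\mathbf y,\mathbf u)$ of $\dot{\mathbf y}=\mathbf u$, $\dot{\mathbf u}=\mathbf u\times\mathbf B$. **Dispersion relation.** There is $\sigma\ge0$ such that for all $\mathbf k\in\mathbb Z^3$ and $\mathrm{Re}\,\lambda>\sigma$ the integrals defining $P(\mathbf k,\lambda)$ and $L[\hat S(\cdot,\mathbf k)](\lambda)$ and, for $\mathbf k\ne0$, $L[\hat U(\cdot,\mathbf k)](\lambda)$ converge absolutely, and $$P(\mathbf k,\lambda)\,L[\hat U(\cdot,\mathbf k)](\lambda)=L[\hat S(\cdot,\mathbf k)](\lambda)$$ (for $\mathbf k=0$ both sides are $0$, because $P(0,\lambda)=0$). The same identity holds, with $L[\hat S(\cdot,\mathbf k)](\lambda)$ absolutely convergent, for every $\mathbf k\in\mathbb Z^3$ and every $\lambda\in\mathbb C$ at which the integrals defining $P(\mathbf k,\lambda)$ and $L[\hat U(\cdot,\mathbf k)](\lambda)$ converge absolutely. The integrals defining $P(\mathbf k,\lambda)$ converge absolutely whenever $\mathrm{Re}\,\lambda>0$. **Penrose condition.** If for some $\kappa_0>0$ $$\inf_{\mathbf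 k\in\mathbb Z^3\setminus\{0\},\ \mathrm{Re}\,\lambda>0}|P(\mathbf k,\lambda)|\ge\kappa_0,$$ then the electric energy $\mathcal E(t)=\frac12\int_{\mathbb T^3}|\mathbf E(t,\mathbf x)|^2\,d\mathbf x$ does not blow up: $\sup_{t\ge0}\mathcal E(t)<\infty$. More generally, if $K\subseteq\mathbb Z^3\setminus\{0\}$ and $|P(\mathbf k,\lambda)|\ge\kappa_0>0$ for all $\mathbf k\in K$ and $\mathrm{Re}\,\lambda>0$, then the electric energy carried by the modes in $K$ is bounded: $\sup_{t\ge0}\,(2\pi)^{-3}\sum_{\mathbf k\in K}\frac12|\hat{\mathbf E}(t,\mathbf k)|^2<\infty$. -/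

import Mathlib

open MeasureTheory Set
open scoped ENNReal Matrix Laplacian Gradient

noncomputable section

namespace MagnetizedVP

/-- Physical space and velocity space `ℝ³`, with the Euclidean norm. Functions on the torus
`𝕋³ = (ℝ/2πℤ)³` are functions on `ℝ³` that are `2π`-periodic in each coordinate. -/
abbrev R3 : Type := EuclideanSpace ℝ (Fin 3)

/-- Fourier modes `k ∈ ℤ³`. -/
abbrev Mode : Type := Fin 3 → ℤ

/-- A mode as a real vector. -/
def Mode.toR3 (k : Mode) : R3 := WithLp.toLp 2 (fun i => (k i : ℝ))

/-- `h` is `2π`-periodic in each coordinate. -/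
def Periodic3 (h : R3 → ℝ) : Prop :=
  ∀ (k : Mode) (x : R3), h (x + (2 * Real.pi) • k.toR3) = h x

/-- The fundamental cell `[0, 2π]³` of the torus. -/
def cell : Set R3 := {x | ∀ i, x i ∈ Icc 0 (2 * Real.pi)}

/-! ### Fourier and Laplace transforms -/

/-- Fourier coefficient over the torus, `∫_{𝕋³} e^{-i k·x} h(x) dx`. -/
def torusFourier (h : R3 → ℝ) (k : Mode) : ℂ :=
  ∫ x in cell, Complex.exp (-Complex.I * (inner ℝ k.toR3 x : ℝ)) * (h x : ℂ)

/-- Fourier transform in velocity, `∫_{ℝ³} e^{-i ξ·v} h(v) dv`. -/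
def velFourier (h : R3 → ℝ) (ξ : R3) : ℂ :=
  ∫ v, Complex.exp (-Complex.I * (inner ℝ ξ v : ℝ)) * (h v : ℂ)

/-- The Laplace integral of `F` converges absolutely at `l`. -/
def LaplaceConv (F : ℝ → ℂ) (l : ℂ) : Prop :=
  IntegrableOn (fun t : ℝ => Complex.exp (-l * t) * F t) (Ioi 0)

/-- Laplace transform `L[F](l) = ∫₀^∞ e^{-l t} F(t) dt`. -/
def laplace (F : ℝ → ℂ) (l : ℂ) : ℂ :=
  ∫ t in Ioi (0 : ℝ), Complex.exp (-l * t) * F t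

/-! ### Gyro-rotation and free-streaming characteristics -/

/-- The rotation matrix `R(α)`. -/
def rot (α : ℝ) : Matrix (Fin 2) (Fin 2) ℝ :=
  !![Real.cos α, Real.sin α; -Real.sin α, Real.cos α]

/-- The `3 × 3` block-diagonal matrix `diag(A, c)`. -/
def block (A : Matrix (Fin 2) (Fin 2) ℝ) (c : ℝ) : Matrix (Fin 3) (Fin 3) ℝ :=
  !![A 0 0, A 0 1, 0; A 1 0, A 1 1, 0; 0, 0, c]

/-- A matrix acting on `ℝ³`. -/
def act (A : Matrix (Fin 3) (Fin 3) ℝ) (v : R3) : R3 := WithLp.toLp 2 (A *ᵥ v.ofLp)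

/-- The gyro-rotation matrix `R̃(t) = diag((R(π/2 - B₀t) - R(π/2)) / B₀, t)`. -/
def gyro (B₀ t : ℝ) : Matrix (Fin 3) (Fin 3) ℝ :=
  block ((1 / B₀) • (rot (Real.pi / 2 - B₀ * t) - rot (Real.pi / 2))) t

/-- `M(t) + Q`, with `M(t) = R(B₀t - π/2) / B₀` and `Q = R(π/2) / B₀`. -/
def shift (B₀ t : ℝ) : Matrix (Fin 2) (Fin 2) ℝ :=
  (1 / B₀) • rot (B₀ * t - Real.pi / 2) + (1 / B₀) • !![0, 1; -1, 0]

/-- Velocity `u(t; v)` on the free-streaming characteristic. -/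
def charVel (B₀ t : ℝ) (v : R3) : R3 := act (block (rot (B₀ * t)) 1) v

/-- Position `y(t; x, v)` on the free-streaming characteristic. -/
def charPos (B₀ t : ℝ) (x v : R3) : R3 := x + act (block (shift B₀ t) t) v

/-- `u⁻¹(t; v)`: the initial velocity of the characteristic with velocity `v` at time `t`. -/
def charVelInv (B₀ t : ℝ) (v : R3) : R3 := act (block (rot (-(B₀ * t))) 1) v

/-- `y⁻¹(t; x, v)`: the initial position of the characteristic that is at `(x, v)` at time `t`. -/
def charPosInv (B₀ t : ℝ) (x v : R3) : R3 :=
  x - act (block (shift B₀ t) t) (charVelInv B₀ t v)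

/-- The characteristics solve `y' = u`, `u' = u × B`. -/
theorem char_ode (B₀ : ℝ) (hB : B₀ ≠ 0) (t : ℝ) (x v : R3) (i : Fin 3) :
    HasDerivAt (fun s => charPos B₀ s x v i) (charVel B₀ t v i) t ∧
      HasDerivAt (fun s => charVel B₀ s v i)
        (![B₀ * charVel B₀ t v 1, -(B₀ * charVel B₀ t v 0), 0] i) t := by
  have hl : HasDerivAt (fun s : ℝ => B₀ * s) B₀ t := by
    simpa using (hasDerivAt_id t).const_mul B₀
  have hs : HasDerivAt (fun s : ℝ => Real.sin (B₀ * s)) (Real.cos (B₀ * t) * B₀) t :=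
    hl.sin
  have hc : HasDerivAt (fun s : ℝ => Real.cos (B₀ * s)) (-Real.sin (B₀ * t) * B₀) t :=
    hl.cos
  have key : ∀ (a b c : ℝ) (F : ℝ → ℝ) (F' : ℝ),
      (∀ s, F s = a * Real.sin (B₀ * s) + b * Real.cos (B₀ * s) + c) →
      F' = a * (Real.cos (B₀ * t) * B₀) + b * (-Real.sin (B₀ * t) * B₀) →
      HasDerivAt F F' t := by
    intro a b c F F' hF hF'
    rw [funext hF, hF']
    exact ((hs.const_mul a).add (hc.const_mul b)).add_const c
  fin_cases i <;> constructor <;>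
    simp [charPos, charVel, act, block, rot, shift, dotProduct, Fin.sum_univ_three,
      Real.cos_sub_pi_div_two, Real.sin_sub_pi_div_two]
  · exact key (B₀⁻¹ * v 0) (-(B₀⁻¹ * v 1)) (B₀⁻¹ * v 1) _ _ (fun s => by ring) (by field_simp)
  · exact key (v 1) (v 0) 0 _ _ (fun s => by ring) (by ring)
  · exact key (B₀⁻¹ * v 1) (B₀⁻¹ * v 0) (-(B₀⁻¹ * v 0)) _ _ (fun s => by ring)
      (by field_simp; ring)
  · exact key (-v 0) (v 1) 0 _ _ (fun s => by ring) (by ring)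
  · simpa using (hasDerivAt_id t).mul_const (v 2)
  · exact hasDerivAt_const _ _

theorem act_rot_neg (a : ℝ) (v : R3) :
    act (block (rot a) 1) (act (block (rot (-a)) 1) v) = v := by
  have h := Real.sin_sq_add_cos_sq a
  ext i
  fin_cases i <;> simp [act, block, rot, dotProduct, Fin.sum_univ_three]
  · linear_combination (v 0) * h
  · linear_combination (v 1) * h

/-- The characteristic issued from the inverse characteristic at `(x, v)` reaches `(x, v)`. -/
theorem char_charInv (B₀ t : ℝ) (x v : R3) :
    charPos B₀ t (charPosInv B₀ t x v) (charVelInv B₀ t v) = x ∧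
      charVel B₀ t (charVelInv B₀ t v) = v :=
  ⟨by simp [charPos, charPosInv], act_rot_neg _ v⟩

/-- Going back along the characteristic issued from `(x, v)` returns `(x, v)`. -/
theorem charInv_char (B₀ t : ℝ) (x v : R3) :
    charPosInv B₀ t (charPos B₀ t x v) (charVel B₀ t v) = x ∧
      charVelInv B₀ t (charVel B₀ t v) = v := by
  have h : charVelInv B₀ t (charVel B₀ t v) = v := by
    simpa [charVelInv, charVel] using act_rot_neg (-(B₀ * t)) v
  exact ⟨by simp [charPosInv, charPos, h], h⟩

/-- The free-streaming density `S(t, x) = ∫ f₀(y⁻¹(t; x, v), u⁻¹(t; v)) dv`. -/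
def freeDensity (B₀ : ℝ) (f₀ : R3 → R3 → ℝ) (t : ℝ) (x : R3) : ℝ :=
  ∫ v, f₀ (charPosInv B₀ t x v) (charVelInv B₀ t v)

/-! ### Equilibria, initial data and the linearized system -/

/-- `∇_v h(v) · (v × B)` for `B = (0, 0, B₀)`. -/
def magnetic (B₀ : ℝ) (h : R3 → ℝ) (v : R3) : ℝ :=
  v 1 * B₀ * (∇ h v) 0 - v 0 * B₀ * (∇ h v) 1

/-- A spatially homogeneous equilibrium `μ(v)`: a stationary solution with vanishing electric
field, of class `C³`, with derivatives up to order three that are `O((1 + |v|)⁻⁴)`. The density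
`∫ μ` of the neutralizing background is not normalized. -/
structure IsEquilibrium (B₀ : ℝ) (μ : R3 → ℝ) : Prop where
  smooth : ContDiff ℝ 3 μ
  decay : ∀ n : ℕ, n ≤ 3 → ∃ C : ℝ, ∀ v : R3, (1 + ‖v‖) ^ 4 * ‖iteratedFDeriv ℝ n μ v‖ ≤ C
  stationary : ∀ v : R3, magnetic B₀ μ v = 0

/-- Initial perturbations: periodic in `x`, of class `C³`, with derivatives up to order three that
are `O((1 + |v|)⁻⁴)` uniformly in `x`. -/
structure IsInitialDatum (f₀ : R3 → R3 → ℝ) : Prop where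
  periodic : ∀ v, Periodic3 (fun x => f₀ x v)
  smooth : ContDiff ℝ 3 (Function.uncurry f₀)
  decay : ∀ n : ℕ, n ≤ 3 → ∃ C : ℝ, ∀ x v : R3,
    (1 + ‖v‖) ^ 4 * ‖iteratedFDeriv ℝ n (Function.uncurry f₀) (x, v)‖ ≤ C

/-- The self-generated electric field `E = -∇U`. -/
def field (U : ℝ → R3 → ℝ) (t : ℝ) (x : R3) : R3 := -(∇ (U t) x)

/-- `(f, U)` is a classical solution, for all times `t ≥ 0`, of the magnetized Vlasov–Poisson
system linearized about `μ`, with initial datum `f₀`. -/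
structure IsSolution (B₀ : ℝ) (μ : R3 → ℝ) (f₀ : R3 → R3 → ℝ)
    (f : ℝ → R3 → R3 → ℝ) (U : ℝ → R3 → ℝ) : Prop where
  periodic_f : ∀ t, 0 ≤ t → ∀ v, Periodic3 (fun x => f t x v)
  periodic_U : ∀ t, 0 ≤ t → Periodic3 (U t)
  continuous_f : ContinuousOn (fun p : ℝ × R3 × R3 => f p.1 p.2.1 p.2.2) (Ici 0 ×ˢ univ)
  smooth_f : ContDiffOn ℝ 1 (fun p : ℝ × R3 × R3 => f p.1 p.2.1 p.2.2) (Ioi 0 ×ˢ univ)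
  integrable_f : ∀ t, 0 ≤ t → ∀ x, Integrable (fun v => f t x v)
  smooth_U : ∀ t, 0 ≤ t → ContDiff ℝ 2 (U t)
  continuous_field : ContinuousOn (fun p : ℝ × R3 => field U p.1 p.2) (Ici 0 ×ˢ univ)
  vlasov : ∀ t, 0 < t → ∀ x v : R3,
    deriv (fun s => f s x v) t + inner ℝ v (∇ (fun y => f t y v) x)
      + magnetic B₀ (fun w => f t x w) v + inner ℝ (field U t x) (∇ μ v) = 0
  poisson : ∀ t, 0 ≤ t → ∀ x, Δ (U t) x = -∫ v, f t x v
  initial : ∀ x v, f 0 x v = f₀ x v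

/-! ### Dispersion function and electric energy -/

/-- The matrix-valued function `t ↦ μ̂(R̃(t)k) R̃(t)`, entry `(i, j)`. -/
def kernelEntry (B₀ : ℝ) (μ : R3 → ℝ) (k : Mode) (i j : Fin 3) (t : ℝ) : ℂ :=
  velFourier μ (act (gyro B₀ t) k.toR3) * (gyro B₀ t i j : ℂ)

/-- The matrix `L[μ̂ R̃](l, k)`. -/
def kernelLaplace (B₀ : ℝ) (μ : R3 → ℝ) (k : Mode) (l : ℂ) : Matrix (Fin 3) (Fin 3) ℂ :=
  Matrix.of fun i j => laplace (kernelEntry B₀ μ k i j) l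

/-- The dispersion function `P(k, l) = k · (I + L[μ̂ R̃](l, k)) k`. -/
def dispersion (B₀ : ℝ) (μ : R3 → ℝ) (k : Mode) (l : ℂ) : ℂ :=
  (fun i => (k i : ℂ)) ⬝ᵥ ((1 + kernelLaplace B₀ μ k l) *ᵥ fun i => (k i : ℂ))

/-- The electric energy `½ ∫_{𝕋³} |E(t, x)|² dx`. -/
def energy (U : ℝ → R3 → ℝ) (t : ℝ) : ℝ :=
  1 / 2 * ∫ x in cell, ‖field U t x‖ ^ 2

/-- The electric energy of the mode `k`, `½ |Ê(t, k)|²`. -/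
def modeEnergy (U : ℝ → R3 → ℝ) (t : ℝ) (k : Mode) : ℝ :=
  1 / 2 * ∑ j : Fin 3, ‖torusFourier (fun x => field U t x j) k‖ ^ 2

/-- The part of the electric energy carried by a set `K` of modes (by Parseval, the whole electric
energy if `K` is the set of all modes). -/
def energyOn (U : ℝ → R3 → ℝ) (K : Set Mode) (t : ℝ) : ℝ≥0∞ :=
  ENNReal.ofReal (1 / (2 * Real.pi) ^ 3) * ∑' k : K, ENNReal.ofReal (modeEnergy U t k)

end MagnetizedVP

end

/-!
Integrating the linearized equation along the free-streaming characteristics, integrating in `v`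
and taking Fourier coefficients in `x` turns the Poisson equation into one Volterra equation per
mode (`IsSolution.volterra`),
`|k|² Û(t, k) + ∫₀ᵗ K(t - s) Û(s, k) ds = Ŝ(t, k)`, with
`K(t) = μ̂(R̃(t) k) k · R̃(t) k` (`modeKernel`). Its Laplace transform is the dispersion relation,
because `P(k, l) = |k|² + L[K](l)` (`dispersion_eq`, `laplace_volterra`); the growth bound
`volterra_growth`, uniform in `k ≠ 0`, provides the half-plane of absolute convergence.

For the bound on the energy, the modes with `k₃ ≠ 0` and with `k₃ = 0` behave differently.

If `k₃ ≠ 0`, phase mixing along the magnetic field makes `K` and `Ŝ` decay in time, so that both are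
square integrable. The transform `L[Û] = L[Ŝ] / P` then extends to `Re l > 0` under the Penrose
condition, Laplace inversion on a line far to the right can be moved to the imaginary axis, and
Plancherel's theorem there bounds the convolution `K * Û` by the product of the `L²` norms of `K`
and `Ŝ` divided by the lower bound of `|P|` (`volterra_penrose_bound`). Thus
`|k|² Û - Ŝ` is bounded in time.

If `k₃ = 0`, the kernel is periodic in time, and odd because an equilibrium is invariant under the
rotations about the magnetic field. Its Laplace transform is meromorphic with at most simple poles
on the imaginary axis, and a lower bound on `|P|` makes `1 / P` bounded in the right half-plane;
oddness continues `1 / P` to a bounded entire function, and Liouville's theorem forces `K = 0`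
(`periodic_kernel_eq_zero`, `modeKernel_eq_zero`). So `|k|² Û = Ŝ`.

In both cases the regularity of `f₀` in `x` gives `|Û(t, k)| ≤ D |k|⁻³` uniformly in `t`
(`IsSolution.exists_penrose_bound`), hence `|Ê(t, k)|² = |k|² |Û(t, k)|² ≤ D² |k|⁻⁴`, which is
summable over `ℤ³ \ {0}`. Parseval's identity turns the sum over all nonzero modes into the electric
energy (`IsSolution.energyOn_ne_zero`).
-/

noncomputable section

namespace MagnetizedVP

/-! ### The Fourier transform on the line -/

open scoped FourierTransform SchwartzMap in
/-- Plancherel's theorem for functions in `L¹ ∩ L²`: the Fourier integral agrees almost everywhere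
with the `L²` Fourier transform, since both define the same tempered distribution. -/
theorem eLpNorm_fourier_eq {f : ℝ → ℂ} (hf : Integrable f) (hf2 : MemLp f 2) :
    MemLp (𝓕 f) 2 ∧ eLpNorm (𝓕 f) 2 = eLpNorm f 2 := by
  set g : Lp ℂ 2 (volume : Measure ℝ) := hf2.toLp f
  have hcont : Continuous (𝓕 f) :=
    VectorFourier.fourierIntegral_continuous Real.continuous_fourierChar (by fun_prop) hf
  have hae : 𝓕 f =ᵐ[volume] (𝓕 g : Lp ℂ 2 (volume : Measure ℝ)) := by
    apply ae_eq_of_integral_contDiff_smul_eq hcont.locallyIntegrable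
      ((Lp.memLp _).locallyIntegrable (by norm_num))
    intro φ hφ hc
    have hφ' : ContDiff ℝ ((⊤ : ℕ∞) : WithTop ℕ∞) (fun x => (φ x : ℂ)) :=
        Complex.ofRealCLM.contDiff.comp hφ
    have hc' : HasCompactSupport (fun x => (φ x : ℂ)) := hc.comp_left (g := Complex.ofReal) rfl
    set ψ : 𝓢(ℝ, ℂ) := hc'.toSchwartzMap hφ'
    have h1 := congrArg (fun T => T ψ) (Lp.fourier_toTemperedDistribution_eq g)
    simp only [TemperedDistribution.fourier_apply, Lp.toTemperedDistribution_apply] at h1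
    have h2 : ∫ x, (𝓕 ψ) x • (g : ℝ → ℂ) x = ∫ x, (𝓕 ψ) x • f x := by
      refine integral_congr_ae ?_
      filter_upwards [hf2.coeFn_toLp] with x hx
      rw [hx]
    have h3 := VectorFourier.integral_fourierIntegral_smul_eq_flip (μ := volume) (ν := volume)
      (L := innerₗ ℝ) (f := ψ) (g := f) Real.continuous_fourierChar
      (by simp only [innerₗ_apply_apply]; exact continuous_inner) ψ.integrable hf
    have h4 : (innerₗ ℝ : ℝ →ₗ[ℝ] ℝ →ₗ[ℝ] ℝ).flip = innerₗ ℝ := by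
      ext; simp
    rw [h4] at h3
    have h5 : ∫ x, ψ x • 𝓕 f x = ∫ x, ψ x • (𝓕 g : Lp ℂ 2 (volume : Measure ℝ)) x := by
      rw [← h1, h2]; exact h3.symm
    have h6 : ∀ x, ψ x = (φ x : ℂ) := fun x => rfl
    simpa [h6] using h5
  have hn : eLpNorm (𝓕 g : Lp ℂ 2 (volume : Measure ℝ)) 2 = eLpNorm f 2 := by
    have := Lp.norm_fourier_eq g
    rw [Lp.norm_def, Lp.norm_def,
      ENNReal.toReal_eq_toReal_iff' (Lp.eLpNorm_ne_top _) (Lp.eLpNorm_ne_top _)] at this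
    rw [this]
    exact eLpNorm_congr_ae hf2.coeFn_toLp
  exact ⟨(memLp_congr_ae hae).2 (Lp.memLp _), (eLpNorm_congr_ae hae).trans hn⟩

/-- The function `e^{-x t} F(t)` on `t > 0`, extended by zero: its Fourier transform is the
restriction of the Laplace transform of `F` to the line `Re l = x`. -/
def damped (F : ℝ → ℂ) (x : ℝ) : ℝ → ℂ :=
  indicator (Ioi 0) (fun t => Complex.exp (-(x : ℂ) * t) * F t)

open scoped FourierTransform in
theorem fourier_damped (F : ℝ → ℂ) (x w : ℝ) :
    𝓕 (damped F x) w = laplace F (x + (2 * Real.pi * w : ℝ) * Complex.I) := by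
  rw [Real.fourier_real_eq_integral_exp_smul, laplace, ← integral_indicator measurableSet_Ioi]
  congr 1
  ext t
  by_cases ht : t ∈ Ioi (0 : ℝ)
  · simp only [damped, indicator_of_mem ht, smul_eq_mul]
    rw [← mul_assoc, ← Complex.exp_add]
    congr 2
    push_cast
    ring
  · simp [damped, indicator_of_notMem ht]

theorem norm_exp_neg_mul (l : ℂ) (t : ℝ) :
    ‖Complex.exp (-l * t)‖ = Real.exp (-l.re * t) := by
  simp [Complex.norm_exp]

theorem integrable_damped {F : ℝ → ℂ} {x : ℝ} (h : LaplaceConv F x) :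
    Integrable (damped F x) :=
  (integrable_indicator_iff measurableSet_Ioi).2 h

/-- A continuous function of exponential growth has a convergent Laplace integral. -/
theorem laplaceConv_of_growth {F : ℝ → ℂ} (hc : ContinuousOn F (Ioi 0)) {C s : ℝ}
    (hb : ∀ t, 0 < t → ‖F t‖ ≤ C * Real.exp (s * t)) {l : ℂ} (hl : s < l.re) :
    LaplaceConv F l := by
  have hi : IntegrableOn (fun t : ℝ => C * Real.exp ((s - l.re) * t)) (Ioi 0) :=
    (integrableOn_exp_mul_Ioi (by linarith) 0).const_mul C
  refine Integrable.mono' hi ?_ ?_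
  · exact (ContinuousOn.mul (by fun_prop) hc).aestronglyMeasurable measurableSet_Ioi
  · refine (ae_restrict_iff' measurableSet_Ioi).2 (Filter.Eventually.of_forall fun t ht => ?_)
    rw [norm_mul, norm_exp_neg_mul]
    calc Real.exp (-l.re * t) * ‖F t‖ ≤ Real.exp (-l.re * t) * (C * Real.exp (s * t)) := by
          gcongr; exact hb t ht
      _ = C * Real.exp ((s - l.re) * t) := by
          rw [sub_mul, sub_eq_add_neg, Real.exp_add, neg_mul]; ring

/-- The Laplace transform is holomorphic to the right of an abscissa of absolute convergence. -/
theorem differentiableAt_laplace {F : ℝ → ℂ} {x : ℝ} (h : LaplaceConv F x) {l : ℂ}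
    (hl : x < l.re) : DifferentiableAt ℂ (laplace F) l := by
  set d := (l.re - x) / 2 with hd
  have hd0 : 0 < d := by rw [hd]; linarith
  have hmeas : ∀ z : ℂ, AEStronglyMeasurable (fun t : ℝ => Complex.exp (-z * t) * F t)
      (volume.restrict (Ioi 0)) := by
    intro z
    have : AEStronglyMeasurable (fun t : ℝ => Complex.exp ((x - z) * t) *
        (Complex.exp (-(x : ℂ) * t) * F t)) (volume.restrict (Ioi 0)) :=
      (by fun_prop : Continuous fun t : ℝ => Complex.exp ((x - z) * t)).aestronglyMeasurable.mul
        h.aestronglyMeasurable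
    refine this.congr (Filter.Eventually.of_forall fun t => ?_)
    simp only
    rw [← mul_assoc, ← Complex.exp_add]
    ring_nf
  have hs : Metric.ball l d ∈ nhds l := Metric.ball_mem_nhds _ hd0
  have hre : ∀ z ∈ Metric.ball l d, x + d ≤ z.re := by
    intro z hz
    have h1 : |(z - l).re| ≤ ‖z - l‖ := Complex.abs_re_le_norm _
    rw [Metric.mem_ball, dist_eq_norm] at hz
    have := (abs_lt.1 (h1.trans_lt hz)).1
    simp only [Complex.sub_re] at this
    rw [hd] at this ⊢
    linarith
  refine (hasDerivAt_integral_of_dominated_loc_of_deriv_le (𝕜 := ℂ)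
    (F := fun (z : ℂ) (t : ℝ) => Complex.exp (-z * t) * F t)
    (F' := fun (z : ℂ) (t : ℝ) => -(t : ℂ) * (Complex.exp (-z * t) * F t))
    (bound := fun t : ℝ => (1 / d) * ‖Complex.exp (-(x : ℂ) * t) * F t‖)
    hs (Filter.Eventually.of_forall hmeas) ?_ ?_ ?_ ?_ ?_).2.differentiableAt
  · have h2 : LaplaceConv F l := by
      refine Integrable.mono h (hmeas l) ?_
      refine (ae_restrict_iff' measurableSet_Ioi).2 (Filter.Eventually.of_forall fun t ht => ?_)
      rw [norm_mul, norm_mul, norm_exp_neg_mul, norm_exp_neg_mul]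
      have ht' : (0 : ℝ) < t := ht
      rw [Complex.ofReal_re]
      have : Real.exp (-l.re * t) ≤ Real.exp (-x * t) := by gcongr
      gcongr
    exact h2
  · exact (by fun_prop : Continuous fun t : ℝ => -(t : ℂ)).aestronglyMeasurable.mul (hmeas l)
  · refine (ae_restrict_iff' measurableSet_Ioi).2 (Filter.Eventually.of_forall fun t ht z hz => ?_)
    have ht' : (0 : ℝ) < t := ht
    rw [norm_mul, norm_mul, norm_mul, norm_exp_neg_mul, norm_exp_neg_mul, ← mul_assoc, ← mul_assoc,
      norm_neg, Complex.norm_real, Real.norm_of_nonneg ht'.le, Complex.ofReal_re]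
    refine mul_le_mul_of_nonneg_right ?_ (norm_nonneg _)
    -- `d t ≤ e^{d t}` absorbs the factor `t` produced by the derivative
    have h3 : d * t ≤ Real.exp (d * t) := by linarith [Real.add_one_le_exp (d * t)]
    have h4 : Real.exp (-z.re * t) ≤ Real.exp (-x * t) * Real.exp (-(d * t)) := by
      rw [← Real.exp_add]
      apply Real.exp_le_exp.2
      nlinarith [hre z hz]
    calc t * Real.exp (-z.re * t) ≤ (1 / d * Real.exp (d * t)) *
          (Real.exp (-x * t) * Real.exp (-(d * t))) := by
          gcongr
          rw [one_div, inv_mul_eq_div, le_div_iff₀ hd0]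
          linarith
      _ = 1 / d * Real.exp (-x * t) := by
          rw [Real.exp_neg]
          field_simp
  · exact h.norm.const_mul _
  · refine Filter.Eventually.of_forall fun t z _ => ?_
    have h5 : HasDerivAt (fun z : ℂ => Complex.exp (-z * t)) (Complex.exp (-z * t) * (-1 * t)) z :=
      ((hasDerivAt_neg z).mul_const (t : ℂ)).cexp
    convert! h5.mul_const (F t) using 1
    ring

/-- Riemann–Lebesgue on a vertical line. -/
theorem tendsto_laplace_vertical (F : ℝ → ℂ) (x : ℝ) :
    Filter.Tendsto (fun y : ℝ => laplace F (x + y * Complex.I)) (Filter.cocompact ℝ) (nhds 0) := by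
  have h := Real.zero_at_infty_fourier (damped F x)
  have hp : (2 * Real.pi)⁻¹ ≠ 0 := by positivity
  have h2 : Filter.Tendsto (fun y : ℝ => (2 * Real.pi)⁻¹ * y) (Filter.cocompact ℝ)
      (Filter.cocompact ℝ) :=
    (Homeomorph.mulLeft₀ _ hp).isClosedEmbedding.tendsto_cocompact
  refine (h.comp h2).congr fun y => ?_
  simp only [Function.comp]
  rw [fourier_damped]
  congr 4
  field_simp

theorem norm_laplace_le {F : ℝ → ℂ} {x : ℝ} (h : LaplaceConv F x) {l : ℂ} (hl : x ≤ l.re) :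
    ‖laplace F l‖ ≤ ∫ t in Ioi (0 : ℝ), ‖Complex.exp (-(x : ℂ) * t) * F t‖ := by
  refine norm_integral_le_of_norm_le h.norm ?_
  refine (ae_restrict_iff' measurableSet_Ioi).2 (Filter.Eventually.of_forall fun t ht => ?_)
  have ht' : (0 : ℝ) < t := ht
  rw [norm_mul, norm_mul, norm_exp_neg_mul, norm_exp_neg_mul]
  rw [Complex.ofReal_re]
  have : Real.exp (-l.re * t) ≤ Real.exp (-x * t) := by gcongr
  gcongr

/-- A vertical line of integration may be moved across a strip in which the integrand is
holomorphic, bounded, and tends to zero along every vertical line. -/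
theorem integral_vertical_eq {G : ℂ → ℂ} {a b M : ℝ} (hab : a ≤ b)
    (hd : ∀ z : ℂ, a ≤ z.re → z.re ≤ b → DifferentiableAt ℂ G z)
    (hM : ∀ z : ℂ, a ≤ z.re → z.re ≤ b → ‖G z‖ ≤ M)
    (ht : ∀ x : ℝ, a ≤ x → x ≤ b →
      Filter.Tendsto (fun y : ℝ => G (x + y * Complex.I)) (Filter.cocompact ℝ) (nhds 0))
    (ha : Integrable (fun y : ℝ => G (a + y * Complex.I)))
    (hb : Integrable (fun y : ℝ => G (b + y * Complex.I))) :
    ∫ y : ℝ, G (a + y * Complex.I) = ∫ y : ℝ, G (b + y * Complex.I) := by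
  have hhor : ∀ s : ℕ → ℝ, Filter.Tendsto s Filter.atTop (Filter.cocompact ℝ) →
      Filter.Tendsto (fun n => ∫ x in a..b, G (x + s n * Complex.I)) Filter.atTop (nhds 0) := by
    intro s hs
    have h := intervalIntegral.tendsto_integral_filter_of_dominated_convergence (μ := volume)
      (a := a) (b := b) (l := Filter.atTop) (F := fun (n : ℕ) (x : ℝ) => G (x + s n * Complex.I))
      (f := fun _ => 0) (fun _ => M) ?_ ?_ ?_ ?_
    · simpa using h
    · refine Filter.Eventually.of_forall fun n => ?_
      rw [uIoc_of_le hab]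
      refine ContinuousOn.aestronglyMeasurable (fun x hx => ?_) measurableSet_Ioc
      have h1 : ContinuousAt G ((x : ℂ) + s n * Complex.I) :=
        (hd _ (by simpa using hx.1.le) (by simpa using hx.2)).continuousAt
      exact (ContinuousAt.comp (f := fun x : ℝ => (x : ℂ) + s n * Complex.I) h1
        (by fun_prop)).continuousWithinAt
    · refine Filter.Eventually.of_forall fun n => Filter.Eventually.of_forall fun x hx => ?_
      rw [uIoc_of_le hab] at hx
      exact hM _ (by simpa using hx.1.le) (by simpa using hx.2)
    · exact intervalIntegrable_const
    · refine Filter.Eventually.of_forall fun x hx => ?_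
      rw [uIoc_of_le hab] at hx
      exact (ht x hx.1.le hx.2).comp hs
  have hn : Filter.Tendsto (fun n : ℕ => (n : ℝ)) Filter.atTop Filter.atTop :=
    tendsto_natCast_atTop_atTop
  have hn' : Filter.Tendsto (fun n : ℕ => -(n : ℝ)) Filter.atTop Filter.atBot :=
    Filter.tendsto_neg_atTop_atBot.comp hn
  have hup := hhor (fun n => (n : ℝ)) (hn.mono_right
      (by rw [cocompact_eq_atBot_atTop]; exact le_sup_right))
  have hdn := hhor (fun n => -(n : ℝ)) (hn'.mono_right
      (by rw [cocompact_eq_atBot_atTop]; exact le_sup_left))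
  have hA := intervalIntegral_tendsto_integral ha hn' hn
  have hB := intervalIntegral_tendsto_integral hb hn' hn
  -- Cauchy's theorem on the rectangle `[a, b] × [-n, n]`
  have hrect : ∀ n : ℕ, (∫ x in a..b, G (x + (-(n : ℝ) : ℝ) * Complex.I))
      - (∫ x in a..b, G (x + (n : ℝ) * Complex.I))
      + Complex.I • (∫ y in (-(n : ℝ))..n, G (b + y * Complex.I))
      - Complex.I • (∫ y in (-(n : ℝ))..n, G (a + y * Complex.I)) = 0 := by
    intro n
    have := Complex.integral_boundary_rect_eq_zero_of_differentiableOn G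
      ⟨a, -(n : ℝ)⟩ ⟨b, n⟩ (fun z hz => ?_)
    · simpa using this
    · have h1 := hz.1
      simp only [mem_preimage, uIcc_of_le hab] at h1
      exact (hd z h1.1 h1.2).differentiableWithinAt
  have hlim := ((hdn.sub hup).add (hB.const_smul Complex.I)).sub (hA.const_smul Complex.I)
  have h0 := tendsto_nhds_unique (hlim.congr hrect) tendsto_const_nhds
  simp only [sub_zero, zero_add, smul_eq_mul, ← mul_sub, mul_eq_zero, Complex.I_ne_zero,
    false_or] at h0
  exact (sub_eq_zero.1 h0).symm

theorem integrable_vertical_iff {E : Type*} [NormedAddCommGroup E] [NormedSpace ℝ E]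
    (g : ℝ → E) : Integrable (fun w : ℝ => g (2 * Real.pi * w)) ↔ Integrable g :=
  integrable_comp_mul_left_iff g (by positivity)

theorem integral_comp_two_pi_mul {E : Type*} [NormedAddCommGroup E] [NormedSpace ℝ E]
    (g : ℝ → E) : ∫ w : ℝ, g (2 * Real.pi * w) = (2 * Real.pi)⁻¹ • ∫ y, g y := by
  rw [Measure.integral_comp_mul_left, abs_of_pos (by positivity)]

open scoped FourierTransform in
/-- Laplace inversion on the line `Re l = x`. -/
theorem laplace_inversion {F : ℝ → ℂ} {x t : ℝ} (h : LaplaceConv F x) (ht : 0 < t)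
    (hc : ContinuousAt F t) (hi : Integrable (fun y : ℝ => laplace F (x + y * Complex.I))) :
    ∫ y : ℝ, Complex.exp ((x + y * Complex.I) * t) * laplace F (x + y * Complex.I)
      = 2 * Real.pi * F t := by
  have hF : 𝓕 (damped F x) = fun w => (fun y : ℝ => laplace F (x + y * Complex.I))
      (2 * Real.pi * w) := by
    ext w
    simp only [fourier_damped]
  have hev : damped F x =ᶠ[nhds t] fun t => Complex.exp (-(x : ℂ) * t) * F t := by
    filter_upwards [Ioi_mem_nhds ht] with s hs
    simp only [damped, indicator_of_mem hs]
  have hinv := (integrable_damped h).fourierInv_fourier_eq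
    (by rw [hF]; exact (integrable_vertical_iff _).2 hi) (v := t)
    (((by fun_prop : ContinuousAt (fun t : ℝ => Complex.exp (-(x : ℂ) * t)) t).mul
      hc).congr hev.symm)
  rw [hev.self_of_nhds, Real.fourierInv_eq', hF] at hinv
  have h2 : ∫ w : ℝ, Complex.exp (((2 * Real.pi * inner ℝ w t : ℝ)) * Complex.I) •
      (fun y : ℝ => laplace F (x + y * Complex.I)) (2 * Real.pi * w)
      = (2 * Real.pi)⁻¹ • ∫ y : ℝ, Complex.exp (y * t * Complex.I) *
          laplace F (x + y * Complex.I) := by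
    rw [← integral_comp_two_pi_mul]
    congr 1
    ext w
    simp only [smul_eq_mul]
    congr 2
    simp
    ring
  rw [h2] at hinv
  have h3 : ∀ y : ℝ, Complex.exp ((x + y * Complex.I) * t) * laplace F (x + y * Complex.I)
      = Complex.exp (x * t) * (Complex.exp (y * t * Complex.I) *
          laplace F (x + y * Complex.I)) := by
    intro y
    rw [← mul_assoc, ← Complex.exp_add]
    ring_nf
  simp_rw [h3]
  rw [integral_const_mul]
  have hp : (2 * Real.pi : ℂ) ≠ 0 := by exact_mod_cast (by positivity : (2 * Real.pi : ℝ) ≠ 0)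
  have h4 : ∫ y : ℝ, Complex.exp (y * t * Complex.I) * laplace F (x + y * Complex.I)
      = 2 * Real.pi * (Complex.exp (-(x : ℂ) * t) * F t) := by
    beta_reduce at hinv
    rw [← hinv, Complex.real_smul]
    push_cast
    rw [mul_inv_cancel_left₀ hp]
  rw [h4]
  calc Complex.exp (x * t) * (2 * Real.pi * (Complex.exp (-(x : ℂ) * t) * F t))
      = 2 * Real.pi * F t * (Complex.exp (x * t) * Complex.exp (-(x : ℂ) * t)) := by ring
    _ = 2 * Real.pi * F t := by rw [← Complex.exp_add]; simp

open scoped FourierTransform in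
/-- Plancherel's theorem for the Laplace transform on the line `Re l = x`. -/
theorem laplace_plancherel {F : ℝ → ℂ} {x : ℝ} (h : LaplaceConv F x)
    (h2 : MemLp (damped F x) 2) :
    MemLp (fun y : ℝ => laplace F (x + y * Complex.I)) 2 ∧
      ∫ y : ℝ, ‖laplace F (x + y * Complex.I)‖ ^ 2
        = 2 * Real.pi * ∫ t, ‖damped F x t‖ ^ 2 := by
  obtain ⟨hm, he⟩ := eLpNorm_fourier_eq (integrable_damped h) h2
  have hF : 𝓕 (damped F x) = fun w => (fun y : ℝ => laplace F (x + y * Complex.I))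
      (2 * Real.pi * w) := by
    ext w
    simp only [fourier_damped]
  have hmeas : AEStronglyMeasurable (fun y : ℝ => laplace F (x + y * Complex.I)) := by
    have h3 : (fun y : ℝ => laplace F (x + y * Complex.I))
        = fun y => 𝓕 (damped F x) ((2 * Real.pi)⁻¹ * y) := by
      ext y
      rw [hF]
      simp only
      congr 4
      field_simp
    rw [h3]
    have hcont : Continuous (𝓕 (damped F x)) :=
      VectorFourier.fourierIntegral_continuous Real.continuous_fourierChar (by fun_prop)
        (integrable_damped h)
    exact (hcont.comp (continuous_const.mul continuous_id)).aestronglyMeasurable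
  constructor
  · rw [memLp_two_iff_integrable_sq_norm hmeas]
    rw [memLp_two_iff_integrable_sq_norm hm.1, hF] at hm
    exact (integrable_vertical_iff (fun y : ℝ => ‖laplace F (x + y * Complex.I)‖ ^ 2)).1 hm
  · have h4 : ∫ w, ‖𝓕 (damped F x) w‖ ^ 2 = ∫ t, ‖damped F x t‖ ^ 2 := by
      have e1 := hm.eLpNorm_eq_integral_rpow_norm (by norm_num) (by norm_num)
      have e2 := h2.eLpNorm_eq_integral_rpow_norm (by norm_num) (by norm_num)
      rw [e1, e2, ENNReal.ofReal_eq_ofReal_iff (by positivity) (by positivity)] at he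
      simp only [ENNReal.toReal_ofNat, Real.rpow_ofNat] at he
      exact (Real.rpow_left_inj (by positivity) (by positivity) (by norm_num)).1 he
    rw [← h4, hF, integral_comp_two_pi_mul (fun y : ℝ => ‖laplace F (x + y * Complex.I)‖ ^ 2),
      smul_eq_mul, mul_inv_cancel_left₀ (by positivity)]

/-- A continuous function bounded by `A / (1 + t)` has damped `L²` norm at most `A`. -/
theorem memLp_damped {F : ℝ → ℂ} (hc : ContinuousOn F (Ioi 0)) {A x : ℝ} (hx : 0 ≤ x)
    (hb : ∀ t, 0 < t → ‖F t‖ ≤ A / (1 + t)) :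
    MemLp (damped F x) 2 ∧ ∫ t, ‖damped F x t‖ ^ 2 ≤ A ^ 2 := by
  -- the square of the bound has the primitive `-A² / (1 + t)`
  have hderiv : ∀ t ∈ Ioi (0 : ℝ), HasDerivAt (fun t : ℝ => -(A ^ 2) * (1 + t)⁻¹)
      (A ^ 2 * ((1 + t) ^ 2)⁻¹) t := by
    intro t ht
    have ht' : (0 : ℝ) < t := ht
    have h1 : HasDerivAt (fun t : ℝ => 1 + t) 1 t := (hasDerivAt_id t).const_add 1
    convert! (h1.fun_inv (by positivity)).const_mul (-(A ^ 2)) using 1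
    field_simp
  have hcw : ContinuousWithinAt (fun t : ℝ => -(A ^ 2) * (1 + t)⁻¹) (Ici 0) 0 := by
    apply ContinuousAt.continuousWithinAt
    exact continuousAt_const.mul ((continuousAt_const.add continuousAt_id).inv₀ (by simp))
  have hlim : Filter.Tendsto (fun t : ℝ => -(A ^ 2) * (1 + t)⁻¹) Filter.atTop (nhds 0) := by
    have : Filter.Tendsto (fun t : ℝ => (1 + t)⁻¹) Filter.atTop (nhds 0) :=
      Filter.Tendsto.inv_tendsto_atTop (Filter.tendsto_atTop_add_const_left _ _ Filter.tendsto_id)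
    simpa using this.const_mul (-(A ^ 2))
  have hint : IntegrableOn (fun t : ℝ => A ^ 2 * ((1 + t) ^ 2)⁻¹) (Ioi 0) :=
    integrableOn_Ioi_deriv_of_nonneg hcw hderiv (fun t _ => by positivity) hlim
  have hval := integral_Ioi_of_hasDerivAt_of_tendsto hcw hderiv hint hlim
  have hmeas : AEStronglyMeasurable (damped F x) :=
    (aestronglyMeasurable_indicator_iff measurableSet_Ioi).2
      ((ContinuousOn.mul (by fun_prop) hc).aestronglyMeasurable measurableSet_Ioi)
  have hle : ∀ t, ‖damped F x t‖ ^ 2 ≤ indicator (Ioi 0) (fun t => A ^ 2 * ((1 + t) ^ 2)⁻¹) t := by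
    intro t
    by_cases ht : t ∈ Ioi (0 : ℝ)
    · have ht' : (0 : ℝ) < t := ht
      simp only [damped, indicator_of_mem ht]
      rw [norm_mul, norm_exp_neg_mul, Complex.ofReal_re]
      have h1 : Real.exp (-x * t) ≤ 1 := Real.exp_le_one_iff.2 (by nlinarith)
      have h2 : Real.exp (-x * t) * ‖F t‖ ≤ A / (1 + t) :=
        (mul_le_of_le_one_left (norm_nonneg _) h1).trans (hb t ht')
      calc (Real.exp (-x * t) * ‖F t‖) ^ 2 ≤ (A / (1 + t)) ^ 2 := by gcongr
        _ = A ^ 2 * ((1 + t) ^ 2)⁻¹ := by rw [div_pow, div_eq_mul_inv]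
    · simp [damped, indicator_of_notMem ht]
  have hint' := (integrable_indicator_iff measurableSet_Ioi).2 hint
  have hsq : Integrable (fun t => ‖damped F x t‖ ^ 2) :=
    Integrable.mono' hint' (hmeas.norm.pow 2) (Filter.Eventually.of_forall fun t => by
      rw [Real.norm_of_nonneg (by positivity)]; exact hle t)
  refine ⟨(memLp_two_iff_integrable_sq_norm hmeas).2 hsq, ?_⟩
  refine (integral_mono hsq hint' hle).trans ?_
  rw [integral_indicator measurableSet_Ioi, hval]
  simp

/-- The Laplace transforms of two functions bounded by `A / (1 + t)` and `B / (1 + t)` have an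
integrable product on vertical lines. -/
theorem integral_laplace_mul_le {F G : ℝ → ℂ} (hF : ContinuousOn F (Ioi 0))
    (hG : ContinuousOn G (Ioi 0)) {A B x : ℝ} (hA : 0 ≤ A) (hB : 0 ≤ B) (hx : 0 < x)
    (hbF : ∀ t, 0 < t → ‖F t‖ ≤ A / (1 + t)) (hbG : ∀ t, 0 < t → ‖G t‖ ≤ B / (1 + t)) :
    Integrable (fun y : ℝ => ‖laplace F (x + y * Complex.I)‖ * ‖laplace G (x + y * Complex.I)‖) ∧
    ∫ y : ℝ, ‖laplace F (x + y * Complex.I)‖ * ‖laplace G (x + y * Complex.I)‖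
      ≤ 2 * Real.pi * (A * B) := by
  have hconv : ∀ {H : ℝ → ℂ} {C : ℝ}, 0 ≤ C → ContinuousOn H (Ioi 0) →
      (∀ t, 0 < t → ‖H t‖ ≤ C / (1 + t)) → LaplaceConv H x := by
    intro H C hC hH hb
    refine laplaceConv_of_growth hH (C := C) (s := 0) (fun t ht => (hb t ht).trans ?_) (by simpa)
    simp only [zero_mul, Real.exp_zero, mul_one]
    exact div_le_self hC (by linarith)
  obtain ⟨mF, eF⟩ := laplace_plancherel (hconv hA hF hbF) (memLp_damped hF hx.le hbF).1
  obtain ⟨mG, eG⟩ := laplace_plancherel (hconv hB hG hbG) (memLp_damped hG hx.le hbG).1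
  have lF := (memLp_damped hF hx.le hbF).2
  have lG := (memLp_damped hG hx.le hbG).2
  refine ⟨MemLp.integrable_mul mF.norm mG.norm, ?_⟩
  refine (integral_mul_le_Lp_mul_Lq_of_nonneg Real.HolderConjugate.two_two
    (Filter.Eventually.of_forall fun _ => norm_nonneg _)
    (Filter.Eventually.of_forall fun _ => norm_nonneg _)
    (by simpa using mF.norm) (by simpa using mG.norm)).trans ?_
  simp only [Real.rpow_ofNat, ← Real.sqrt_eq_rpow, eF, eG]
  rw [← Real.sqrt_mul (by positivity)]
  refine (Real.sqrt_le_left (by positivity)).2 ?_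
  calc 2 * Real.pi * (∫ t, ‖damped F x t‖ ^ 2) * (2 * Real.pi * ∫ t, ‖damped G x t‖ ^ 2)
      ≤ 2 * Real.pi * A ^ 2 * (2 * Real.pi * B ^ 2) := by gcongr
    _ = (2 * Real.pi * (A * B)) ^ 2 := by ring

/-- The Laplace transform of a causal convolution. -/
theorem laplace_convolution {K u : ℝ → ℂ} {l : ℂ} (hK : LaplaceConv K l) (hu : LaplaceConv u l) :
    LaplaceConv (fun t => ∫ s in (0 : ℝ)..t, K (t - s) * u s) l ∧
      laplace (fun t => ∫ s in (0 : ℝ)..t, K (t - s) * u s) l = laplace K l * laplace u l := by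
  have hpt : ∀ t : ℝ, ∫ s in (0 : ℝ)..t, ContinuousLinearMap.mul ℝ ℂ
      (Complex.exp (-l * s) * u s) (Complex.exp (-l * (t - s : ℝ)) * K (t - s))
      = Complex.exp (-l * t) * ∫ s in (0 : ℝ)..t, K (t - s) * u s := by
    intro t
    rw [← intervalIntegral.integral_const_mul]
    congr 1
    ext s
    have : Complex.exp (-l * t) = Complex.exp (-l * s) * Complex.exp (-l * (t - s : ℝ)) := by
      rw [← Complex.exp_add]; push_cast; ring_nf
    rw [ContinuousLinearMap.mul_apply', this]
    ring
  constructor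
  · have h := integrable_posConvolution (μ := volume) (ν := volume) hu hK
      (ContinuousLinearMap.mul ℝ ℂ)
    have h2 := (integrable_indicator_iff measurableSet_Ioi).1 h
    exact h2.congr (Filter.Eventually.of_forall hpt)
  · have h := integral_posConvolution (μ := volume) (ν := volume) hu hK
      (ContinuousLinearMap.mul ℝ ℂ)
    simp only [hpt] at h
    rw [laplace, h, ContinuousLinearMap.mul_apply', mul_comm]
    rfl

/-! ### Volterra equations with a causal convolution kernel -/

/-- Taking Laplace transforms in `a u + K * u = S`. -/
theorem laplace_volterra {K u S : ℝ → ℂ} {a : ℂ} {l : ℂ}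
    (hV : ∀ t, 0 ≤ t → a * u t + ∫ s in (0 : ℝ)..t, K (t - s) * u s = S t)
    (hK : LaplaceConv K l) (hu : LaplaceConv u l) :
    LaplaceConv S l ∧ (a + laplace K l) * laplace u l = laplace S l := by
  obtain ⟨h1, h2⟩ := laplace_convolution hK hu
  have hpt : ∀ t ∈ Ioi (0 : ℝ), a * (Complex.exp (-l * t) * u t)
      + Complex.exp (-l * t) * (∫ s in (0 : ℝ)..t, K (t - s) * u s)
      = Complex.exp (-l * t) * S t := by
    intro t ht
    have ht' : (0 : ℝ) < t := ht
    rw [← hV t ht'.le]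
    ring
  have h3 : IntegrableOn (fun t : ℝ => a * (Complex.exp (-l * t) * u t)) (Ioi 0) :=
    hu.const_mul a
  constructor
  · exact (h3.add h1).congr_fun hpt measurableSet_Ioi
  · rw [add_mul, ← h2]
    unfold laplace
    rw [← integral_const_mul, ← integral_add h3 h1]
    exact setIntegral_congr_fun measurableSet_Ioi hpt

/-- A Gronwall bound: if the kernel is at most `a c eᵗ` and the source at most `B`, the solution
grows at most at the rate `1 + 2 c`, whatever `a > 0` is. -/
theorem volterra_growth {K u S : ℝ → ℂ} {a c B : ℝ} (ha : 0 < a) (hc : 0 ≤ c)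
    (hV : ∀ t, 0 ≤ t → (a : ℂ) * u t + ∫ s in (0 : ℝ)..t, K (t - s) * u s = S t)
    (hu : ContinuousOn u (Ici 0))
    (hK : ∀ t, 0 ≤ t → ‖K t‖ ≤ a * c * Real.exp t) (hS : ∀ t, 0 ≤ t → ‖S t‖ ≤ B) :
    ∀ t, 0 ≤ t → ‖u t‖ ≤ 2 * B / a * Real.exp ((1 + 2 * c + 1) * t) := by
  intro T hT
  set r : ℝ := 1 + 2 * c + 1 with hr
  have hB : 0 ≤ B := (norm_nonneg _).trans (hS 0 le_rfl)
  -- `m` maximizes `|u| e^{-r t}` on `[0, T]`; the equation at time `m` bounds the maximum `M`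
  have hcont : ContinuousOn (fun t => ‖u t‖ * Real.exp (-r * t)) (Icc 0 T) :=
    (hu.mono Icc_subset_Ici_self).norm.mul (by fun_prop)
  obtain ⟨m, hm, hmax⟩ := isCompact_Icc.exists_isMaxOn (nonempty_Icc.2 hT) hcont
  set M := ‖u m‖ * Real.exp (-r * m) with hM
  have hM0 : 0 ≤ M := by positivity
  have hle : ∀ s ∈ Icc 0 T, ‖u s‖ ≤ M * Real.exp (r * s) := by
    intro s hs
    have h1 : ‖u s‖ * Real.exp (-r * s) ≤ M := hmax hs
    calc ‖u s‖ = ‖u s‖ * Real.exp (-r * s) * Real.exp (r * s) := by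
          rw [mul_assoc, ← Real.exp_add]; simp
      _ ≤ M * Real.exp (r * s) := by gcongr
  -- the convolution term is at most half of `a M e^{r m}`
  have hint : ‖∫ s in (0 : ℝ)..m, K (m - s) * u s‖ ≤ a * M / 2 * Real.exp (r * m) := by
    have hb : ∀ s ∈ Ioc 0 m, ‖K (m - s) * u s‖
        ≤ a * c * M * Real.exp m * Real.exp ((r - 1) * s) := by
      intro s hs
      rw [norm_mul]
      calc ‖K (m - s)‖ * ‖u s‖ ≤ (a * c * Real.exp (m - s)) * (M * Real.exp (r * s)) := by
            gcongr
            · exact hK _ (by linarith [hs.2])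
            · exact hle s ⟨hs.1.le, hs.2.trans hm.2⟩
        _ = a * c * M * Real.exp m * Real.exp ((r - 1) * s) := by
            rw [show a * c * Real.exp (m - s) * (M * Real.exp (r * s))
              = a * c * M * (Real.exp (m - s) * Real.exp (r * s)) by ring,
              mul_assoc (a * c * M), ← Real.exp_add, ← Real.exp_add]
            ring_nf
    have hr1 : 0 < r - 1 := by rw [hr]; linarith
    have h2 : ∫ s in (0 : ℝ)..m, a * c * M * Real.exp m * Real.exp ((r - 1) * s)
        = a * c * M * Real.exp m * ((r - 1)⁻¹ * (Real.exp ((r - 1) * m) - 1)) := by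
      rw [intervalIntegral.integral_const_mul, intervalIntegral.integral_comp_mul_left _ hr1.ne',
        integral_exp]
      simp
    refine (intervalIntegral.norm_integral_le_of_norm_le hm.1
      (Filter.Eventually.of_forall fun s hs => hb s hs)
      ((by fun_prop : Continuous fun s : ℝ => a * c * M * Real.exp m *
        Real.exp ((r - 1) * s)).intervalIntegrable _ _)).trans ?_
    rw [h2]
    have h3 : c * (r - 1)⁻¹ ≤ 1 / 2 := by
      rw [← div_eq_mul_inv, div_le_iff₀ hr1, hr]; linarith
    calc a * c * M * Real.exp m * ((r - 1)⁻¹ * (Real.exp ((r - 1) * m) - 1))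
        ≤ a * c * M * Real.exp m * ((r - 1)⁻¹ * Real.exp ((r - 1) * m)) := by
          gcongr; linarith
      _ = a * M * (c * (r - 1)⁻¹) * (Real.exp m * Real.exp ((r - 1) * m)) := by ring
      _ ≤ a * M * (1 / 2) * (Real.exp m * Real.exp ((r - 1) * m)) := by gcongr
      _ = a * M / 2 * Real.exp (r * m) := by
          rw [← Real.exp_add]; ring_nf
  have hbal : a * ‖u m‖ ≤ B + a * M / 2 * Real.exp (r * m) := by
    have h4 : (a : ℂ) * u m = S m - ∫ s in (0 : ℝ)..m, K (m - s) * u s := by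
      rw [← hV m hm.1]; ring
    calc a * ‖u m‖ = ‖(a : ℂ) * u m‖ := by
          rw [norm_mul, Complex.norm_real, Real.norm_of_nonneg ha.le]
      _ ≤ ‖S m‖ + ‖∫ s in (0 : ℝ)..m, K (m - s) * u s‖ := by rw [h4]; exact norm_sub_le _ _
      _ ≤ _ := add_le_add (hS m hm.1) hint
  have hum : ‖u m‖ = M * Real.exp (r * m) := by
    rw [hM, mul_assoc, ← Real.exp_add]; simp
  have hexp : 1 ≤ Real.exp (r * m) := Real.one_le_exp (by rw [hr]; nlinarith [hm.1])
  have hMB : M ≤ 2 * B / a := by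
    rw [le_div_iff₀ ha]
    rw [hum] at hbal
    nlinarith [mul_nonneg ha.le hM0]
  exact (hle T ⟨hT, le_rfl⟩).trans (by gcongr)

/-- Under a Penrose condition `κ ≤ |a + L[K]|` in the right half-plane, the solution of
`a u + K * u = S` stays close to `S / a`: by Laplace inversion, `a u - S` is the inverse transform
of `-L[S] L[K] / (a + L[K])` along a line far to the right; that function is holomorphic in the
right half-plane, so the line can be moved to the imaginary axis, where the Cauchy–Schwarz and
Plancherel inequalities apply. -/
theorem volterra_penrose_bound {K u S : ℝ → ℂ} {a κ A B σ C : ℝ} (hκ : 0 < κ)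
    (hA : 0 ≤ A) (hB : 0 ≤ B)
    (hV : ∀ t, 0 ≤ t → (a : ℂ) * u t + ∫ s in (0 : ℝ)..t, K (t - s) * u s = S t)
    (hu : ContinuousOn u (Ici 0)) (hKc : ContinuousOn K (Ici 0)) (hSc : ContinuousOn S (Ici 0))
    (hK : ∀ t, 0 ≤ t → ‖K t‖ ≤ A / (1 + t)) (hS : ∀ t, 0 ≤ t → ‖S t‖ ≤ B / (1 + t))
    (hug : ∀ t, 0 ≤ t → ‖u t‖ ≤ C * Real.exp (σ * t)) (hσ : 0 ≤ σ)
    (hP : ∀ l : ℂ, 0 < l.re → κ ≤ ‖a + laplace K l‖) :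
    ∀ t, 0 ≤ t → ‖a * u t - S t‖ ≤ A * B / κ := by
  have hKc' := hKc.mono Ioi_subset_Ici_self
  have hSc' := hSc.mono Ioi_subset_Ici_self
  have hconv : ∀ {H : ℝ → ℂ} {D : ℝ}, 0 ≤ D → ContinuousOn H (Ioi 0) →
      (∀ t, 0 ≤ t → ‖H t‖ ≤ D / (1 + t)) → ∀ l : ℂ, 0 < l.re → LaplaceConv H l := by
    intro H D hD hH hb l hl
    refine laplaceConv_of_growth hH (C := D) (s := 0) (fun t ht => (hb t ht.le).trans ?_) hl
    simp only [zero_mul, Real.exp_zero, mul_one]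
    exact div_le_self hD (by linarith)
  have cK := hconv hA hKc' hK
  have cS := hconv hB hSc' hS
  have dK : ∀ l : ℂ, 0 < l.re → DifferentiableAt ℂ (laplace K) l := fun l hl =>
    differentiableAt_laplace (x := l.re / 2) (cK _ (by simpa using hl)) (by linarith)
  have dS : ∀ l : ℂ, 0 < l.re → DifferentiableAt ℂ (laplace S) l := fun l hl =>
    differentiableAt_laplace (x := l.re / 2) (cS _ (by simpa using hl)) (by linarith)
  have hP0 : ∀ l : ℂ, 0 < l.re → (a : ℂ) + laplace K l ≠ 0 := fun l hl h => by
    have := hP l hl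
    rw [h, norm_zero] at this
    linarith
  set H : ℂ → ℂ := fun l => -(laplace S l * laplace K l) / (a + laplace K l) with hH
  have dH : ∀ l : ℂ, 0 < l.re → DifferentiableAt ℂ H l := fun l hl =>
    ((dS l hl).mul (dK l hl)).neg.div ((dK l hl).const_add _) (hP0 l hl)
  have hHn : ∀ l : ℂ, 0 < l.re → ‖H l‖ ≤ κ⁻¹ * (‖laplace S l‖ * ‖laplace K l‖) := by
    intro l hl
    rw [hH]
    simp only
    rw [norm_div, norm_neg, norm_mul, div_eq_inv_mul]
    gcongr
    exact hP l hl
  have hHi : ∀ x : ℝ, 0 < x → Integrable (fun y : ℝ => H (x + y * Complex.I)) ∧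
      ∫ y : ℝ, ‖H (x + y * Complex.I)‖ ≤ κ⁻¹ * (2 * Real.pi * (B * A)) := by
    intro x hx
    obtain ⟨hi, hle⟩ := integral_laplace_mul_le hSc' hKc' hB hA hx
      (fun t ht => hS t ht.le) (fun t ht => hK t ht.le)
    have hre : ∀ y : ℝ, 0 < ((x : ℂ) + y * Complex.I).re := fun y => by simpa using hx
    have hm : Continuous fun y : ℝ => H (x + y * Complex.I) := by
      rw [continuous_iff_continuousAt]
      intro y
      exact ContinuousAt.comp (f := fun y : ℝ => (x : ℂ) + y * Complex.I)
        (dH _ (hre y)).continuousAt (by fun_prop)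
    have hint : Integrable (fun y : ℝ => H (x + y * Complex.I)) :=
      Integrable.mono' (hi.const_mul κ⁻¹) hm.aestronglyMeasurable
        (Filter.Eventually.of_forall fun y => hHn _ (hre y))
    refine ⟨hint, (integral_mono hint.norm (hi.const_mul κ⁻¹) fun y => hHn _ (hre y)).trans ?_⟩
    rw [integral_const_mul]
    gcongr
  set w : ℝ → ℂ := fun t => a * u t - S t with hw
  -- the growth of `u` identifies `L[w]` with `H` far to the right only
  have hwL : ∀ l : ℂ, σ < l.re → LaplaceConv w l ∧ laplace w l = H l := by
    intro l hl
    have hl0 : 0 < l.re := hσ.trans_lt hl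
    have cu : LaplaceConv u l := laplaceConv_of_growth (hu.mono Ioi_subset_Ici_self)
      (fun t ht => hug t ht.le) hl
    obtain ⟨_, hid⟩ := laplace_volterra hV (cK l hl0) cu
    have hpt : ∀ t : ℝ, (a : ℂ) * (Complex.exp (-l * t) * u t) - Complex.exp (-l * t) * S t
        = Complex.exp (-l * t) * w t := fun t => by rw [hw]; ring
    have i1 : IntegrableOn (fun t : ℝ => (a : ℂ) * (Complex.exp (-l * t) * u t)) (Ioi 0) :=
      Integrable.const_mul cu _
    constructor
    · exact (i1.sub (cS l hl0)).congr (Filter.Eventually.of_forall hpt)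
    · have : laplace w l = a * laplace u l - laplace S l := by
        unfold laplace
        rw [← integral_const_mul, ← integral_sub i1 (cS l hl0)]
        simp only [hpt]
      rw [this, hH]
      simp only
      rw [eq_div_iff (hP0 l hl0), ← hid]
      ring
  have hpos : ∀ t, 0 < t → ‖w t‖ ≤ A * B / κ := by
    intro t ht
    have hwc : ContinuousAt w t :=
      (continuousAt_const.mul (hu.continuousAt (Ici_mem_nhds ht))).sub
        (hSc.continuousAt (Ici_mem_nhds ht))
    have hb : σ < σ + 1 := by linarith
    set b : ℝ := σ + 1 with hbdef
    have hb0 : 0 < b := by linarith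
    have hline : ∀ (x y : ℝ), ((x : ℂ) + y * Complex.I).re = x := fun x y => by simp
    have hinv : ∫ y : ℝ, Complex.exp ((b + y * Complex.I) * t) * H (b + y * Complex.I)
        = 2 * Real.pi * w t := by
      have e : ∀ y : ℝ, laplace w (b + y * Complex.I) = H (b + y * Complex.I) := fun y =>
        (hwL _ (by rw [hline]; exact hb)).2
      rw [← laplace_inversion (hwL b (by simpa using hb)).1 ht hwc
          (by simpa only [e] using (hHi b hb0).1)]
      simp only [e]
    -- moving the line from `Re l = b` to `Re l = x`
    have hshift : ∀ x, 0 < x → x ≤ b → ‖w t‖ ≤ Real.exp (x * t) * (A * B / κ) := by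
      intro x hx hxb
      have hen : ∀ z : ℂ, ‖Complex.exp (z * t)‖ = Real.exp (z.re * t) := fun z => by
        simp [Complex.norm_exp]
      have hGi : ∀ c : ℝ, 0 < c →
          Integrable (fun y : ℝ => Complex.exp ((c + y * Complex.I) * t)
            * H (c + y * Complex.I)) := by
        intro c hc
        refine ((hHi c hc).1.norm.const_mul (Real.exp (c * t))).mono' ?_ ?_
        · exact (by fun_prop : Continuous fun y : ℝ =>
            Complex.exp (((c : ℂ) + y * Complex.I) * t)).aestronglyMeasurable.mul
            (hHi c hc).1.aestronglyMeasurable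
        · refine Filter.Eventually.of_forall fun y => ?_
          rw [norm_mul, hen, hline]
      have hbd : ∀ F : ℝ → ℂ, LaplaceConv F x → ∃ D, 0 ≤ D ∧ ∀ z : ℂ, x ≤ z.re →
          ‖laplace F z‖ ≤ D := fun F hF =>
        ⟨_, integral_nonneg fun _ => norm_nonneg _, fun z hz => norm_laplace_le hF hz⟩
      obtain ⟨DK, hDK0, hDK⟩ := hbd K (cK x (by simpa using hx))
      obtain ⟨DS, hDS0, hDS⟩ := hbd S (cS x (by simpa using hx))
      have hmove := integral_vertical_eq (G := fun z => Complex.exp (z * t) * H z) hxb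
        (M := Real.exp (b * t) * (κ⁻¹ * (DS * DK)))
        (fun z hz _ => (by fun_prop : DifferentiableAt ℂ (fun z : ℂ => Complex.exp (z * t)) z).mul
          (dH z (hx.trans_le hz)))
        (fun z hz hz' => by
          rw [norm_mul, hen]
          gcongr
          refine (hHn z (hx.trans_le hz)).trans ?_
          gcongr
          · exact hDS z hz
          · exact hDK z hz)
        (fun c hc _ => by
          have hc0 : 0 < c := hx.trans_le hc
          have hlim := ((tendsto_laplace_vertical S c).norm.mul
            (tendsto_laplace_vertical K c).norm).const_mul (Real.exp (c * t) * κ⁻¹)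
          simp only [norm_zero, mul_zero] at hlim
          refine squeeze_zero_norm (fun y => ?_) hlim
          rw [norm_mul, hen, hline, mul_assoc]
          gcongr
          exact hHn _ (by rw [hline]; exact hc0))
        (hGi x hx) (hGi b hb0)
      rw [hinv] at hmove
      have h1 : 2 * Real.pi * ‖w t‖ ≤ Real.exp (x * t) * (κ⁻¹ * (2 * Real.pi * (B * A))) := by
        calc 2 * Real.pi * ‖w t‖ = ‖2 * (Real.pi : ℂ) * w t‖ := by
              simp [abs_of_pos Real.pi_pos]
          _ = ‖∫ y : ℝ, Complex.exp ((x + y * Complex.I) * t) * H (x + y * Complex.I)‖ := by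
              rw [← hmove]
          _ ≤ ∫ y : ℝ, ‖Complex.exp ((x + y * Complex.I) * t) * H (x + y * Complex.I)‖ :=
              norm_integral_le_integral_norm _
          _ = Real.exp (x * t) * ∫ y : ℝ, ‖H (x + y * Complex.I)‖ := by
              rw [← integral_const_mul]
              congr 1
              ext y
              rw [norm_mul, hen, hline]
          _ ≤ _ := by gcongr; exact (hHi x hx).2
      have h2 : Real.exp (x * t) * (κ⁻¹ * (2 * Real.pi * (B * A)))
          = 2 * Real.pi * (Real.exp (x * t) * (A * B / κ)) := by
        rw [div_eq_inv_mul]; ring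
      rw [h2] at h1
      exact le_of_mul_le_mul_left h1 (by positivity)
    -- on the line `Re l = x` the inversion integral is at most `e^{x t} A B / κ`; let `x → 0`
    have hlim : Filter.Tendsto (fun x : ℝ => Real.exp (x * t) * (A * B / κ))
        (nhdsWithin 0 (Ioi 0)) (nhds (A * B / κ)) := by
      have : Continuous fun x : ℝ => Real.exp (x * t) * (A * B / κ) := by fun_prop
      simpa using (this.tendsto 0).mono_left nhdsWithin_le_nhds
    refine ge_of_tendsto hlim ?_
    filter_upwards [self_mem_nhdsWithin, mem_nhdsWithin_of_mem_nhds (Iio_mem_nhds hb0)] with x h1 h2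
    exact hshift x h1 (le_of_lt h2)
  intro t ht
  rcases ht.eq_or_lt with rfl | ht
  · have h0 := hV 0 le_rfl
    rw [intervalIntegral.integral_same, add_zero] at h0
    rw [h0, sub_self, norm_zero]
    positivity
  · exact hpos t ht

/-- A function continuous on `t > 0` with vanishing Laplace transform on a vertical line is zero. -/
theorem eq_zero_of_laplace_eq_zero {F : ℝ → ℂ} {x : ℝ} (hc : ContinuousOn F (Ioi 0))
    (h : LaplaceConv F x) (h0 : ∀ y : ℝ, laplace F (x + y * Complex.I) = 0) :
    ∀ t, 0 < t → F t = 0 := by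
  intro t ht
  have := laplace_inversion h ht (hc.continuousAt (Ioi_mem_nhds ht)) (by simp [h0])
  simp only [h0, mul_zero, integral_zero] at this
  have hp : (2 * Real.pi : ℂ) ≠ 0 := by exact_mod_cast (by positivity : (2 * Real.pi : ℝ) ≠ 0)
  exact (mul_eq_zero.1 this.symm).resolve_left hp

/-! ### Periodic kernels -/

/-- If two entire functions satisfy `κ ‖e‖ ≤ ‖D‖` and `e` has simple zeros only, then `e` is a
constant multiple of `D`: Liouville's theorem for the quotient. -/
theorem exists_eq_mul_of_norm_le {e D : ℂ → ℂ} (he : Differentiable ℂ e) (hD : Differentiable ℂ D)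
    {κ : ℝ} (hκ : 0 < κ) (hle : ∀ z, κ * ‖e z‖ ≤ ‖D z‖)
    (hsimple : ∀ z, e z = 0 → deriv e z ≠ 0) : ∃ c : ℂ, ∀ z, e z = c * D z := by
  have hzero : ∀ z, D z = 0 → e z = 0 := by
    intro z hz
    have := hle z
    rw [hz, norm_zero] at this
    exact norm_eq_zero.1 (le_antisymm (by nlinarith [norm_nonneg (e z)]) (norm_nonneg _))
  have hds : ∀ {g : ℂ → ℂ}, Differentiable ℂ g → ∀ c, Differentiable ℂ (dslope g c) :=
    fun hg c => differentiableOn_univ.1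
      ((Complex.differentiableOn_dslope Filter.univ_mem).2 hg.differentiableOn)
  have hmul : ∀ {g : ℂ → ℂ} {c : ℂ}, g c = 0 → ∀ z, g z = (z - c) * dslope g c z := by
    intro g c hg z
    have := sub_smul_dslope g c z
    rw [hg, sub_zero, smul_eq_mul] at this
    exact this.symm
  -- the inequality survives division by `z - c`, and extends to `z = c` by continuity
  have hslope : ∀ c, D c = 0 → ∀ z, κ * ‖dslope e c z‖ ≤ ‖dslope D c z‖ := by
    intro c hc
    have hne : ∀ z ∈ ({c}ᶜ : Set ℂ), κ * ‖dslope e c z‖ ≤ ‖dslope D c z‖ := by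
      intro z hz
      have h1 := hle z
      rw [hmul (hzero c hc) z, hmul hc z, norm_mul, norm_mul] at h1
      have h2 : 0 < ‖z - c‖ := norm_pos_iff.2 (sub_ne_zero.2 hz)
      exact le_of_mul_le_mul_left (by linarith) h2
    have hcl : IsClosed {z | κ * ‖dslope e c z‖ ≤ ‖dslope D c z‖} :=
      isClosed_le ((hds he c).continuous.norm.const_smul κ) (hds hD c).continuous.norm
    intro z
    have : closure ({c}ᶜ : Set ℂ) ⊆ {z | κ * ‖dslope e c z‖ ≤ ‖dslope D c z‖} :=
      hcl.closure_subset_iff.2 hne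
    rw [closure_compl_singleton] at this
    exact this (mem_univ z)
  -- the quotient `e / D`, with its removable singularities filled in
  set h : ℂ → ℂ := fun z => if D z = 0 then deriv e z / deriv D z else e z / D z with hh
  have hdiff : Differentiable ℂ h := by
    intro c
    by_cases hc : D c = 0
    · have hDc : dslope D c c ≠ 0 := by
        intro h0
        have h1 := hslope c hc c
        rw [h0, norm_zero, dslope_same] at h1
        have h2 : 0 < ‖deriv e c‖ := norm_pos_iff.2 (hsimple c (hzero c hc))
        nlinarith
      have hev : h =ᶠ[nhds c] fun z => dslope e c z / dslope D c z := by
        filter_upwards [(hds hD c).continuous.continuousAt.eventually_ne hDc] with z hz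
        by_cases hzc : z = c
        · subst hzc
          simp [hh, hc, dslope_same]
        · have h3 : z - c ≠ 0 := sub_ne_zero.2 hzc
          have h4 : D z ≠ 0 := by
            rw [hmul hc z]; exact mul_ne_zero h3 hz
          simp only [hh, if_neg h4]
          rw [hmul hc z, hmul (hzero c hc) z, mul_div_mul_left _ _ h3]
      exact (((hds he c) c).div ((hds hD c) c) hDc).congr_of_eventuallyEq hev
    · have hev : h =ᶠ[nhds c] fun z => e z / D z := by
        filter_upwards [hD.continuous.continuousAt.eventually_ne hc] with z hz
        simp only [hh, if_neg hz]
      exact ((he c).div (hD c) hc).congr_of_eventuallyEq hev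
  have hdiv : ∀ p q : ℂ, κ * ‖p‖ ≤ ‖q‖ → ‖p / q‖ ≤ κ⁻¹ := by
    intro p q hpq
    rw [norm_div, ← one_div, le_div_iff₀ hκ]
    rcases (norm_nonneg q).eq_or_lt with h0 | h0
    · rw [← h0]; simp
    · rw [div_mul_eq_mul_div, div_le_one h0, mul_comm]; exact hpq
  have hbdd : Bornology.IsBounded (range h) := by
    refine (isBounded_iff_forall_norm_le).2 ⟨κ⁻¹, ?_⟩
    rintro _ ⟨z, rfl⟩
    by_cases hz : D z = 0
    · simp only [hh, if_pos hz]
      have := hslope z hz z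
      rw [dslope_same, dslope_same] at this
      exact hdiv _ _ this
    · simp only [hh, if_neg hz]
      exact hdiv _ _ (hle z)
  refine ⟨h 0, fun z => ?_⟩
  by_cases hz : D z = 0
  · rw [hz, mul_zero, hzero z hz]
  · rw [← hdiff.apply_eq_apply_of_bounded hbdd z 0]
    simp only [hh, if_neg hz]
    field_simp

/-- For a continuous, odd, `T`-periodic kernel, the Penrose condition `κ ≤ |a + L[K]|` in the right
half-plane forces `K = 0` on the half-line. Indeed `a + L[K]` extends to a meromorphic function on
`ℂ`, with poles on the imaginary axis, and the extension is even because `K` is odd. So its inverse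
is a bounded entire function, hence constant. -/
theorem periodic_kernel_eq_zero {K : ℝ → ℂ} {T : ℝ} (hT : 0 < T) (hK : Continuous K)
    (hper : ∀ t, K (t + T) = K t) (hodd : ∀ t, K (-t) = -K t) {a κ : ℝ} (hκ : 0 < κ)
    (hP : ∀ l : ℂ, 0 < l.re → κ ≤ ‖a + laplace K l‖) : ∀ t, 0 < t → K t = 0 := by
  obtain ⟨M, hM⟩ : ∃ M, ∀ t, ‖K t‖ ≤ M := by
    have hp : Function.Periodic K T := hper
    obtain ⟨M, hM⟩ := (hp.isBounded_of_continuous hT.ne' hK).exists_norm_le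
    exact ⟨M, fun t => hM _ (mem_range_self t)⟩
  have hconv : ∀ l : ℂ, 0 < l.re → LaplaceConv K l := fun l hl =>
    laplaceConv_of_growth hK.continuousOn (C := M) (s := 0) (fun t _ => by simpa using hM t) hl
  set q : ℂ → ℂ := fun l => ∫ t in (0 : ℝ)..T, Complex.exp (-l * t) * K t with hq
  set e : ℂ → ℂ := fun l => 1 - Complex.exp (-l * T) with he
  set D : ℂ → ℂ := fun l => a * e l + q l with hDdef
  -- `D = e (a + L[K])` in the right half-plane, where `1 / e` sums the series over the periods;
  -- both `e` and `D` are entire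
  have hqd : Differentiable ℂ q := by
    have hind : ∀ l : ℂ, ∀ t : ℝ, Complex.exp (-l * t) * (indicator (Iic T) K) t
        = indicator (Iic T) (fun t : ℝ => Complex.exp (-l * t) * K t) t := by
      intro l t
      by_cases ht : t ∈ Iic T
      · simp only [indicator_of_mem ht]
      · simp only [indicator_of_notMem ht, mul_zero]
    have hql : q = laplace (indicator (Iic T) K) := by
      ext l
      simp only [hq, laplace, hind]
      rw [setIntegral_indicator measurableSet_Iic, intervalIntegral.integral_of_le hT.le,
          Ioi_inter_Iic]
    have hc : ∀ l : ℂ, LaplaceConv (indicator (Iic T) K) l := by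
      intro l
      simp only [LaplaceConv, hind]
      rw [IntegrableOn, integrable_indicator_iff measurableSet_Iic, IntegrableOn,
        Measure.restrict_restrict measurableSet_Iic, Iic_inter_Ioi]
      exact ((by fun_prop : Continuous fun t : ℝ => Complex.exp (-l * t) * K t).integrableOn_Icc
        (a := 0) (b := T)).mono_set Ioc_subset_Icc_self
    rw [hql]
    intro l
    exact differentiableAt_laplace (x := l.re - 1) (hc _) (by linarith)
  have hed : Differentiable ℂ e := by fun_prop
  have hDd : Differentiable ℂ D := (hed.const_mul _).add hqd
  have hsplit : ∀ l : ℂ, 0 < l.re → e l * laplace K l = q l := by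
    intro l hl
    have h1 : laplace K l = q l + ∫ t in Ioi T, Complex.exp (-l * t) * K t := by
      rw [laplace, ← intervalIntegral.integral_interval_add_Ioi (b := T)]
      · exact hconv l hl
      · exact (hconv l hl).mono_set (Ioi_subset_Ioi hT.le)
    have h2 : ∫ t in Ioi T, Complex.exp (-l * t) * K t = Complex.exp (-l * T) * laplace K l := by
      rw [laplace, ← integral_const_mul,
          ← (measurePreserving_add_right volume T).setIntegral_preimage_emb
        (measurableEmbedding_addRight T), preimage_add_const_Ioi, sub_self]
      congr 1
      ext t
      rw [hper, ← mul_assoc, ← Complex.exp_add]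
      push_cast
      ring_nf
    rw [h2] at h1
    simp only [he]
    linear_combination h1
  have hDe : ∀ l : ℂ, 0 < l.re → D l = e l * (a + laplace K l) := by
    intro l hl
    simp only [hDdef]
    rw [← hsplit l hl]
    ring
  have hqneg : ∀ l : ℂ, q (-l) = -(Complex.exp (l * T) * q l) := by
    intro l
    have h1 := intervalIntegral.integral_comp_sub_left (a := 0) (b := T)
      (fun t : ℝ => Complex.exp (-(-l) * t) * K t) T
    rw [sub_self, sub_zero] at h1
    simp only [hq]
    rw [← h1, ← intervalIntegral.integral_const_mul, ← intervalIntegral.integral_neg]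
    congr 1
    ext t
    have hKt : K (T - t) = -K t := by
      rw [← hodd t, ← hper (-t)]; congr 1; ring
    rw [hKt, mul_neg, ← mul_assoc, ← Complex.exp_add]
    push_cast
    ring_nf
  have heneg : ∀ l : ℂ, e (-l) = -(Complex.exp (l * T) * e l) := by
    intro l
    simp only [he, neg_neg, mul_sub, mul_one, neg_sub]
    rw [← Complex.exp_add]
    simp
  -- `e` and `D` transform by the same factor, so that the quotient `D / e` is even and the lower
  -- bound on it passes to the left half-plane
  have hDneg : ∀ l : ℂ, D (-l) = -(Complex.exp (l * T) * D l) := by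
    intro l
    simp only [hDdef, heneg, hqneg]
    ring
  have hle1 : ∀ l : ℂ, 0 < l.re → κ * ‖e l‖ ≤ ‖D l‖ := by
    intro l hl
    rw [hDe l hl, norm_mul, mul_comm]
    gcongr
    exact hP l hl
  have hle2 : ∀ l : ℂ, l.re ≠ 0 → κ * ‖e l‖ ≤ ‖D l‖ := by
    intro l hl
    rcases lt_or_gt_of_ne hl with h | h
    · have h1 := hle1 (-l) (by simpa using h)
      rw [heneg, hDneg, norm_neg, norm_neg, norm_mul, norm_mul, mul_left_comm] at h1
      exact le_of_mul_le_mul_left h1 (norm_pos_iff.2 (Complex.exp_ne_zero _))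
    · exact hle1 l h
  have hle : ∀ l : ℂ, κ * ‖e l‖ ≤ ‖D l‖ := by
    intro l
    by_cases hl : l.re = 0
    · have hlim : ∀ {g : ℂ → ℂ}, Differentiable ℂ g → Filter.Tendsto (fun x : ℝ => ‖g (l + x)‖)
          (nhdsWithin 0 (Ioi 0)) (nhds ‖g l‖) := by
        intro g hg
        have : Continuous fun x : ℝ => ‖g (l + x)‖ := by
          have := hg.continuous
          fun_prop
        simpa using (this.tendsto 0).mono_left nhdsWithin_le_nhds
      refine le_of_tendsto_of_tendsto ((hlim hed).const_mul κ) (hlim hDd) ?_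
      filter_upwards [self_mem_nhdsWithin] with x hx
      exact hle2 _ (by simpa [hl] using (ne_of_gt hx))
    · exact hle2 l hl
  have hsimple : ∀ z, e z = 0 → deriv e z ≠ 0 := by
    intro z _
    have h1 : HasDerivAt e (-(Complex.exp (-z * T) * (-1 * T))) z :=
      (((hasDerivAt_neg z).mul_const (T : ℂ)).cexp).const_sub 1
    rw [h1.deriv]
    simp [Complex.exp_ne_zero, hT.ne']
  obtain ⟨c, hc⟩ := exists_eq_mul_of_norm_le hed hDd hκ hle hsimple
  have hconst : ∀ l : ℂ, 0 < l.re → c * (a + laplace K l) = 1 := by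
    intro l hl
    have he0 : e l ≠ 0 := by
      intro h0
      have h1 : Complex.exp (-l * T) = 1 := (sub_eq_zero.1 h0).symm
      have h2 : ‖Complex.exp (-l * T)‖ = 1 := by rw [h1, norm_one]
      rw [norm_exp_neg_mul, Real.exp_eq_one_iff] at h2
      nlinarith
    have h1 := hc l
    rw [hDe l hl] at h1
    exact mul_left_cancel₀ he0 (by linear_combination -h1)
  have hc0 : c ≠ 0 := by
    rintro rfl
    simpa using hconst 1 (by simp)
  have hL : ∀ y : ℝ, laplace K ((1 : ℝ) + y * Complex.I) = 1 / c - a := by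
    intro y
    rw [eq_sub_iff_add_eq, eq_div_iff hc0]
    linear_combination hconst ((1 : ℝ) + y * Complex.I) (by simp)
  -- `L[K]` is constant, and tends to zero along vertical lines
  have hz : (1 / c - a : ℂ) = 0 := by
    have h1 := tendsto_laplace_vertical K 1
    simp only [hL] at h1
    exact tendsto_nhds_unique tendsto_const_nhds h1
  exact eq_zero_of_laplace_eq_zero hK.continuousOn (hconv (1 : ℝ) (by simp))
    (fun y => by rw [hL y, hz])

/-! ### Fourier analysis on the torus -/

/-- The normalized Haar measure on `ℝ / ℤ`, for which Mathlib states its Fourier series results. -/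
local instance : MeasureSpace UnitAddCircle := ⟨AddCircle.haarAddCircle⟩

local instance : Measure.IsAddHaarMeasure (volume : Measure UnitAddCircle) :=
  inferInstanceAs (Measure.IsAddHaarMeasure AddCircle.haarAddCircle)

local instance : IsProbabilityMeasure (volume : Measure UnitAddCircle) :=
  inferInstanceAs (IsProbabilityMeasure AddCircle.haarAddCircle)

/-- The projection `ℝ³ → (ℝ / ℤ)³`, `x ↦ x / 2π`. -/
def toTorus (x : R3) : UnitAddTorus (Fin 3) := fun i => ((x i / (2 * Real.pi) : ℝ) : UnitAddCircle)

/-- A section of `toTorus`, with values in the fundamental cell. -/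
def torusRep (z : UnitAddTorus (Fin 3)) : R3 :=
  WithLp.toLp 2 fun i => 2 * Real.pi * (AddCircle.equivIoc 1 0 (z i) : ℝ)

theorem toTorus_torusRep (z : UnitAddTorus (Fin 3)) : toTorus (torusRep z) = z := by
  ext i
  simp only [toTorus, torusRep]
  rw [mul_div_cancel_left₀ _ (by positivity)]
  exact (AddCircle.equivIoc 1 0).symm_apply_apply (z i)

theorem toTorus_add (x y : R3) : toTorus (x + y) = toTorus x + toTorus y := by
  ext i
  simp [toTorus, add_div]

theorem torusRep_mem_cell (z : UnitAddTorus (Fin 3)) : torusRep z ∈ cell := by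
  intro i
  have h := (AddCircle.equivIoc 1 0 (z i)).2
  simp only [torusRep, zero_add, mem_Ioc, mem_Icc] at h ⊢
  constructor
  · have := h.1.le; positivity
  · have := h.2
    nlinarith [Real.pi_pos]

theorem measurable_torusRep : Measurable torusRep := by
  refine (WithLp.measurable_toLp 2 (Fin 3 → ℝ)).comp (measurable_pi_lambda _ fun i => ?_)
  exact ((measurable_subtype_coe.comp (AddCircle.measurableEquivIoc 1 0).measurable).comp
    (measurable_pi_apply i)).const_mul _

theorem exists_eq_add_of_toTorus_eq {x y : R3} (h : toTorus x = toTorus y) :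
    ∃ k : Mode, x = y + (2 * Real.pi) • k.toR3 := by
  have h1 : ∀ i, ∃ n : ℤ, x i = y i + 2 * Real.pi * n := by
    intro i
    have h2 : ((x i / (2 * Real.pi) : ℝ) : UnitAddCircle)
        = ((y i / (2 * Real.pi) : ℝ) : UnitAddCircle) :=
      congrFun h i
    rw [← sub_eq_zero, ← AddCircle.coe_sub, AddCircle.coe_eq_zero_iff] at h2
    obtain ⟨n, hn⟩ := h2
    refine ⟨n, ?_⟩
    have hp : (2 * Real.pi) ≠ 0 := by positivity
    rw [zsmul_eq_mul, mul_one] at hn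
    rw [hn]
    field_simp
    ring
  choose k hk using h1
  refine ⟨k, ?_⟩
  ext i
  simp [Mode.toR3, hk i]

theorem apply_torusRep_toTorus {E : Type*} {g : R3 → E}
    (hg : ∀ (k : Mode) (x : R3), g (x + (2 * Real.pi) • k.toR3) = g x) (x : R3) :
    g (torusRep (toTorus x)) = g x := by
  obtain ⟨k, hk⟩ := exists_eq_add_of_toTorus_eq (toTorus_torusRep (toTorus x))
  rw [hk, hg]

theorem isCompact_cell : IsCompact cell := by
  have h : cell = (WithLp.toLp 2 : (Fin 3 → ℝ) → R3) '' (univ.pi fun _ => Icc 0 (2 * Real.pi)) := by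
    ext x
    simp only [cell, mem_ofPred_eq, mem_image, mem_univ_pi]
    constructor
    · intro hx
      exact ⟨x.ofLp, hx, rfl⟩
    · rintro ⟨y, hy, rfl⟩
      exact hy
  rw [h]
  exact (isCompact_univ_pi fun _ => isCompact_Icc).image (PiLp.continuous_toLp 2 _)

theorem measurableSet_cell : MeasurableSet cell := isCompact_cell.isClosed.measurableSet

instance : IsFiniteMeasure (volume.restrict cell : Measure R3) :=
  ⟨by simpa using isCompact_cell.measure_lt_top⟩

open scoped Pointwise in
/-- The integral over the cell of a periodic function is an integral over the torus. -/
theorem setIntegral_cell {E : Type*} [NormedAddCommGroup E] [NormedSpace ℝ E] {g : R3 → E}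
    (hg : ∀ (k : Mode) (x : R3), g (x + (2 * Real.pi) • k.toR3) = g x) :
    ∫ x in cell, g x = ((2 * Real.pi) ^ 3) • ∫ z, g (torusRep z) := by
  have hp : (0 : ℝ) < 2 * Real.pi := by positivity
  rw [UnitAddTorus.integral_preimage _ 0]
  have h1 : ∀ y : Fin 3 → ℝ, g (torusRep fun i => (y i : UnitAddCircle))
      = g (WithLp.toLp 2 ((2 * Real.pi) • y)) := by
    intro y
    rw [← apply_torusRep_toTorus hg (WithLp.toLp 2 ((2 * Real.pi) • y))]
    congr 2
    ext i
    simp only [toTorus, Pi.smul_apply, smul_eq_mul]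
    rw [mul_div_cancel_left₀ _ hp.ne']
  simp only [h1, Pi.zero_apply, zero_add]
  have h2 : {x : Fin 3 → ℝ | ∀ i, x i ∈ Ioc (0 : ℝ) 1} =ᵐ[volume] Icc (0 : Fin 3 → ℝ) 1 := by
    have h4 : {x : Fin 3 → ℝ | ∀ i, x i ∈ Ioc (0 : ℝ) 1}
        = univ.pi fun i => Ioc ((0 : Fin 3 → ℝ) i) ((1 : Fin 3 → ℝ) i) := by
      ext x; simp [Set.mem_pi]
    rw [h4]
    exact Measure.univ_pi_Ioc_ae_eq_Icc (μ := fun _ : Fin 3 => (volume : Measure ℝ))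
  rw [setIntegral_congr_set h2, Measure.setIntegral_comp_smul_of_pos volume
    (fun y : Fin 3 → ℝ => g (WithLp.toLp 2 y)) _ hp]
  have h3 : (2 * Real.pi) • Icc (0 : Fin 3 → ℝ) 1
      = (WithLp.toLp 2 : (Fin 3 → ℝ) → R3) ⁻¹' cell := by
    ext y
    rw [Set.mem_smul_set_iff_inv_smul_mem₀ hp.ne']
    simp only [mem_Icc, Pi.le_def, Pi.zero_apply, Pi.one_apply, Pi.smul_apply, smul_eq_mul, cell,
      mem_preimage, mem_ofPred_eq, ← forall_and]
    refine forall_congr' fun i => ?_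
    rw [inv_mul_le_one₀ hp]
    have : 0 ≤ (2 * Real.pi)⁻¹ * y i ↔ 0 ≤ y i := by
      rw [mul_nonneg_iff_of_pos_left (by positivity)]
    rw [this]
  rw [h3, (PiLp.volume_preserving_toLp (Fin 3)).setIntegral_preimage_emb
    (MeasurableEquiv.toLp 2 (Fin 3 → ℝ)).measurableEmbedding, smul_smul]
  simp

theorem setIntegral_cell_shift {E : Type*} [NormedAddCommGroup E] [NormedSpace ℝ E] {g : R3 → E}
    (hg : ∀ (k : Mode) (x : R3), g (x + (2 * Real.pi) • k.toR3) = g x) (a : R3) :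
    ∫ x in cell, g (x + a) = ∫ x in cell, g x := by
  rw [setIntegral_cell hg, setIntegral_cell (g := fun x => g (x + a))
    (fun k x => by rw [add_right_comm, hg]),
    ← integral_add_right_eq_self (fun z => g (torusRep z)) (toTorus a)]
  congr 2
  ext z
  rw [← apply_torusRep_toTorus hg, toTorus_add, toTorus_torusRep]

theorem exp_inner_periodic (k n : Mode) (x : R3) :
    Complex.exp (-Complex.I * (inner ℝ k.toR3 (x + (2 * Real.pi) • n.toR3) : ℝ))
      = Complex.exp (-Complex.I * (inner ℝ k.toR3 x : ℝ)) := by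
  have h : inner ℝ k.toR3 n.toR3 = ((∑ i, n i * k i : ℤ) : ℝ) := by
    simp [Mode.toR3, PiLp.inner_apply]
  rw [inner_add_right, inner_smul_right, h, Complex.exp_eq_exp_iff_exists_int]
  refine ⟨-∑ i, n i * k i, ?_⟩
  push_cast
  ring

theorem torusFourier_shift {h : R3 → ℝ} (hh : Periodic3 h) (a : R3) (k : Mode) :
    torusFourier (fun x => h (x + a)) k
      = Complex.exp (Complex.I * (inner ℝ k.toR3 a : ℝ)) * torusFourier h k := by
  unfold torusFourier
  rw [← setIntegral_cell_shift (g := fun x =>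
    Complex.exp (-Complex.I * (inner ℝ k.toR3 x : ℝ)) * (h x : ℂ))
    (fun n x => by rw [exp_inner_periodic, hh]) a, ← integral_const_mul]
  congr 1
  ext x
  rw [← mul_assoc, ← Complex.exp_add, inner_add_right]
  push_cast
  ring_nf

theorem norm_exp_neg_I_mul (r : ℝ) : ‖Complex.exp (-Complex.I * r)‖ = 1 := by
  rw [neg_mul, ← mul_neg, mul_comm, ← Complex.ofReal_neg, Complex.norm_exp_ofReal_mul_I]

theorem continuous_exp_inner (k : Mode) :
    Continuous fun x : R3 => Complex.exp (-Complex.I * (inner ℝ k.toR3 x : ℝ)) := by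
  have : Continuous fun x : R3 => inner ℝ k.toR3 x := continuous_const.inner continuous_id
  fun_prop

/-- Differentiation on the torus becomes multiplication on the Fourier side: differentiate the
shift identity in the shift. -/
theorem torusFourier_fderiv {h : R3 → ℝ} (hh : Periodic3 h) (hc : ContDiff ℝ 1 h) (w : R3)
    (k : Mode) :
    torusFourier (fun x => fderiv ℝ h x w) k
      = Complex.I * (inner ℝ k.toR3 w : ℝ) * torusFourier h k := by
  have hcf : Continuous fun x => fderiv ℝ h x w :=
    (hc.continuous_fderiv (by norm_num)).clm_apply continuous_const
  have hdiff : Differentiable ℝ h := hc.differentiable (by norm_num)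
  obtain ⟨M, hM⟩ : ∃ M, ∀ p ∈ cell ×ˢ Icc (-1 : ℝ) 1, ‖fderiv ℝ h (p.1 + p.2 • w) w‖ ≤ M :=
    (isCompact_cell.prod isCompact_Icc).exists_bound_of_continuousOn
      (hcf.comp (by fun_prop : Continuous fun p : R3 × ℝ => p.1 + p.2 • w)).continuousOn
  have hL := (hasDerivAt_integral_of_dominated_loc_of_deriv_le (μ := volume.restrict cell)
    (F := fun (s : ℝ) (x : R3) =>
      Complex.exp (-Complex.I * (inner ℝ k.toR3 x : ℝ)) * (h (x + s • w) : ℂ))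
    (F' := fun (s : ℝ) (x : R3) =>
      Complex.exp (-Complex.I * (inner ℝ k.toR3 x : ℝ)) * (fderiv ℝ h (x + s • w) w : ℂ))
    (x₀ := 0) (s := Icc (-1) 1) (bound := fun _ => M) (Icc_mem_nhds (by norm_num) (by norm_num))
    (Filter.Eventually.of_forall fun s => ?_) ?_ ?_ ?_ ?_ ?_).2
  · have hR : HasDerivAt (fun s : ℝ => Complex.exp (Complex.I * (inner ℝ k.toR3 (s • w) : ℝ)) *
        torusFourier h k) (Complex.I * (inner ℝ k.toR3 w : ℝ) * torusFourier h k) 0 := by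
      have h1 : HasDerivAt (fun s : ℝ => Complex.I * (inner ℝ k.toR3 (s • w) : ℝ))
          (Complex.I * (inner ℝ k.toR3 w : ℝ)) 0 := by
        have h2 := ((hasDerivAt_id' (0 : ℝ)).ofReal_comp.mul_const
          ((inner ℝ k.toR3 w : ℝ) : ℂ)).const_mul Complex.I
        simp only [inner_smul_right]
        convert! h2 using 1
        · ext s; push_cast; ring
        · push_cast; ring
      have h3 := (h1.cexp).mul_const (torusFourier h k)
      simpa using h3
    have hEq : (fun s : ℝ => ∫ x in cell,
        Complex.exp (-Complex.I * (inner ℝ k.toR3 x : ℝ)) * (h (x + s • w) : ℂ))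
        = fun s : ℝ => Complex.exp (Complex.I * (inner ℝ k.toR3 (s • w) : ℝ))
            * torusFourier h k := by
      ext s
      exact torusFourier_shift hh (s • w) k
    rw [hEq] at hL
    have := hL.unique hR
    simp only [zero_smul, add_zero] at this
    exact this
  · exact ((continuous_exp_inner k).mul (Complex.continuous_ofReal.comp
      (hc.continuous.comp (by fun_prop)))).aestronglyMeasurable
  · refine ContinuousOn.integrableOn_compact isCompact_cell ?_
    exact ((continuous_exp_inner k).mul (Complex.continuous_ofReal.comp
      (hc.continuous.comp (by fun_prop)))).continuousOn
  · exact ((continuous_exp_inner k).mul (Complex.continuous_ofReal.comp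
      (hcf.comp (continuous_id.add continuous_const)))).aestronglyMeasurable
  · refine (ae_restrict_iff' measurableSet_cell).2 (Filter.Eventually.of_forall fun x hx s hs => ?_)
    rw [norm_mul, norm_exp_neg_I_mul, one_mul, Complex.norm_real]
    exact hM (x, s) ⟨hx, hs⟩
  · exact integrable_const M
  · refine Filter.Eventually.of_forall fun x s _ => ?_
    have h1 : HasDerivAt (fun s : ℝ => x + s • w) w s := by
      simpa using ((hasDerivAt_id s).smul_const w).const_add x
    have h2 : HasDerivAt (fun s : ℝ => h (x + s • w)) (fderiv ℝ h (x + s • w) w) s :=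
      (hdiff (x + s • w)).hasFDerivAt.comp_hasDerivAt s h1
    exact h2.ofReal_comp.const_mul _

theorem norm_torusFourier_le {h : R3 → ℝ} {M : ℝ} (hM : ∀ x, |h x| ≤ M) (k : Mode) :
    ‖torusFourier h k‖ ≤ M * volume.real cell := by
  refine norm_setIntegral_le_of_norm_le_const isCompact_cell.measure_lt_top fun x _ => ?_
  rw [norm_mul, norm_exp_neg_I_mul, one_mul, Complex.norm_real]
  exact hM x

theorem periodic_apply_bounded {h : R3 → ℝ} (hh : Periodic3 h) (hc : Continuous h) :
    ∃ M, ∀ x, |h x| ≤ M := by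
  obtain ⟨M, hM⟩ := isCompact_cell.exists_bound_of_continuousOn hc.continuousOn
  refine ⟨M, fun x => ?_⟩
  rw [← apply_torusRep_toTorus hh x]
  exact hM _ (torusRep_mem_cell _)

/-- Parseval's identity on the torus `(ℝ / 2πℤ)³`. -/
theorem hasSum_norm_torusFourier_sq {h : R3 → ℝ} (hh : Periodic3 h) (hc : Continuous h) :
    HasSum (fun k => ‖torusFourier h k‖ ^ 2) ((2 * Real.pi) ^ 3 * ∫ x in cell, h x ^ 2) := by
  have hp : (0 : ℝ) < 2 * Real.pi := by positivity
  obtain ⟨M, hM⟩ := periodic_apply_bounded hh hc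
  have hmem : MemLp (fun z => (h (torusRep z) : ℂ)) 2 := by
    refine MemLp.of_bound
      (Complex.measurable_ofReal.comp (hc.measurable.comp measurable_torusRep)).aestronglyMeasurable
      M (Filter.Eventually.of_forall fun z => ?_)
    simpa using hM (torusRep z)
  have hcoef : ∀ k, UnitAddTorus.mFourierCoeff (hmem.toLp _) k
      = ((2 * Real.pi) ^ 3 : ℝ)⁻¹ • torusFourier h k := by
    intro k
    unfold torusFourier
    rw [setIntegral_cell (fun n x => by rw [exp_inner_periodic, hh]), smul_smul,
      inv_mul_cancel₀ (by positivity), one_smul, UnitAddTorus.mFourierCoeff]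
    refine integral_congr_ae ?_
    filter_upwards [hmem.coeFn_toLp] with z hz
    rw [hz, smul_eq_mul]
    congr 1
    conv_lhs => rw [← toTorus_torusRep z]
    simp only [UnitAddTorus.mFourier, ContinuousMap.coe_mk, toTorus, fourier_coe_apply]
    rw [← Complex.exp_sum]
    congr 1
    simp only [Mode.toR3, PiLp.inner_apply, Complex.ofReal_sum, Finset.mul_sum]
    refine Finset.sum_congr rfl fun i _ => ?_
    have hpc : (Real.pi : ℂ) ≠ 0 := by exact_mod_cast Real.pi_ne_zero
    simp
    field_simp
  have hsum := UnitAddTorus.hasSum_sq_mFourierCoeff (hmem.toLp _)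
  simp only [hcoef] at hsum
  have hint : ∫ z, ‖hmem.toLp _ z‖ ^ 2 = ∫ z, h (torusRep z) ^ 2 := by
    refine integral_congr_ae ?_
    filter_upwards [hmem.coeFn_toLp] with z hz
    rw [hz]
    simp
  rw [hint] at hsum
  have h2 := hsum.mul_left (((2 * Real.pi) ^ 3) ^ 2)
  rw [setIntegral_cell (g := fun x => h x ^ 2) (fun n x => by rw [hh]), smul_eq_mul, ← mul_assoc,
      ← sq]
  refine h2.congr_fun fun k => ?_
  rw [norm_smul, norm_inv, Real.norm_of_nonneg (by positivity)]
  field_simp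

/-! ### Free-streaming characteristics -/

theorem act_block_zero (A : Matrix (Fin 2) (Fin 2) ℝ) (c : ℝ) (v : R3) :
    act (block A c) v 0 = A 0 0 * v 0 + A 0 1 * v 1 := by
  simp [act, block, dotProduct, Fin.sum_univ_three]

theorem act_block_one (A : Matrix (Fin 2) (Fin 2) ℝ) (c : ℝ) (v : R3) :
    act (block A c) v 1 = A 1 0 * v 0 + A 1 1 * v 1 := by
  simp [act, block, dotProduct, Fin.sum_univ_three]

theorem act_block_two (A : Matrix (Fin 2) (Fin 2) ℝ) (c : ℝ) (v : R3) :
    act (block A c) v 2 = c * v 2 := by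
  simp [act, block, dotProduct, Fin.sum_univ_three]

theorem R3_ext {v w : R3} (h0 : v 0 = w 0) (h1 : v 1 = w 1) (h2 : v 2 = w 2) : v = w := by
  ext i
  fin_cases i
  · exact h0
  · exact h1
  · exact h2

theorem inner_R3 (v w : R3) : inner ℝ v w = v 0 * w 0 + v 1 * w 1 + v 2 * w 2 := by
  simp [PiLp.inner_apply, Fin.sum_univ_three]
  ring

theorem norm_sq_R3 (v : R3) : ‖v‖ ^ 2 = v 0 ^ 2 + v 1 ^ 2 + v 2 ^ 2 := by
  rw [← real_inner_self_eq_norm_sq, inner_R3]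
  ring

/-- Rotation about the magnetic axis, as a linear isometry. -/
def axisRotation (a : ℝ) : R3 ≃ₗᵢ[ℝ] R3 where
  toFun := act (block (rot a) 1)
  invFun := act (block (rot (-a)) 1)
  map_add' v w := by simp [act, Matrix.mulVec_add]
  map_smul' c v := by simp [act, Matrix.mulVec_smul]
  left_inv v := by simpa using act_rot_neg (-a) v
  right_inv v := act_rot_neg a v
  norm_map' v := by
    have h := Real.sin_sq_add_cos_sq a
    refine (sq_eq_sq₀ (norm_nonneg _) (norm_nonneg _)).1 ?_
    change ‖act (block (rot a) 1) v‖ ^ 2 = ‖v‖ ^ 2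
    rw [norm_sq_R3, norm_sq_R3, act_block_zero, act_block_one, act_block_two]
    simp [rot]
    linear_combination (v 0 ^ 2 + v 1 ^ 2) * h

theorem axisRotation_apply (a : ℝ) (v : R3) : axisRotation a v = act (block (rot a) 1) v := rfl

theorem charVel_eq (B₀ t : ℝ) (v : R3) : charVel B₀ t v = axisRotation (B₀ * t) v := rfl

/-- The displacement `y(t; x, v) - x` of a characteristic with initial velocity `v`. -/
def drift (B₀ t : ℝ) (v : R3) : R3 := act (block (shift B₀ t) t) v

theorem charPos_eq (B₀ t : ℝ) (x v : R3) : charPos B₀ t x v = x + drift B₀ t v := rfl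

theorem continuous_charVel (B₀ : ℝ) : Continuous fun p : ℝ × R3 => charVel B₀ p.1 p.2 := by
  refine (PiLp.continuous_toLp 2 _).comp (continuous_pi fun i => ?_)
  fin_cases i <;> simp [block, rot, dotProduct, Fin.sum_univ_three] <;> fun_prop

theorem continuous_drift (B₀ : ℝ) : Continuous fun p : ℝ × R3 => drift B₀ p.1 p.2 := by
  refine (PiLp.continuous_toLp 2 _).comp (continuous_pi fun i => ?_)
  fin_cases i <;> simp [block, shift, rot, dotProduct, Fin.sum_univ_three] <;> fun_prop

@[fun_prop]
theorem continuous_charVel_comp {X : Type*} [TopologicalSpace X] (B₀ : ℝ) {a : X → ℝ} {b : X → R3}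
    (ha : Continuous a) (hb : Continuous b) : Continuous fun x => charVel B₀ (a x) (b x) := by
  have h := (continuous_charVel B₀).comp (ha.prodMk hb)
  exact h

@[fun_prop]
theorem continuous_drift_comp {X : Type*} [TopologicalSpace X] (B₀ : ℝ) {a : X → ℝ} {b : X → R3}
    (ha : Continuous a) (hb : Continuous b) : Continuous fun x => drift B₀ (a x) (b x) := by
  have h := (continuous_drift B₀).comp (ha.prodMk hb)
  exact h

theorem continuous_gyro (B₀ : ℝ) (v : R3) : Continuous fun t : ℝ => act (gyro B₀ t) v := by
  refine (PiLp.continuous_toLp 2 _).comp (continuous_pi fun i => ?_)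
  fin_cases i <;> simp [gyro, block, rot, dotProduct, Fin.sum_univ_three] <;> fun_prop

/-- `R̃(t)` is the transpose of the drift. -/
theorem inner_drift (B₀ t : ℝ) (k v : R3) :
    inner ℝ k (drift B₀ t v) = inner ℝ (act (gyro B₀ t) k) v := by
  rw [inner_R3, inner_R3, drift, gyro]
  simp only [act_block_zero, act_block_one, act_block_two]
  simp [shift, rot, Real.cos_sub_pi_div_two, Real.sin_sub_pi_div_two, Real.cos_pi_div_two_sub,
    Real.sin_pi_div_two_sub]
  ring

/-- The flow property: the drift between the times `s` and `t` only depends on `t - s` and on the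
velocity at time `s`. -/
theorem drift_sub (B₀ t s : ℝ) (v : R3) :
    drift B₀ t v - drift B₀ s v = drift B₀ (t - s) (charVel B₀ s v) := by
  have e1 : B₀ * (t - s) = B₀ * t - B₀ * s := by ring
  have h := Real.sin_sq_add_cos_sq (B₀ * s)
  refine R3_ext ?_ ?_ ?_
  · simp only [drift, charVel, PiLp.sub_apply, act_block_zero, act_block_one]
    simp [shift, rot, e1, Real.cos_sub,
      Real.sin_sub]
    linear_combination (-B₀⁻¹ * Real.sin (B₀ * t) * v 0 + B₀⁻¹ * Real.cos (B₀ * t) * v 1) * h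
  · simp only [drift, charVel, PiLp.sub_apply, act_block_zero, act_block_one]
    simp [shift, rot, e1, Real.cos_sub,
      Real.sin_sub]
    linear_combination (-B₀⁻¹ * Real.cos (B₀ * t) * v 0 - B₀⁻¹ * Real.sin (B₀ * t) * v 1) * h
  · simp only [drift, charVel, PiLp.sub_apply, act_block_two]
    ring

theorem gyro_zero (B₀ t : ℝ) (k : R3) :
    act (gyro B₀ t) k 0 = B₀⁻¹ * (Real.sin (B₀ * t) * k 0 + (Real.cos (B₀ * t) - 1) * k 1) := by
  rw [gyro, act_block_zero]
  simp [rot, Real.cos_pi_div_two_sub, Real.sin_pi_div_two_sub]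
  ring

theorem gyro_one (B₀ t : ℝ) (k : R3) :
    act (gyro B₀ t) k 1 = B₀⁻¹ * ((1 - Real.cos (B₀ * t)) * k 0 + Real.sin (B₀ * t) * k 1) := by
  rw [gyro, act_block_one]
  simp [rot, Real.cos_pi_div_two_sub, Real.sin_pi_div_two_sub]
  ring

theorem gyro_two (B₀ t : ℝ) (k : R3) : act (gyro B₀ t) k 2 = t * k 2 := by
  rw [gyro, act_block_two]

theorem inner_gyro (B₀ t : ℝ) (k : R3) :
    inner ℝ k (act (gyro B₀ t) k) = B₀⁻¹ * Real.sin (B₀ * t) * (k 0 ^ 2 + k 1 ^ 2)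
        + t * k 2 ^ 2 := by
  rw [inner_R3, gyro_zero, gyro_one, gyro_two]
  ring

theorem gyro_add_period {B₀ : ℝ} (hB : B₀ ≠ 0) (t : ℝ) {k : R3} (hk : k 2 = 0) :
    act (gyro B₀ (t + 2 * Real.pi / B₀)) k = act (gyro B₀ t) k := by
  have e : B₀ * (t + 2 * Real.pi / B₀) = B₀ * t + 2 * Real.pi := by field_simp
  refine R3_ext ?_ ?_ ?_
  · simp only [gyro_zero, e, Real.sin_add_two_pi, Real.cos_add_two_pi]
  · simp only [gyro_one, e, Real.sin_add_two_pi, Real.cos_add_two_pi]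
  · simp only [gyro_two, hk, mul_zero]

theorem gyro_neg (B₀ t : ℝ) {k : R3} (hk : k 2 = 0) :
    act (gyro B₀ (-t)) k = axisRotation (B₀ * t + Real.pi) (act (gyro B₀ t) k) := by
  have h := Real.sin_sq_add_cos_sq (B₀ * t)
  rw [axisRotation_apply]
  refine R3_ext ?_ ?_ ?_
  · rw [act_block_zero]
    simp only [gyro_zero, gyro_one]
    simp [rot, Real.cos_add_pi, Real.sin_add_pi]
    linear_combination (B₀⁻¹ * k 1) * h
  · rw [act_block_one]
    simp only [gyro_zero, gyro_one]
    simp [rot, Real.cos_add_pi, Real.sin_add_pi]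
    linear_combination (-B₀⁻¹ * k 0) * h
  · rw [act_block_two]
    simp only [gyro_two, hk, mul_zero]

theorem norm_gyro_entry_le (B₀ t : ℝ) (ht : 0 ≤ t) (hB : 0 < B₀) (i j : Fin 3) :
    |gyro B₀ t i j| ≤ 2 * B₀⁻¹ + t := by
  have hB' : 0 < B₀⁻¹ := by positivity
  have hs : |B₀⁻¹ * Real.sin (B₀ * t)| ≤ 2 * B₀⁻¹ + t := by
    rw [abs_mul, abs_of_pos hB']
    nlinarith [Real.abs_sin_le_one (B₀ * t)]
  have hc : |B₀⁻¹ * (Real.cos (B₀ * t) - 1)| ≤ 2 * B₀⁻¹ + t := by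
    rw [abs_mul, abs_of_pos hB']
    have : |Real.cos (B₀ * t) - 1| ≤ 2 := by
      rw [abs_le]; constructor <;> linarith [Real.cos_le_one (B₀ * t), Real.neg_one_le_cos (B₀ * t)]
    nlinarith
  have h0 : (0 : ℝ) ≤ 2 * B₀⁻¹ + t := by positivity
  have h2 : |t| ≤ 2 * B₀⁻¹ + t := by rw [abs_of_nonneg ht]; linarith
  have hc' : |B₀⁻¹ * (-Real.cos (B₀ * t) + 1)| ≤ 2 * B₀⁻¹ + t := by
    rw [← abs_neg]; convert! hc using 2; ring
  fin_cases i <;> fin_cases j <;>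
    simp [gyro, block, rot, Real.cos_pi_div_two_sub, Real.sin_pi_div_two_sub] <;>
    first | exact hs | exact hc | exact hc' | exact h0 | exact h2 |
      (simpa [sub_eq_add_neg] using hc) |
      (simpa using hs) | (simpa using hc')

/-! ### Fourier transforms in phase space -/

/-- The integrable weight `(1 + |v|)⁻⁴` on velocity space. -/
def weight (v : R3) : ℝ := ((1 + ‖v‖) ^ 4)⁻¹

theorem weight_pos (v : R3) : 0 < weight v := by
  unfold weight; positivity

theorem integrable_weight : Integrable weight := by
  have h := integrable_one_add_norm (E := R3) (μ := volume) (r := 4) (by simp; norm_num)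
  refine h.congr (Filter.Eventually.of_forall fun v => ?_)
  simp only [weight]
  rw [Real.rpow_neg (by positivity)]
  norm_cast

/-- The weight varies slowly: it changes by a bounded factor under bounded translations. -/
theorem weight_add_le (v w : R3) : weight (v + w) ≤ (1 + ‖w‖) ^ 4 * weight v := by
  unfold weight
  rw [← div_eq_mul_inv, le_div_iff₀ (by positivity), inv_mul_le_iff₀ (by positivity), ← mul_pow]
  gcongr
  have h : ‖v‖ ≤ ‖v + w‖ + ‖w‖ := by
    simpa using norm_sub_le (v + w) w
  nlinarith [norm_nonneg w, norm_nonneg (v + w)]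

theorem weight_axisRotation (a : ℝ) (v : R3) : weight (axisRotation a v) = weight v := by
  simp [weight]

theorem norm_le_of_weight {E : Type*} [NormedAddCommGroup E] {y : E} {C : ℝ} {v : R3}
    (h : (1 + ‖v‖) ^ 4 * ‖y‖ ≤ C) : ‖y‖ ≤ C * weight v := by
  unfold weight
  rw [← div_eq_mul_inv, le_div_iff₀ (by positivity), mul_comm]
  exact h

/-- Functions on phase space that are `2π`-periodic in `x` and of class `Cⁿ`, with derivatives up to
order `n` that are `O((1 + |v|)⁻⁴)`. -/
structure PhaseDecay (n : ℕ) (g : R3 → R3 → ℝ) : Prop where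
  periodic : ∀ v, Periodic3 (fun x => g x v)
  smooth : ContDiff ℝ n (Function.uncurry g)
  decay : ∀ m : ℕ, m ≤ n → ∃ C : ℝ, ∀ x v : R3,
    (1 + ‖v‖) ^ 4 * ‖iteratedFDeriv ℝ m (Function.uncurry g) (x, v)‖ ≤ C

theorem PhaseDecay.mono {n m : ℕ} {g : R3 → R3 → ℝ} (h : PhaseDecay n g) (hm : m ≤ n) :
    PhaseDecay m g :=
  ⟨h.periodic, h.smooth.of_le (by exact_mod_cast hm), fun j hj => h.decay j (hj.trans hm)⟩

theorem PhaseDecay.exists_bound {n : ℕ} {g : R3 → R3 → ℝ} (h : PhaseDecay n g) :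
    ∃ C, 0 ≤ C ∧ ∀ x v, |g x v| ≤ C * weight v := by
  obtain ⟨C, hC⟩ := h.decay 0 (Nat.zero_le _)
  have h1 : ∀ x v, |g x v| ≤ C * weight v := by
    intro x v
    have := hC x v
    rw [norm_iteratedFDeriv_zero] at this
    exact norm_le_of_weight this
  refine ⟨C, ?_, h1⟩
  have := (abs_nonneg _).trans (h1 0 0)
  exact nonneg_of_mul_nonneg_left this (weight_pos 0)

/-- Directional derivative on phase space. -/
def phaseDeriv (g : R3 → R3 → ℝ) (w : R3 × R3) (x v : R3) : ℝ :=
  fderiv ℝ (Function.uncurry g) (x, v) w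

theorem PhaseDecay.deriv {n : ℕ} {g : R3 → R3 → ℝ} (h : PhaseDecay (n + 1) g) (w : R3 × R3) :
    PhaseDecay n (phaseDeriv g w) := by
  have hs : ContDiff ℝ n (fderiv ℝ (Function.uncurry g)) :=
    h.smooth.fderiv_right (by exact_mod_cast le_rfl)
  have hu : Function.uncurry (phaseDeriv g w) = fun p => fderiv ℝ (Function.uncurry g) p w := rfl
  refine ⟨fun v k x => ?_, ?_, fun m hm => ?_⟩
  · have h1 : (fun p : R3 × R3 => Function.uncurry g (p + ((2 * Real.pi) • k.toR3, 0)))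
        = Function.uncurry g := by
      ext ⟨x, v⟩
      simpa [Function.uncurry] using h.periodic v k x
    have h2 := fderiv_comp_add_right (𝕜 := ℝ) (f := Function.uncurry g) (x := (x, v))
      ((2 * Real.pi) • k.toR3, (0 : R3))
    rw [h1] at h2
    simp only [phaseDeriv]
    rw [h2]
    simp
  · rw [hu]
    exact hs.clm_apply contDiff_const
  · obtain ⟨C, hC⟩ := h.decay (m + 1) (by omega)
    refine ⟨‖w‖ * C, fun x v => ?_⟩
    have h1 := norm_iteratedFDeriv_clm_apply_const (𝕜 := ℝ) (f := fderiv ℝ (Function.uncurry g))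
      (c := w) (x := (x, v)) (N := n) (n := m) hs.contDiffAt (by exact_mod_cast hm)
    rw [norm_iteratedFDeriv_fderiv] at h1
    rw [hu]
    calc (1 + ‖v‖) ^ 4 * ‖iteratedFDeriv ℝ m (fun p => fderiv ℝ (Function.uncurry g) p w) (x, v)‖
        ≤ (1 + ‖v‖) ^ 4 * (‖w‖ * ‖iteratedFDeriv ℝ (m + 1) (Function.uncurry g) (x, v)‖) := by
          gcongr
      _ = ‖w‖ * ((1 + ‖v‖) ^ 4 * ‖iteratedFDeriv ℝ (m + 1) (Function.uncurry g) (x, v)‖) := by ring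
      _ ≤ ‖w‖ * C := by gcongr; exact hC x v

/-- The Fourier transform of `g` in both variables, at `(k, ξ) ∈ ℤ³ × ℝ³`. -/
def phaseFourier (g : R3 → R3 → ℝ) (k : Mode) (ξ : R3) : ℂ :=
  ∫ v, Complex.exp (-Complex.I * (inner ℝ ξ v : ℝ)) * torusFourier (fun x => g x v) k

theorem continuous_torusFourier {Y : Type*} [TopologicalSpace Y] [FirstCountableTopology Y]
    [LocallyCompactSpace Y] {g : Y → R3 → ℝ} (hg : Continuous (Function.uncurry g)) (k : Mode) :
    Continuous fun y => torusFourier (g y) k := by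
  refine continuous_parametric_integral_of_continuous ?_ isCompact_cell
  exact ((continuous_exp_inner k).comp continuous_snd).mul (Complex.continuous_ofReal.comp hg)

theorem PhaseDecay.integrable_torusFourier {n : ℕ} {g : R3 → R3 → ℝ} (h : PhaseDecay n g)
    (k : Mode) : Integrable fun v => torusFourier (fun x => g x v) k := by
  obtain ⟨C, _, hC⟩ := h.exists_bound
  refine (integrable_weight.const_mul (C * volume.real cell)).mono'
    (continuous_torusFourier (g := fun v x => g x v) (h.smooth.continuous.comp continuous_swap)
      k).aestronglyMeasurable (Filter.Eventually.of_forall fun v => ?_)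
  refine (norm_torusFourier_le (fun x => hC x v) k).trans (le_of_eq ?_)
  ring

theorem continuous_exp_inner_left (v : R3) :
    Continuous fun ξ : R3 => Complex.exp (-Complex.I * (inner ℝ ξ v : ℝ)) := by
  have : Continuous fun ξ : R3 => inner ℝ ξ v := continuous_id.inner continuous_const
  fun_prop

theorem continuous_exp_inner_right (ξ : R3) :
    Continuous fun v : R3 => Complex.exp (-Complex.I * (inner ℝ ξ v : ℝ)) := by
  have : Continuous fun v : R3 => inner ℝ ξ v := continuous_const.inner continuous_id
  fun_prop

theorem integrable_exp_inner_mul {c : R3 → ℂ} (hc : Integrable c) (ξ : R3) :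
    Integrable fun v => Complex.exp (-Complex.I * (inner ℝ ξ v : ℝ)) * c v :=
  hc.norm.mono' ((continuous_exp_inner_right ξ).aestronglyMeasurable.mul hc.aestronglyMeasurable)
    (Filter.Eventually.of_forall fun v => by rw [norm_mul, norm_exp_neg_I_mul, one_mul])

theorem continuous_integral_exp_inner {c : R3 → ℂ} (hc : Integrable c) :
    Continuous fun ξ : R3 => ∫ v, Complex.exp (-Complex.I * (inner ℝ ξ v : ℝ)) * c v := by
  refine continuous_of_dominated (bound := fun v => ‖c v‖)
    (fun ξ => (integrable_exp_inner_mul hc ξ).aestronglyMeasurable)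
    (fun ξ => Filter.Eventually.of_forall fun v => by rw [norm_mul, norm_exp_neg_I_mul, one_mul])
    hc.norm (Filter.Eventually.of_forall fun v =>
        (continuous_exp_inner_left v).mul continuous_const)

theorem PhaseDecay.continuous_phaseFourier {n : ℕ} {g : R3 → R3 → ℝ} (h : PhaseDecay n g)
    (k : Mode) : Continuous (phaseFourier g k) :=
  continuous_integral_exp_inner (h.integrable_torusFourier k)

theorem PhaseDecay.exists_norm_phaseFourier_le {n : ℕ} {g : R3 → R3 → ℝ} (h : PhaseDecay n g) :
    ∃ C, 0 ≤ C ∧ ∀ k ξ, ‖phaseFourier g k ξ‖ ≤ C := by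
  obtain ⟨C, hC0, hC⟩ := h.exists_bound
  refine ⟨∫ v, C * volume.real cell * weight v, integral_nonneg fun v => ?_, fun k ξ => ?_⟩
  · have := (weight_pos v).le
    simp only [Pi.zero_apply]
    positivity
  refine norm_integral_le_of_norm_le (integrable_weight.const_mul _)
    (Filter.Eventually.of_forall fun v => ?_)
  rw [norm_mul, norm_exp_neg_I_mul, one_mul]
  refine (norm_torusFourier_le (fun x => hC x v) k).trans (le_of_eq ?_)
  ring

theorem phaseFourier_shift {g : R3 → R3 → ℝ} (hg : ∀ v, Periodic3 (fun x => g x v)) (a b : R3)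
    (k : Mode) (ξ : R3) :
    phaseFourier (fun x v => g (x + a) (v + b)) k ξ
      = Complex.exp (Complex.I * (inner ℝ k.toR3 a + inner ℝ ξ b : ℝ)) * phaseFourier g k ξ := by
  unfold phaseFourier
  rw [← integral_add_right_eq_self (fun v => Complex.exp (-Complex.I * (inner ℝ ξ v : ℝ)) *
    torusFourier (fun x => g x v) k) b, ← integral_const_mul]
  congr 1
  ext v
  rw [torusFourier_shift (hg (v + b)) a k, ← mul_assoc, ← mul_assoc, ← Complex.exp_add,
    ← Complex.exp_add, inner_add_right]
  push_cast
  ring_nf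

theorem PhaseDecay.integrable_prod {n : ℕ} {g : R3 → R3 → ℝ} (h : PhaseDecay n g)
    (k : Mode) (ξ : R3) : Integrable (fun p : R3 × R3 =>
      Complex.exp (-Complex.I * (inner ℝ ξ p.1 : ℝ)) *
        (Complex.exp (-Complex.I * (inner ℝ k.toR3 p.2 : ℝ)) * (g p.2 p.1 : ℂ)))
      (volume.prod (volume.restrict cell)) := by
  obtain ⟨C, _, hC⟩ := h.exists_bound
  have hi : Integrable (fun p : R3 × R3 => (C * weight p.1) * (1 : ℝ))
      (volume.prod (volume.restrict cell)) :=
    (integrable_weight.const_mul C).mul_prod (integrable_const 1)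
  refine hi.mono' (Continuous.aestronglyMeasurable ?_) (Filter.Eventually.of_forall fun p => ?_)
  · exact ((continuous_exp_inner_right ξ).comp continuous_fst).mul
      (((continuous_exp_inner k).comp continuous_snd).mul
        (Complex.continuous_ofReal.comp (h.smooth.continuous.comp continuous_swap)))
  · rw [norm_mul, norm_mul, norm_exp_neg_I_mul, norm_exp_neg_I_mul, one_mul, one_mul, mul_one,
      Complex.norm_real]
    exact hC _ _

theorem PhaseDecay.phaseFourier_eq_integral_prod {n : ℕ} {g : R3 → R3 → ℝ} (h : PhaseDecay n g)
    (k : Mode) (ξ : R3) : phaseFourier g k ξ = ∫ p : R3 × R3,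
      Complex.exp (-Complex.I * (inner ℝ ξ p.1 : ℝ)) *
        (Complex.exp (-Complex.I * (inner ℝ k.toR3 p.2 : ℝ)) * (g p.2 p.1 : ℂ))
      ∂(volume.prod (volume.restrict cell)) := by
  rw [integral_prod _ (h.integrable_prod k ξ), phaseFourier]
  congr 1
  ext v
  rw [torusFourier, ← integral_const_mul]

theorem PhaseDecay.shift {n : ℕ} {g : R3 → R3 → ℝ} (h : PhaseDecay n g) (a b : R3) :
    PhaseDecay 0 (fun x v => g (x + a) (v + b)) := by
  obtain ⟨C, hC0, hC⟩ := h.exists_bound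
  refine ⟨fun v k x => ?_, ?_, fun m hm => ⟨C * (1 + ‖b‖) ^ 4, fun x v => ?_⟩⟩
  · have := h.periodic (v + b) k (x + a)
    simp only at this ⊢
    rw [add_right_comm, this]
  · have h0 := h.smooth.continuous
    rw [Nat.cast_zero, contDiff_zero]
    exact h0.comp (by fun_prop : Continuous fun p : R3 × R3 => (p.1 + a, p.2 + b))
  · obtain rfl : m = 0 := by omega
    rw [norm_iteratedFDeriv_zero]
    have h1 : |g (x + a) (v + b)| ≤ C * (1 + ‖b‖) ^ 4 * weight v := by
      refine (hC _ _).trans ?_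
      rw [mul_assoc]
      gcongr
      exact weight_add_le v b
    rw [weight, ← div_eq_mul_inv, le_div_iff₀ (by positivity)] at h1
    rw [mul_comm]
    exact h1

/-- Differentiation in phase space becomes multiplication on the Fourier side. -/
theorem PhaseDecay.phaseFourier_deriv {n : ℕ} {g : R3 → R3 → ℝ} (h : PhaseDecay (n + 1) g)
    (w : R3 × R3) (k : Mode) (ξ : R3) :
    phaseFourier (phaseDeriv g w) k ξ
      = Complex.I * (inner ℝ k.toR3 w.1 + inner ℝ ξ w.2 : ℝ) * phaseFourier g k ξ := by
  obtain ⟨C, hC0, hC⟩ := (h.deriv w).exists_bound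
  have hcd : Continuous (Function.uncurry (phaseDeriv g w)) := (h.deriv w).smooth.continuous
  have hdiff : Differentiable ℝ (Function.uncurry g) :=
    h.smooth.differentiable (by exact_mod_cast Nat.succ_ne_zero n)
  have hL := (hasDerivAt_integral_of_dominated_loc_of_deriv_le
    (μ := (volume : Measure R3).prod ((volume : Measure R3).restrict cell))
    (F := fun (s : ℝ) (p : R3 × R3) => Complex.exp (-Complex.I * (inner ℝ ξ p.1 : ℝ)) *
        (Complex.exp (-Complex.I * (inner ℝ k.toR3 p.2 : ℝ)) *
          (g (p.2 + s • w.1) (p.1 + s • w.2) : ℂ)))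
    (F' := fun (s : ℝ) (p : R3 × R3) => Complex.exp (-Complex.I * (inner ℝ ξ p.1 : ℝ)) *
        (Complex.exp (-Complex.I * (inner ℝ k.toR3 p.2 : ℝ)) *
          (phaseDeriv g w (p.2 + s • w.1) (p.1 + s • w.2) : ℂ)))
    (x₀ := 0) (s := Icc (-1) 1) (bound := fun p => C * (1 + ‖w.2‖) ^ 4 * weight p.1 * 1)
    (Icc_mem_nhds (by norm_num) (by norm_num))
    (Filter.Eventually.of_forall fun s =>
      ((h.shift (s • w.1) (s • w.2)).integrable_prod k ξ).aestronglyMeasurable)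
    ((h.shift ((0 : ℝ) • w.1) ((0 : ℝ) • w.2)).integrable_prod k ξ)
    (((h.deriv w).shift ((0 : ℝ) • w.1) ((0 : ℝ) • w.2)).integrable_prod k ξ).aestronglyMeasurable
    (Filter.Eventually.of_forall fun p s hs => ?_) ?_
    (Filter.Eventually.of_forall fun p s _ => ?_)).2
  · have hEq : (fun s : ℝ => ∫ p : R3 × R3, Complex.exp (-Complex.I * (inner ℝ ξ p.1 : ℝ)) *
        (Complex.exp (-Complex.I * (inner ℝ k.toR3 p.2 : ℝ)) *
          (g (p.2 + s • w.1) (p.1 + s • w.2) : ℂ)) ∂(volume.prod (volume.restrict cell)))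
        = fun s : ℝ => Complex.exp (Complex.I * ((s * (inner ℝ k.toR3 w.1 + inner ℝ ξ w.2) : ℝ))) *
          phaseFourier g k ξ := by
      ext s
      rw [← (h.shift (s • w.1) (s • w.2)).phaseFourier_eq_integral_prod k ξ,
        phaseFourier_shift h.periodic, inner_smul_right, inner_smul_right, mul_add]
    rw [hEq] at hL
    have hR : HasDerivAt (fun s : ℝ =>
        Complex.exp (Complex.I * ((s * (inner ℝ k.toR3 w.1 + inner ℝ ξ w.2) : ℝ))) *
          phaseFourier g k ξ)
        (Complex.I * (inner ℝ k.toR3 w.1 + inner ℝ ξ w.2 : ℝ) * phaseFourier g k ξ) 0 := by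
      have h2 := (((hasDerivAt_id' (0 : ℝ)).mul_const
        (inner ℝ k.toR3 w.1 + inner ℝ ξ w.2)).ofReal_comp).const_mul Complex.I
      have h3 := (h2.cexp).mul_const (phaseFourier g k ξ)
      simpa using h3
    have := hL.unique hR
    rw [← this, (h.deriv w).phaseFourier_eq_integral_prod]
    simp only [zero_smul, add_zero]
  · rw [norm_mul, norm_mul, norm_exp_neg_I_mul, norm_exp_neg_I_mul, one_mul, one_mul, mul_one,
      Complex.norm_real]
    refine (hC _ _).trans ?_
    rw [mul_assoc]
    refine mul_le_mul_of_nonneg_left ((weight_add_le _ _).trans ?_) hC0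
    have := (weight_pos p.1).le
    gcongr
    rw [norm_smul]
    exact mul_le_of_le_one_left (norm_nonneg _) (by rw [Real.norm_eq_abs, abs_le]; exact hs)
  · exact (integrable_weight.const_mul _).mul_prod (integrable_const 1)
  · have h1 : HasDerivAt (fun s : ℝ => (p.2 + s • w.1, p.1 + s • w.2)) w s := by
      have e1 : HasDerivAt (fun s : ℝ => p.2 + s • w.1) w.1 s := by
        simpa using ((hasDerivAt_id s).smul_const w.1).const_add p.2
      have e2 : HasDerivAt (fun s : ℝ => p.1 + s • w.2) w.2 s := by
        simpa using ((hasDerivAt_id s).smul_const w.2).const_add p.1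
      exact e1.prodMk e2
    have h2 : HasDerivAt (fun s : ℝ => g (p.2 + s • w.1) (p.1 + s • w.2))
        (phaseDeriv g w (p.2 + s • w.1) (p.1 + s • w.2)) s :=
      HasFDerivAt.comp_hasDerivAt (l := Function.uncurry g) s
        (hdiff (p.2 + s • w.1, p.1 + s • w.2)).hasFDerivAt h1
    exact (h2.ofReal_comp.const_mul _).const_mul _

/-- The coordinate vectors of `ℝ³`. -/
def unitVec (j : Fin 3) : R3 := EuclideanSpace.single j 1

theorem inner_unitVec (v : R3) (j : Fin 3) : inner ℝ v (unitVec j) = v j := by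
  simp [unitVec, EuclideanSpace.inner_single_right]

theorem PhaseDecay.exists_vertical_decay {g : R3 → R3 → ℝ} (h : PhaseDecay 1 g) :
    ∃ C, 0 ≤ C ∧ ∀ k ξ, (1 + |ξ 2|) * ‖phaseFourier g k ξ‖ ≤ C := by
  obtain ⟨C, hC0, hC⟩ := h.exists_norm_phaseFourier_le
  obtain ⟨D, hD0, hD⟩ := (PhaseDecay.deriv (n := 0) h (0, unitVec 2)).exists_norm_phaseFourier_le
  refine ⟨C + D, by positivity, fun k ξ => ?_⟩
  have h1 := hD k ξ
  rw [PhaseDecay.phaseFourier_deriv (n := 0) h, norm_mul, norm_mul, Complex.norm_I, one_mul,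
    Complex.norm_real, inner_unitVec, inner_zero_right, zero_add, Real.norm_eq_abs] at h1
  linarith [hC k ξ]

theorem norm_phaseFourier_deriv_deriv {n : ℕ} {g : R3 → R3 → ℝ} (h : PhaseDecay (n + 2) g)
    (w : R3 × R3) (k : Mode) (ξ : R3) :
    ‖phaseFourier (phaseDeriv (phaseDeriv g w) w) k ξ‖
      = (inner ℝ k.toR3 w.1 + inner ℝ ξ w.2) ^ 2 * ‖phaseFourier g k ξ‖ := by
  rw [(PhaseDecay.deriv (n := n + 1) h w).phaseFourier_deriv,
    PhaseDecay.phaseFourier_deriv (n := n + 1) h, norm_mul, norm_mul, norm_mul, norm_mul,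
    Complex.norm_I, Complex.norm_real, Real.norm_eq_abs, ← sq_abs]
  ring

/-- Two derivatives in `x` and one in `v` give decay of order two in `k` and of order one in the
velocity frequency. -/
theorem PhaseDecay.exists_decay {g : R3 → R3 → ℝ} (h : PhaseDecay 3 g) :
    ∃ C, 0 ≤ C ∧ ∀ (k : Mode) ξ,
      (1 + ‖k.toR3‖ ^ 2) * (1 + |ξ 2|) * ‖phaseFourier g k ξ‖ ≤ C := by
  have hD : ∀ j, PhaseDecay 1 (phaseDeriv (phaseDeriv g (unitVec j, 0)) (unitVec j, 0)) := fun j =>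
    PhaseDecay.deriv (n := 1) (PhaseDecay.deriv (n := 2) h _) _
  obtain ⟨C, hC0, hC⟩ := (h.mono (m := 1) (by norm_num)).exists_vertical_decay
  choose D hD0 hDb using fun j => (hD j).exists_vertical_decay
  refine ⟨C + (D 0 + D 1 + D 2), by have := hD0 0; have := hD0 1; have := hD0 2; positivity,
    fun k ξ => ?_⟩
  have h1 : ∀ j, (1 + |ξ 2|) * (k.toR3 j ^ 2 * ‖phaseFourier g k ξ‖) ≤ D j := by
    intro j
    have := hDb j k ξ
    rw [norm_phaseFourier_deriv_deriv (n := 1) h, inner_unitVec, inner_zero_right, add_zero] at this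
    exact this
  rw [norm_sq_R3]
  linarith [hC k ξ, h1 0, h1 1, h1 2]

theorem IsInitialDatum.phaseDecay {f₀ : R3 → R3 → ℝ} (h : IsInitialDatum f₀) : PhaseDecay 3 f₀ :=
  ⟨h.periodic, by exact_mod_cast h.smooth, h.decay⟩

/-! ### Equilibria -/

theorem IsEquilibrium.phaseDecay {B₀ : ℝ} {μ : R3 → ℝ} (h : IsEquilibrium B₀ μ) :
    PhaseDecay 3 (fun _ v => μ v) := by
  have hu : Function.uncurry (fun _ v : R3 => μ v) = μ ∘ (ContinuousLinearMap.snd ℝ R3 R3) := rfl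
  refine ⟨fun v k x => rfl, ?_, fun n hn => ?_⟩
  · rw [hu]
    exact_mod_cast h.smooth.comp (ContinuousLinearMap.snd ℝ R3 R3).contDiff
  · obtain ⟨C, hC⟩ := h.decay n hn
    refine ⟨C, fun x v => ?_⟩
    rw [hu, ContinuousLinearMap.iteratedFDeriv_comp_right _ h.smooth _ (by exact_mod_cast hn)]
    refine le_trans ?_ (hC v)
    gcongr
    refine (ContinuousMultilinearMap.norm_compContinuousLinearMap_le _ _).trans ?_
    refine mul_le_of_le_one_right (norm_nonneg _) (Finset.prod_le_one (fun _ _ => norm_nonneg _)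
      fun _ _ => ContinuousLinearMap.norm_snd_le ℝ R3 R3)

theorem volume_cell_pos : 0 < volume.real cell := by
  have h : {x : R3 | ∀ i, x i ∈ Ioo 0 (2 * Real.pi)} ⊆ cell := fun x hx i =>
      Ioo_subset_Icc_self (hx i)
  have ho : IsOpen {x : R3 | ∀ i, x i ∈ Ioo 0 (2 * Real.pi)} := by
    have : {x : R3 | ∀ i, x i ∈ Ioo 0 (2 * Real.pi)}
        = ⋂ i, (fun x : R3 => x i) ⁻¹' Ioo 0 (2 * Real.pi) := by
      ext x; simp
    rw [this]
    exact isOpen_iInter_of_finite fun i => isOpen_Ioo.preimage (by fun_prop)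
  have hne : {x : R3 | ∀ i, x i ∈ Ioo 0 (2 * Real.pi)}.Nonempty :=
    ⟨WithLp.toLp 2 fun _ => Real.pi, fun i => ⟨Real.pi_pos, by simp only; linarith [Real.pi_pos]⟩⟩
  rw [measureReal_def]
  exact ENNReal.toReal_pos ((ho.measure_pos volume hne).trans_le (measure_mono h)).ne'
    isCompact_cell.measure_lt_top.ne

theorem phaseFourier_const (μ : R3 → ℝ) (ξ : R3) :
    phaseFourier (fun _ v => μ v) 0 ξ = volume.real cell * velFourier μ ξ := by
  unfold phaseFourier velFourier
  rw [← integral_const_mul]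
  congr 1
  ext v
  have h : torusFourier (fun _ => μ v) 0 = volume.real cell * μ v := by
    have h0 : Mode.toR3 0 = 0 := by ext i; simp [Mode.toR3]
    simp [torusFourier, h0]
  rw [h]
  ring

theorem IsEquilibrium.velFourier_fderiv {B₀ : ℝ} {μ : R3 → ℝ} (h : IsEquilibrium B₀ μ) (w ξ : R3) :
    ∫ v, Complex.exp (-Complex.I * (inner ℝ ξ v : ℝ)) * (fderiv ℝ μ v w : ℂ)
      = Complex.I * (inner ℝ ξ w : ℝ) * velFourier μ ξ := by
  have h1 := PhaseDecay.phaseFourier_deriv (n := 2) h.phaseDecay (0, w) 0 ξ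
  have h2 : phaseDeriv (fun _ v => μ v) (0, w) = fun _ v => fderiv ℝ μ v w := by
    ext x v
    have hu : Function.uncurry (fun _ v : R3 => μ v) = μ ∘ (ContinuousLinearMap.snd ℝ R3 R3) := rfl
    rw [phaseDeriv, hu, fderiv_comp _ (h.smooth.differentiable (by norm_num) _)
      (ContinuousLinearMap.differentiableAt _), ContinuousLinearMap.fderiv]
    simp
  rw [h2, phaseFourier_const, phaseFourier_const μ] at h1
  have hv : (volume.real cell : ℂ) ≠ 0 := by exact_mod_cast volume_cell_pos.ne'
  refine mul_left_cancel₀ hv (Eq.trans ?_ (h1.trans ?_))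
  · rfl
  · simp only [inner_zero_right, zero_add]
    ring

theorem IsEquilibrium.exists_velFourier_decay {B₀ : ℝ} {μ : R3 → ℝ} (h : IsEquilibrium B₀ μ) :
    ∃ C, 0 ≤ C ∧ ∀ ξ, (1 + ‖ξ‖ ^ 2) * ‖velFourier μ ξ‖ ≤ C := by
  have hD : ∀ j, PhaseDecay 1 (phaseDeriv (phaseDeriv (fun _ v => μ v) (0, unitVec j))
      (0, unitVec j)) :=
    fun j => PhaseDecay.deriv (n := 1) (PhaseDecay.deriv (n := 2) h.phaseDecay _) _
  obtain ⟨C, hC0, hC⟩ := h.phaseDecay.exists_norm_phaseFourier_le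
  choose D hD0 hDb using fun j => (hD j).exists_norm_phaseFourier_le
  have hv := volume_cell_pos
  refine ⟨(C + (D 0 + D 1 + D 2)) / volume.real cell,
    by have := hD0 0; have := hD0 1; have := hD0 2; positivity, fun ξ => ?_⟩
  have h1 : ∀ j, ξ j ^ 2 * (volume.real cell * ‖velFourier μ ξ‖) ≤ D j := by
    intro j
    have := hDb j 0 ξ
    rw [norm_phaseFourier_deriv_deriv (n := 1) h.phaseDecay, inner_unitVec, inner_zero_right,
      zero_add, phaseFourier_const, norm_mul, Complex.norm_real, Real.norm_of_nonneg hv.le] at this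
    exact this
  have h2 := hC 0 ξ
  rw [phaseFourier_const, norm_mul, Complex.norm_real, Real.norm_of_nonneg hv.le] at h2
  rw [norm_sq_R3, le_div_iff₀ hv]
  linarith [h1 0, h1 1, h1 2]

theorem IsEquilibrium.continuous_velFourier {B₀ : ℝ} {μ : R3 → ℝ} (h : IsEquilibrium B₀ μ) :
    Continuous (velFourier μ) := by
  have h1 : velFourier μ = fun ξ => (volume.real cell : ℂ)⁻¹ * phaseFourier
      (fun _ v => μ v) 0 ξ := by
    ext ξ
    have hv : (volume.real cell : ℂ) ≠ 0 := by exact_mod_cast volume_cell_pos.ne'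
    rw [phaseFourier_const, inv_mul_cancel_left₀ hv]
  rw [h1]
  exact continuous_const.mul (h.phaseDecay.continuous_phaseFourier 0)

theorem hasDerivAt_charVel {B₀ : ℝ} (hB : B₀ ≠ 0) (t : ℝ) (v : R3) :
    HasDerivAt (fun s => charVel B₀ s v)
      (WithLp.toLp 2 ![B₀ * charVel B₀ t v 1, -(B₀ * charVel B₀ t v 0), 0]) t := by
  rw [hasDerivAt_iff_hasFDerivAt, ← hasFDerivWithinAt_univ, hasFDerivWithinAt_euclidean]
  intro i
  rw [hasFDerivWithinAt_univ]
  have h := (char_ode B₀ hB t 0 v i).2.hasFDerivAt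
  convert! h using 1

theorem hasDerivAt_charPos {B₀ : ℝ} (hB : B₀ ≠ 0) (t : ℝ) (x v : R3) :
    HasDerivAt (fun s => charPos B₀ s x v) (charVel B₀ t v) t := by
  rw [hasDerivAt_iff_hasFDerivAt, ← hasFDerivWithinAt_univ, hasFDerivWithinAt_euclidean]
  intro i
  rw [hasFDerivWithinAt_univ]
  have h := (char_ode B₀ hB t x v i).1.hasFDerivAt
  convert! h using 1

/-- The magnetic term is the derivative along the gyration. -/
theorem magnetic_eq (B₀ : ℝ) (h : R3 → ℝ) (v : R3) :
    magnetic B₀ h v = fderiv ℝ h v (WithLp.toLp 2 ![B₀ * v 1, -(B₀ * v 0), 0]) := by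
  rw [← inner_gradient_left, inner_R3, magnetic]
  simp
  ring

/-- An equilibrium is invariant under rotations about the magnetic axis. -/
theorem IsEquilibrium.apply_axisRotation {B₀ : ℝ} (hB : B₀ ≠ 0) {μ : R3 → ℝ}
    (h : IsEquilibrium B₀ μ) (a : ℝ) (v : R3) : μ (axisRotation a v) = μ v := by
  have hd : ∀ s, HasDerivAt (fun s => μ (charVel B₀ s v)) 0 s := by
    intro s
    have h1 := HasFDerivAt.comp_hasDerivAt (l := μ) s
      (h.smooth.differentiable (by norm_num) (charVel B₀ s v)).hasFDerivAt
      (hasDerivAt_charVel hB s v)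
    rw [← magnetic_eq, h.stationary] at h1
    exact h1
  have h2 := is_const_of_deriv_eq_zero (fun s => (hd s).differentiableAt) (fun s => (hd s).deriv)
    (a / B₀) 0
  simp only [charVel_eq, mul_zero] at h2
  rw [mul_div_cancel₀ _ hB] at h2
  rw [h2, axisRotation_apply]
  congr 1
  refine R3_ext ?_ ?_ ?_
  · rw [act_block_zero]; simp [rot]
  · rw [act_block_one]; simp [rot]
  · rw [act_block_two]; simp

theorem IsEquilibrium.velFourier_axisRotation {B₀ : ℝ} (hB : B₀ ≠ 0) {μ : R3 → ℝ}
    (h : IsEquilibrium B₀ μ) (a : ℝ) (ξ : R3) :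
    velFourier μ (axisRotation a ξ) = velFourier μ ξ := by
  unfold velFourier
  rw [← (axisRotation a).measurePreserving.integral_comp
    (axisRotation a).toHomeomorph.measurableEmbedding]
  congr 1
  ext v
  rw [LinearIsometryEquiv.inner_map_map, h.apply_axisRotation hB]

/-! ### Density, field and potential on the Fourier side -/

/-- The Fourier coefficients of a velocity average. -/
theorem torusFourier_integral {G : R3 → R3 → ℝ} (hG : Continuous (Function.uncurry G)) {C : ℝ}
    (hC : ∀ x w, |G x w| ≤ C * weight w) (k : Mode) :
    torusFourier (fun x => ∫ w, G x w) k = ∫ w, torusFourier (fun x => G x w) k := by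
  unfold torusFourier
  rw [integral_integral_swap]
  · congr 1
    ext x
    rw [← integral_complex_ofReal, ← integral_const_mul]
  · have hi : Integrable (fun p : R3 × R3 => (C * weight p.1) * (1 : ℝ))
        (volume.prod (volume.restrict cell)) :=
      (integrable_weight.const_mul C).mul_prod (integrable_const 1)
    have hc : Continuous fun p : R3 × R3 =>
        Complex.exp (-Complex.I * (inner ℝ k.toR3 p.2 : ℝ))
            * ((Function.uncurry G p.swap : ℝ) : ℂ) :=
      ((continuous_exp_inner k).comp continuous_snd).mul
        (Complex.continuous_ofReal.comp (hG.comp continuous_swap))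
    refine hi.mono' hc.aestronglyMeasurable (Filter.Eventually.of_forall fun p => ?_)
    simp only [Function.uncurry]
    rw [norm_mul, norm_exp_neg_I_mul, one_mul, mul_one, Complex.norm_real]
    exact hC _ _

theorem integrable_of_weight {G : R3 → R3 → ℝ} (hG : Continuous (Function.uncurry G)) {C : ℝ}
    (hC : ∀ x w, |G x w| ≤ C * weight w) (x : R3) : Integrable (G x) :=
  (integrable_weight.const_mul C).mono' (hG.uncurry_left x).aestronglyMeasurable
    (Filter.Eventually.of_forall fun w => hC x w)

theorem continuous_integral_of_weight {G : R3 → R3 → ℝ} (hG : Continuous (Function.uncurry G))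
    {C : ℝ} (hC : ∀ x w, |G x w| ≤ C * weight w) : Continuous fun x => ∫ w, G x w :=
  continuous_of_dominated (bound := fun w => C * weight w)
    (fun x => (hG.uncurry_left x).aestronglyMeasurable)
    (fun x => Filter.Eventually.of_forall fun w => hC x w) (integrable_weight.const_mul C)
    (Filter.Eventually.of_forall fun w => hG.uncurry_right w)

theorem freeDensity_eq (B₀ : ℝ) (f₀ : R3 → R3 → ℝ) (t : ℝ) (x : R3) :
    freeDensity B₀ f₀ t x = ∫ w, f₀ (x - drift B₀ t w) w := by
  exact (axisRotation (B₀ * t)).symm.measurePreserving.integral_comp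
    (axisRotation (B₀ * t)).symm.toHomeomorph.measurableEmbedding (fun w => f₀ (x - drift B₀ t w) w)

/-- The density of the free flow samples the transform of the initial datum along `R̃(t)k`. -/
theorem torusFourier_freeDensity (B₀ : ℝ) {f₀ : R3 → R3 → ℝ} {n : ℕ} (h : PhaseDecay n f₀) (t : ℝ)
    (k : Mode) : torusFourier (freeDensity B₀ f₀ t) k
      = phaseFourier f₀ k (act (gyro B₀ t) k.toR3) := by
  obtain ⟨C, _, hC⟩ := h.exists_bound
  rw [funext (freeDensity_eq B₀ f₀ t), torusFourier_integral (C := C) ?_ (fun x w => hC _ _),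
    phaseFourier]
  · congr 1
    ext w
    have := torusFourier_shift (h.periodic w) (-drift B₀ t w) k
    simp only [← sub_eq_add_neg] at this
    rw [this, inner_neg_right, inner_drift]
    push_cast
    ring_nf
  · exact h.smooth.continuous.comp
      (by fun_prop : Continuous fun p : R3 × R3 => (p.1 - drift B₀ t p.2, p.2))

theorem inner_field (U : ℝ → R3 → ℝ) (t : ℝ) (x p : R3) :
    inner ℝ (field U t x) p = -fderiv ℝ (U t) x p := by
  rw [field, inner_neg_left, inner_gradient_left]

theorem torusFourier_neg (h : R3 → ℝ) (k : Mode) :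
    torusFourier (fun x => -h x) k = -torusFourier h k := by
  simp [torusFourier, integral_neg]

theorem integrableOn_torusFourier {h : R3 → ℝ} (hc : Continuous h) (k : Mode) :
    IntegrableOn (fun x => Complex.exp (-Complex.I * (inner ℝ k.toR3 x : ℝ)) * (h x : ℂ)) cell :=
  ((continuous_exp_inner k).mul
      (Complex.continuous_ofReal.comp hc)).continuousOn.integrableOn_compact
    isCompact_cell

/-- The Laplacian multiplies the Fourier coefficients by `-|k|²`. -/
theorem torusFourier_laplacian {h : R3 → ℝ} (hh : Periodic3 h) (hc : ContDiff ℝ 2 h) (k : Mode) :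
    torusFourier (Δ h) k = -(‖k.toR3‖ ^ 2 : ℝ) * torusFourier h k := by
  have hd : ∀ j, ContDiff ℝ 1 (fun x => fderiv ℝ h x (unitVec j)) := fun j =>
    (hc.fderiv_right (m := 1) (by norm_num)).clm_apply contDiff_const
  have hp : ∀ j, Periodic3 (fun x => fderiv ℝ h x (unitVec j)) := by
    intro j n x
    have h1 : (fun y => h (y + (2 * Real.pi) • n.toR3)) = h := funext (hh n)
    have h2 := fderiv_comp_add_right (𝕜 := ℝ) (f := h) (x := x) ((2 * Real.pi) • n.toR3)
    rw [h1] at h2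
    simp only
    rw [h2]
  have hlap : ∀ x, Δ h x = ∑ j, fderiv ℝ (fun y => fderiv ℝ h y (unitVec j)) x (unitVec j) := by
    intro x
    rw [InnerProductSpace.laplacian_eq_iteratedFDeriv_orthonormalBasis h
        (EuclideanSpace.basisFun (Fin 3) ℝ)]
    refine Finset.sum_congr rfl fun j _ => ?_
    rw [iteratedFDeriv_two_apply, fderiv_clm_apply
      ((hc.fderiv_right (m := 1) (by norm_num)).differentiable (by norm_num) x)
      (differentiableAt_const _)]
    simp [unitVec]
  have hcont : ∀ j, Continuous fun x => fderiv ℝ (fun y => fderiv ℝ h y (unitVec j)) x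
      (unitVec j) :=
    fun j => ((hd j).continuous_fderiv (by norm_num)).clm_apply continuous_const
  have hsum : torusFourier (Δ h) k
      = ∑ j, torusFourier
          (fun x => fderiv ℝ (fun y => fderiv ℝ h y (unitVec j)) x (unitVec j)) k := by
    unfold torusFourier
    rw [← integral_finsetSum _ fun j _ => integrableOn_torusFourier (hcont j) k]
    congr 1
    ext x
    rw [hlap, Complex.ofReal_sum, Finset.mul_sum]
  rw [hsum]
  have hterm : ∀ j, torusFourier
      (fun x => fderiv ℝ (fun y => fderiv ℝ h y (unitVec j)) x (unitVec j)) k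
      = -((k.toR3 j) ^ 2 : ℝ) * torusFourier h k := by
    intro j
    rw [torusFourier_fderiv (hp j) (hd j), torusFourier_fderiv hh (hc.of_le (by norm_num)),
      inner_unitVec]
    push_cast
    linear_combination ((k.toR3 j : ℂ) ^ 2 * torusFourier h k) * Complex.I_sq
  simp only [hterm, Fin.sum_univ_three, norm_sq_R3]
  push_cast
  ring

section Solution

variable {B₀ : ℝ} {μ : R3 → ℝ} {f₀ : R3 → R3 → ℝ} {f : ℝ → R3 → R3 → ℝ} {U : ℝ → R3 → ℝ}

theorem IsSolution.torusFourier_density (h : IsSolution B₀ μ f₀ f U) {t : ℝ}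
    (ht : 0 ≤ t) (k : Mode) :
    torusFourier (fun x => ∫ v, f t x v) k = (‖k.toR3‖ ^ 2 : ℝ) * torusFourier (U t) k := by
  have h1 : (fun x => ∫ v, f t x v) = fun x => -Δ (U t) x := by
    ext x
    rw [h.poisson t ht x, neg_neg]
  rw [h1, torusFourier_neg, torusFourier_laplacian (h.periodic_U t ht) (h.smooth_U t ht)]
  ring

theorem IsSolution.torusFourier_inner_field (h : IsSolution B₀ μ f₀ f U) {t : ℝ}
    (ht : 0 ≤ t) (k : Mode) (p : R3) :
    torusFourier (fun x => inner ℝ (field U t x) p) k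
      = -(Complex.I * (inner ℝ k.toR3 p : ℝ)) * torusFourier (U t) k := by
  simp only [inner_field]
  rw [torusFourier_neg, torusFourier_fderiv (h.periodic_U t ht)
      ((h.smooth_U t ht).of_le (by norm_num))]
  ring

theorem IsSolution.field_periodic (h : IsSolution B₀ μ f₀ f U) {t : ℝ} (ht : 0 ≤ t)
    (k : Mode) (x : R3) : field U t (x + (2 * Real.pi) • k.toR3) = field U t x := by
  have h1 : (fun y => U t (y + (2 * Real.pi) • k.toR3)) = U t := funext (h.periodic_U t ht k)
  have h2 := fderiv_comp_add_right (𝕜 := ℝ) (f := U t) (x := x) ((2 * Real.pi) • k.toR3)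
  rw [h1] at h2
  simp only [field, gradient]
  rw [h2]

theorem IsSolution.continuousOn_torusFourier (h : IsSolution B₀ μ f₀ f U) {k : Mode}
    (hk : k.toR3 ≠ 0) :
    ContinuousOn (fun t => torusFourier (U t) k) (Ici 0) := by
  have h1 : ContinuousOn (fun t => torusFourier (fun x => inner ℝ (field U t x) k.toR3) k)
      (Ici 0) := by
    rw [continuousOn_iff_continuous_domRestrict]
    have : LocallyCompactSpace (Ici (0 : ℝ)) := isClosed_Ici.locallyCompactSpace
    refine continuous_torusFourier
      (g := fun (t : Ici (0 : ℝ)) x => inner ℝ (field U t x) k.toR3) ?_ k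
    refine Continuous.inner ?_ continuous_const
    exact h.continuous_field.comp_continuous
      (by fun_prop : Continuous fun p : Ici (0 : ℝ) × R3 => ((p.1 : ℝ), p.2))
      fun p => ⟨p.1.2, mem_univ _⟩
  have h2 : (‖k.toR3‖ ^ 2 : ℂ) ≠ 0 := by
    exact_mod_cast pow_ne_zero 2 (norm_ne_zero_iff.2 hk)
  -- only the field is assumed continuous in time; `Û = i k · Ê / |k|²` recovers the potential
  refine ((continuousOn_const (c := Complex.I / (‖k.toR3‖ ^ 2 : ℂ))).mul h1).congr fun t ht => ?_
  simp only [Pi.mul_apply]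
  rw [h.torusFourier_inner_field ht, real_inner_self_eq_norm_sq]
  push_cast
  rw [div_mul_eq_mul_div, eq_div_iff h2]
  linear_combination (torusFourier (U t) k * (‖k.toR3‖ : ℂ) ^ 2) * Complex.I_sq

theorem IsSolution.field_bounded (h : IsSolution B₀ μ f₀ f U) (T : ℝ) :
    ∃ M, 0 ≤ M ∧ ∀ t ∈ Icc 0 T, ∀ x, ‖field U t x‖ ≤ M := by
  obtain ⟨M, hM⟩ := ((isCompact_Icc (a := (0 : ℝ)) (b := T)).prod
    isCompact_cell).exists_bound_of_continuousOn
    (h.continuous_field.mono (prod_mono Icc_subset_Ici_self (subset_univ _)))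
  refine ⟨max M 0, le_max_right _ _, fun t ht x => ?_⟩
  rw [← apply_torusRep_toTorus (h.field_periodic ht.1) x]
  exact (hM (t, _) ⟨ht, torusRep_mem_cell _⟩).trans (le_max_left _ _)

end Solution

/-! ### Duhamel's formula and the Volterra equation of a Fourier mode -/

/-- The scalar convolution kernel `μ̂(R̃(t)k) k · R̃(t)k` of the mode `k`. -/
def modeKernel (B₀ : ℝ) (μ : R3 → ℝ) (k : Mode) (t : ℝ) : ℂ :=
  velFourier μ (act (gyro B₀ t) k.toR3) * (inner ℝ k.toR3 (act (gyro B₀ t) k.toR3) : ℝ)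

section Duhamel

variable {B₀ : ℝ} {μ : R3 → ℝ} {f₀ : R3 → R3 → ℝ} {f : ℝ → R3 → R3 → ℝ} {U : ℝ → R3 → ℝ}

/-- Along a characteristic, the Vlasov equation says that `f` changes at the rate `-E · ∇μ`. -/
theorem IsSolution.hasDerivAt_along (hB : B₀ ≠ 0) (h : IsSolution B₀ μ f₀ f U) {s : ℝ} (hs : 0 < s)
    (x w : R3) : HasDerivAt (fun s => f s (charPos B₀ s x w) (charVel B₀ s w))
      (-inner ℝ (field U s (charPos B₀ s x w)) (∇ μ (charVel B₀ s w))) s := by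
  set X := charPos B₀ s x w with hX
  set V := charVel B₀ s w with hV
  set V' : R3 := WithLp.toLp 2 ![B₀ * V 1, -(B₀ * V 0), 0] with hV'
  set F : ℝ × R3 × R3 → ℝ := fun p => f p.1 p.2.1 p.2.2 with hF
  have hmem : Ioi (0 : ℝ) ×ˢ (univ : Set (R3 × R3)) ∈ nhds (s, X, V) :=
    (isOpen_Ioi.prod isOpen_univ).mem_nhds ⟨hs, mem_univ _⟩
  have hFd : HasFDerivAt F (fderiv ℝ F (s, X, V)) (s, X, V) :=
    ((h.smooth_f.contDiffAt hmem).differentiableAt (by norm_num)).hasFDerivAt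
  set L := fderiv ℝ F (s, X, V) with hL
  have hcurve : HasDerivAt (fun s => (s, charPos B₀ s x w, charVel B₀ s w)) ((1 : ℝ), V, V') s :=
    (hasDerivAt_id s).prodMk ((hasDerivAt_charPos hB s x w).prodMk (hasDerivAt_charVel hB s w))
  have hcomp := HasFDerivAt.comp_hasDerivAt (l := F) s hFd hcurve
  have ht : deriv (fun s => f s X V) s = L (1, 0, 0) := by
    have hc : HasDerivAt (fun r : ℝ => (r, X, V)) ((1 : ℝ), (0 : R3), (0 : R3)) s :=
      (hasDerivAt_id s).prodMk (hasDerivAt_const s (X, V))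
    exact (HasFDerivAt.comp_hasDerivAt (l := F) s hFd hc).deriv
  have hx : inner ℝ V (∇ (fun y => f s y V) X) = L (0, V, 0) := by
    have hc : HasFDerivAt (fun y : R3 => (s, y, V))
        ((0 : R3 →L[ℝ] ℝ).prod ((ContinuousLinearMap.id ℝ R3).prod (0 : R3 →L[ℝ] R3))) X :=
      (hasFDerivAt_const s X).prodMk ((hasFDerivAt_id X).prodMk (hasFDerivAt_const V X))
    have := (HasFDerivAt.comp X (g := F) hFd hc).fderiv
    rw [inner_gradient_right]
    change fderiv ℝ (F ∘ fun y => (s, y, V)) X V = _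
    rw [this]
    simp
  have hv : magnetic B₀ (fun y => f s X y) V = L (0, 0, V') := by
    have hc : HasFDerivAt (fun y : R3 => (s, X, y))
        ((0 : R3 →L[ℝ] ℝ).prod ((0 : R3 →L[ℝ] R3).prod (ContinuousLinearMap.id ℝ R3))) V :=
      (hasFDerivAt_const s V).prodMk ((hasFDerivAt_const X V).prodMk (hasFDerivAt_id V))
    have := (HasFDerivAt.comp V (g := F) hFd hc).fderiv
    rw [magnetic_eq]
    change fderiv ℝ (F ∘ fun y => (s, X, y)) V V' = _
    rw [this]
    simp
  have hsplit : L (1, V, V') = L (1, 0, 0) + L (0, V, 0) + L (0, 0, V') := by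
    rw [← map_add, ← map_add]
    simp
  -- the derivative along the curve is the sum of the first three terms of the Vlasov equation
  have hvl := h.vlasov s hs X V
  rw [ht, hx, hv] at hvl
  have hval : L (1, V, V') = -inner ℝ (field U s X) (∇ μ V) := by
    rw [hsplit]; linarith
  rw [hval] at hcomp
  exact hcomp

/-- The forcing `E · ∇μ` accumulated along the characteristic that arrives at `x` at time `t` with
initial velocity `w`. -/
def fieldWork (B₀ : ℝ) (μ : R3 → ℝ) (U : ℝ → R3 → ℝ) (t : ℝ) (x w : R3) : ℝ :=
  ∫ s in (0 : ℝ)..t,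
    inner ℝ (field U s (x - (drift B₀ t w - drift B₀ s w))) (∇ μ (charVel B₀ s w))

theorem IsEquilibrium.continuous_gradient (hμ : IsEquilibrium B₀ μ) : Continuous (∇ μ) := by
  have h1 := hμ.smooth.continuous_fderiv (by norm_num)
  exact (InnerProductSpace.toDual ℝ R3).symm.continuous.comp h1

theorem IsEquilibrium.exists_gradient_bound (hμ : IsEquilibrium B₀ μ) :
    ∃ C, 0 ≤ C ∧ ∀ v, ‖∇ μ v‖ ≤ C * weight v := by
  obtain ⟨C, hC⟩ := hμ.decay 1 (by norm_num)
  have h1 : ∀ v, ‖∇ μ v‖ ≤ C * weight v := by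
    intro v
    have := hC v
    rw [← norm_iteratedFDeriv_fderiv, norm_iteratedFDeriv_zero] at this
    have h2 : ‖∇ μ v‖ = ‖fderiv ℝ μ v‖ := by
      rw [gradient, LinearIsometryEquiv.norm_map]
    rw [h2]
    exact norm_le_of_weight this
  exact ⟨C, nonneg_of_mul_nonneg_left ((norm_nonneg _).trans (h1 0)) (weight_pos 0), h1⟩

/-- The integrand of `fieldWork` is continuous in time, position and velocity. -/
theorem IsSolution.continuousOn_power (h : IsSolution B₀ μ f₀ f U)
    (hμ : IsEquilibrium B₀ μ) (t : ℝ) :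
    ContinuousOn (fun p : ℝ × R3 × R3 => inner ℝ
      (field U p.1 (p.2.1 - (drift B₀ t p.2.2 - drift B₀ p.1 p.2.2))) (∇ μ (charVel B₀ p.1 p.2.2)))
      (Ici 0 ×ˢ univ) := by
  have c1 : Continuous fun p : ℝ × R3 × R3 => drift B₀ p.1 p.2.2 :=
    by fun_prop
  have c2 : Continuous fun p : ℝ × R3 × R3 => drift B₀ t p.2.2 :=
    by fun_prop
  have c3 : Continuous fun p : ℝ × R3 × R3 => charVel B₀ p.1 p.2.2 :=
    by fun_prop
  refine ContinuousOn.inner ?_ (hμ.continuous_gradient.comp c3).continuousOn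
  refine ContinuousOn.comp (g := fun p : ℝ × R3 => field U p.1 p.2)
    (f := fun p : ℝ × R3 × R3 => (p.1, p.2.1 - (drift B₀ t p.2.2 - drift B₀ p.1 p.2.2)))
    h.continuous_field ?_ fun p hp => ⟨hp.1, mem_univ _⟩
  exact (continuous_fst.prodMk (continuous_snd.fst.sub (c2.sub c1))).continuousOn

/-- Duhamel's formula, in terms of the initial velocity `w` of the characteristic. -/
theorem IsSolution.duhamel (hB : B₀ ≠ 0) (h : IsSolution B₀ μ f₀ f U) (hμ : IsEquilibrium B₀ μ)
    {t : ℝ} (ht : 0 ≤ t) (x w : R3) :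
    f t x (charVel B₀ t w) = f₀ (x - drift B₀ t w) w - fieldWork B₀ μ U t x w := by
  set x₀ := x - drift B₀ t w with hx0
  have hpos : ∀ s, charPos B₀ s x₀ w = x - (drift B₀ t w - drift B₀ s w) := by
    intro s
    rw [charPos_eq, hx0]
    abel
  have hcont : ContinuousOn (fun s => f s (charPos B₀ s x₀ w) (charVel B₀ s w)) (Icc 0 t) := by
    have c1 : Continuous fun s : ℝ => charPos B₀ s x₀ w :=
      continuous_iff_continuousAt.2 fun s => (hasDerivAt_charPos hB s x₀ w).continuousAt
    have c2 : Continuous fun s : ℝ => charVel B₀ s w :=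
      continuous_iff_continuousAt.2 fun s => (hasDerivAt_charVel hB s w).continuousAt
    exact ContinuousOn.comp (g := fun p : ℝ × R3 × R3 => f p.1 p.2.1 p.2.2)
      (f := fun s => (s, charPos B₀ s x₀ w, charVel B₀ s w)) h.continuous_f
      (continuous_id.prodMk (c1.prodMk c2)).continuousOn fun s hs => ⟨hs.1, mem_univ _⟩
  have hpow : ContinuousOn (fun s => inner ℝ
      (field U s (x - (drift B₀ t w - drift B₀ s w))) (∇ μ (charVel B₀ s w))) (Icc 0 t) :=
    ContinuousOn.comp (f := fun s : ℝ => (s, x, w)) (h.continuousOn_power hμ t)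
      (by fun_prop) fun s hs => ⟨hs.1, mem_univ _⟩
  have hint := intervalIntegral.integral_eq_sub_of_hasDerivAt_of_le ht hcont
    (fun s hs => h.hasDerivAt_along hB hs.1 x₀ w)
    (by
      simp only [hpos]
      exact (hpow.neg.intervalIntegrable_of_Icc ht))
  simp only [hpos] at hint
  rw [intervalIntegral.integral_neg] at hint
  have e0 : drift B₀ 0 w = 0 := by
    refine R3_ext ?_ ?_ ?_
    · rw [drift, act_block_zero]; simp [shift, rot]
    · rw [drift, act_block_one]; simp [shift, rot]
    · rw [drift, act_block_two]; simp
  have e1 : charVel B₀ 0 w = w := by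
    refine R3_ext ?_ ?_ ?_
    · rw [charVel, act_block_zero]; simp [rot]
    · rw [charVel, act_block_one]; simp [rot]
    · rw [charVel, act_block_two]; simp
  rw [sub_self, sub_zero, e0, sub_zero, e1, h.initial] at hint
  rw [fieldWork]
  linarith

theorem IsSolution.continuous_fieldWork (hB : B₀ ≠ 0) (h : IsSolution B₀ μ f₀ f U)
    (hμ : IsEquilibrium B₀ μ) (hf₀ : IsInitialDatum f₀) {t : ℝ} (ht : 0 ≤ t) :
    Continuous (Function.uncurry (fieldWork B₀ μ U t)) := by
  have h1 : Function.uncurry (fieldWork B₀ μ U t) = fun p : R3 × R3 =>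
      Function.uncurry f₀ (p.1 - drift B₀ t p.2, p.2) - f t p.1 (charVel B₀ t p.2) := by
    ext p
    simp only [Function.uncurry]
    rw [h.duhamel hB hμ ht]
    ring
  rw [h1]
  have c1 : Continuous fun p : R3 × R3 => drift B₀ t p.2 := by fun_prop
  have c2 : Continuous fun p : R3 × R3 => charVel B₀ t p.2 := by fun_prop
  refine (hf₀.smooth.continuous.comp ((continuous_fst.sub c1).prodMk continuous_snd)).sub ?_
  exact h.continuous_f.comp_continuous (f := fun p : R3 × R3 => (t, p.1, charVel B₀ t p.2))
    (continuous_const.prodMk (continuous_fst.prodMk c2)) fun p => ⟨ht, mem_univ _⟩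

theorem IsSolution.exists_power_bound (h : IsSolution B₀ μ f₀ f U)
    (hμ : IsEquilibrium B₀ μ) (t : ℝ) :
    ∃ C, 0 ≤ C ∧ ∀ s ∈ Icc 0 t, ∀ x w,
      |inner ℝ (field U s x) (∇ μ (charVel B₀ s w))| ≤ C * weight w := by
  obtain ⟨M, hM0, hM⟩ := h.field_bounded t
  obtain ⟨C, hC0, hC⟩ := hμ.exists_gradient_bound
  refine ⟨M * C, by positivity, fun s hs x w => ?_⟩
  refine (abs_real_inner_le_norm _ _).trans ?_
  have h1 := hC (charVel B₀ s w)
  rw [charVel_eq, weight_axisRotation] at h1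
  rw [mul_assoc, charVel_eq]
  exact mul_le_mul (hM s hs x) h1 (norm_nonneg _) hM0

theorem IsSolution.exists_fieldWork_bound (h : IsSolution B₀ μ f₀ f U) (hμ : IsEquilibrium B₀ μ)
    {t : ℝ} (ht : 0 ≤ t) : ∃ C, 0 ≤ C ∧ ∀ x w, |fieldWork B₀ μ U t x w| ≤ C * weight w := by
  obtain ⟨C, hC0, hC⟩ := h.exists_power_bound hμ t
  refine ⟨C * t, by positivity, fun x w => ?_⟩
  have := intervalIntegral.norm_integral_le_of_norm_le_const (a := 0) (b := t) (C := C * weight w)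
    (f := fun s => inner ℝ (field U s (x - (drift B₀ t w - drift B₀ s w))) (∇ μ (charVel B₀ s w)))
    (fun s hs => by
      rw [uIoc_of_le ht] at hs
      exact hC s ⟨hs.1.le, hs.2⟩ _ _)
  rw [sub_zero, abs_of_nonneg ht] at this
  refine this.trans (le_of_eq ?_)
  ring

/-- The Fourier coefficients of the accumulated forcing, at a fixed initial velocity `w`: a
translation in `x` becomes a phase. -/
theorem IsSolution.torusFourier_fieldWork (h : IsSolution B₀ μ f₀ f U) (hμ : IsEquilibrium B₀ μ)
    {t : ℝ} (ht : 0 ≤ t) (k : Mode) (w : R3) :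
    torusFourier (fun x => fieldWork B₀ μ U t x w) k = ∫ s in (0 : ℝ)..t,
      -(Complex.I * torusFourier (U s) k) *
        (Complex.exp (-Complex.I * (inner ℝ (act (gyro B₀ (t - s)) k.toR3) (charVel B₀ s w) : ℝ)) *
          (fderiv ℝ μ (charVel B₀ s w) k.toR3 : ℂ)) := by
  obtain ⟨C, hC0, hC⟩ := h.exists_power_bound hμ t
  have hcont : ContinuousOn (fun p : R3 × ℝ => inner ℝ
      (field U p.2 (p.1 - (drift B₀ t w - drift B₀ p.2 w))) (∇ μ (charVel B₀ p.2 w)))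
      (univ ×ˢ Ici 0) :=
    ContinuousOn.comp (f := fun p : R3 × ℝ => (p.2, p.1, w)) (h.continuousOn_power hμ t)
      (by fun_prop) fun p hp => ⟨hp.2, mem_univ _⟩
  have hswap : torusFourier (fun x => fieldWork B₀ μ U t x w) k = ∫ s in (0 : ℝ)..t,
      torusFourier (fun x => inner ℝ
        (field U s (x - (drift B₀ t w - drift B₀ s w))) (∇ μ (charVel B₀ s w))) k := by
    unfold torusFourier fieldWork
    simp only [intervalIntegral.integral_of_le ht]
    rw [integral_integral_swap]
    · congr 1
      ext x
      rw [← integral_complex_ofReal, ← integral_const_mul]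
    · have hm : ContinuousOn (fun p : ℝ × R3 =>
          Complex.exp (-Complex.I * (inner ℝ k.toR3 p.2 : ℝ)) *
          ((inner ℝ (field U p.1 (p.2 - (drift B₀ t w - drift B₀ p.1 w)))
            (∇ μ (charVel B₀ p.1 w)) : ℝ) : ℂ)) (Ioc 0 t ×ˢ cell) := by
        refine ((continuous_exp_inner k).comp continuous_snd).continuousOn.mul
          (Complex.continuous_ofReal.comp_continuousOn ?_)
        exact ContinuousOn.comp (f := fun p : ℝ × R3 => (p.2, p.1)) hcont (by fun_prop)
          fun p hp => ⟨mem_univ _, hp.1.1.le⟩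
      have hm' := hm.aestronglyMeasurable (μ := (volume : Measure ℝ).prod (volume : Measure R3))
        (measurableSet_Ioc.prod measurableSet_cell)
      rw [← Measure.prod_restrict] at hm'
      refine Integrable.mono' (g := fun _ => C * weight w) (integrable_const _) hm' ?_
      rw [Measure.prod_restrict]
      refine (ae_restrict_iff' (measurableSet_Ioc.prod measurableSet_cell)).2
        (Filter.Eventually.of_forall fun p hp => ?_)
      simp only [Function.uncurry]
      rw [norm_mul, norm_exp_neg_I_mul, one_mul, Complex.norm_real]
      exact hC p.1 ⟨hp.1.1.le, hp.1.2⟩ _ _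
  rw [hswap]
  refine intervalIntegral.integral_congr fun s hs => ?_
  beta_reduce
  rw [uIcc_of_le ht] at hs
  have hper : Periodic3 (fun x => inner ℝ (field U s x) (∇ μ (charVel B₀ s w))) := by
    intro n x
    simp only [h.field_periodic hs.1]
  have h1 := torusFourier_shift hper (-(drift B₀ t w - drift B₀ s w)) k
  simp only [← sub_eq_add_neg] at h1
  rw [h1, h.torusFourier_inner_field hs.1, inner_neg_right, drift_sub, inner_drift,
    inner_gradient_right]
  simp only [conj_trivial]
  push_cast
  ring_nf

/-- Integrated over `w`, the accumulated forcing is the convolution of `Û` with the mode kernel: the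
Fourier transform of `∇μ` supplies the factor `μ̂`. -/
theorem IsSolution.torusFourier_integral_fieldWork (hB : B₀ ≠ 0) (h : IsSolution B₀ μ f₀ f U)
    (hμ : IsEquilibrium B₀ μ) (hf₀ : IsInitialDatum f₀) (k : Mode) {t : ℝ} (ht : 0 ≤ t) :
    torusFourier (fun x => ∫ w, fieldWork B₀ μ U t x w) k
      = ∫ s in (0 : ℝ)..t, modeKernel B₀ μ k (t - s) * torusFourier (U s) k := by
  obtain ⟨C, hC0, hC⟩ := h.exists_fieldWork_bound hμ ht
  have hwc := h.continuous_fieldWork hB hμ hf₀ ht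
  rw [torusFourier_integral hwc hC]
  simp only [h.torusFourier_fieldWork hμ ht]
  -- for `k = 0` the coefficient `Û` need not be measurable in time, but both sides vanish
  by_cases hk : k.toR3 = 0
  · simp [hk, modeKernel]
  simp only [intervalIntegral.integral_of_le ht]
  rw [integral_integral_swap]
  · refine setIntegral_congr_fun measurableSet_Ioc fun s hs => ?_
    simp only [charVel_eq]
    rw [integral_const_mul, (axisRotation (B₀ * s)).measurePreserving.integral_comp
      (axisRotation (B₀ * s)).toHomeomorph.measurableEmbedding (fun v =>
        Complex.exp (-Complex.I * (inner ℝ (act (gyro B₀ (t - s)) k.toR3) v : ℝ)) *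
        (fderiv ℝ μ v k.toR3 : ℂ)), hμ.velFourier_fderiv, modeKernel,
      real_inner_comm]
    linear_combination (-(torusFourier (U s) k * (inner ℝ k.toR3 (act (gyro B₀ (t - s)) k.toR3) : ℝ)
      * velFourier μ (act (gyro B₀ (t - s)) k.toR3))) * Complex.I_sq
  · obtain ⟨G, hG0, hG⟩ := hμ.exists_gradient_bound
    have hU := h.continuousOn_torusFourier hk
    obtain ⟨N, hN⟩ := (isCompact_Icc (a := (0 : ℝ)) (b := t)).exists_bound_of_continuousOn
      (hU.mono Icc_subset_Ici_self)
    have c1 : Continuous fun p : R3 × ℝ => charVel B₀ p.2 p.1 := by fun_prop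
    have c2 : Continuous fun p : R3 × ℝ => act (gyro B₀ (t - p.2)) k.toR3 :=
      (continuous_gyro B₀ k.toR3).comp (continuous_const.sub continuous_snd)
    have c3 : Continuous fun p : R3 × ℝ => fderiv ℝ μ (charVel B₀ p.2 p.1) k.toR3 :=
      ((hμ.smooth.continuous_fderiv (by norm_num)).comp c1).clm_apply continuous_const
    have c4 : Continuous fun p : R3 × ℝ =>
        inner ℝ (act (gyro B₀ (t - p.2)) k.toR3) (charVel B₀ p.2 p.1) := c2.inner c1
    have hm : ContinuousOn (fun p : R3 × ℝ => -(Complex.I * torusFourier (U p.2) k) *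
        (Complex.exp (-Complex.I * (inner ℝ (act (gyro B₀ (t - p.2)) k.toR3)
          (charVel B₀ p.2 p.1) : ℝ)) *
        (fderiv ℝ μ (charVel B₀ p.2 p.1) k.toR3 : ℂ))) (univ ×ˢ Ioc 0 t) := by
      refine ContinuousOn.mul ?_ (by fun_prop)
      refine (ContinuousOn.mul continuousOn_const ?_).neg
      exact hU.comp continuous_snd.continuousOn fun p hp => hp.2.1.le
    have hm' := hm.aestronglyMeasurable (μ := (volume : Measure R3).prod (volume : Measure ℝ))
      (MeasurableSet.univ.prod measurableSet_Ioc)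
    rw [← Measure.prod_restrict, Measure.restrict_univ] at hm'
    have hi : Integrable (fun p : R3 × ℝ => (N * (G * ‖k.toR3‖) * weight p.1) * (1 : ℝ))
        ((volume : Measure R3).prod (volume.restrict (Ioc 0 t))) :=
      (integrable_weight.const_mul _).mul_prod (integrable_const 1)
    refine hi.mono' hm' ?_
    rw [← Measure.restrict_univ (μ := (volume : Measure R3)), Measure.prod_restrict]
    refine (ae_restrict_iff' (MeasurableSet.univ.prod measurableSet_Ioc)).2
      (Filter.Eventually.of_forall fun p hp => ?_)
    simp only [Function.uncurry]
    rw [norm_mul, norm_mul, norm_neg, norm_mul, Complex.norm_I, one_mul, norm_exp_neg_I_mul,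
      one_mul, Complex.norm_real, mul_one]
    have b1 := hN p.2 ⟨hp.2.1.le, hp.2.2⟩
    have b2 : ‖fderiv ℝ μ (charVel B₀ p.2 p.1) k.toR3‖ ≤ G * ‖k.toR3‖ * weight p.1 := by
      rw [← inner_gradient_left]
      refine (norm_inner_le_norm _ _).trans ?_
      have := hG (charVel B₀ p.2 p.1)
      rw [charVel_eq, weight_axisRotation] at this
      rw [charVel_eq]
      calc _ ≤ G * weight p.1 * ‖k.toR3‖ := by gcongr
        _ = _ := by ring
    rw [mul_assoc N]
    exact mul_le_mul b1 b2 (norm_nonneg _) ((norm_nonneg _).trans b1)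

/-- The Volterra equation of the mode `k`: `|k|² Û + K * Û = Ŝ`. -/
theorem IsSolution.volterra (hB : B₀ ≠ 0) (h : IsSolution B₀ μ f₀ f U) (hμ : IsEquilibrium B₀ μ)
    (hf₀ : IsInitialDatum f₀) (k : Mode) {t : ℝ} (ht : 0 ≤ t) :
    ((‖k.toR3‖ ^ 2 : ℝ) : ℂ) * torusFourier (U t) k
      + ∫ s in (0 : ℝ)..t, modeKernel B₀ μ k (t - s) * torusFourier (U s) k
      = torusFourier (freeDensity B₀ f₀ t) k := by
  obtain ⟨C, hC0, hC⟩ := h.exists_fieldWork_bound hμ ht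
  obtain ⟨D, hD0, hD⟩ := hf₀.phaseDecay.exists_bound
  have hwc := h.continuous_fieldWork hB hμ hf₀ ht
  set A : R3 → R3 → ℝ := fun x w => f₀ (x - drift B₀ t w) w with hA
  have hAc : Continuous (Function.uncurry A) := hf₀.smooth.continuous.comp
    (by fun_prop : Continuous fun p : R3 × R3 => (p.1 - drift B₀ t p.2, p.2))
  have hAb : ∀ x w, |A x w| ≤ D * weight w := fun x w => hD _ _
  have hdens : (fun x => ∫ v, f t x v)
      = fun x => freeDensity B₀ f₀ t x - ∫ w, fieldWork B₀ μ U t x w := by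
    ext x
    -- the velocity flow is a rotation: integrate over the initial velocities instead
    have h1 : ∫ v, f t x v = ∫ w, f t x (charVel B₀ t w) :=
      ((axisRotation (B₀ * t)).measurePreserving.integral_comp
        (axisRotation (B₀ * t)).toHomeomorph.measurableEmbedding (fun v => f t x v)).symm
    rw [h1, freeDensity_eq, ← integral_sub (integrable_of_weight hAc hAb x)
      (integrable_of_weight hwc hC x)]
    congr 1
    ext w
    exact h.duhamel hB hμ ht x w
  have hcf : Continuous (freeDensity B₀ f₀ t) := by
    rw [funext (freeDensity_eq B₀ f₀ t)]
    exact continuous_integral_of_weight hAc hAb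
  have hcw := continuous_integral_of_weight hwc hC
  have hsub : torusFourier (fun x => ∫ v, f t x v) k = torusFourier (freeDensity B₀ f₀ t) k
      - torusFourier (fun x => ∫ w, fieldWork B₀ μ U t x w) k := by
    rw [hdens]
    unfold torusFourier
    rw [← integral_sub (integrableOn_torusFourier hcf k) (integrableOn_torusFourier hcw k)]
    congr 1
    ext x
    push_cast
    ring
  have hwork := h.torusFourier_integral_fieldWork hB hμ hf₀ k ht
  have hρ := h.torusFourier_density ht k
  rw [hsub, hwork] at hρ
  rw [← hρ]
  ring

end Duhamel

/-! ### The kernel and the source of a Fourier mode -/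

theorem Mode.toR3_ne_zero {k : Mode} (hk : k ≠ 0) : k.toR3 ≠ 0 := by
  intro h
  apply hk
  ext i
  have := congrArg (fun v : R3 => v i) h
  simpa [Mode.toR3] using this

theorem Mode.one_le_norm {k : Mode} (hk : k ≠ 0) : 1 ≤ ‖k.toR3‖ := by
  obtain ⟨i, hi⟩ := Function.ne_iff.1 hk
  have h1 : (1 : ℝ) ≤ |(k i : ℝ)| := by
    exact_mod_cast Int.one_le_abs hi
  exact h1.trans (PiLp.norm_apply_le k.toR3 i)

theorem Mode.toR3_injective : Function.Injective Mode.toR3 := by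
  intro k n h
  ext i
  have h1 : k.toR3 i = n.toR3 i := by rw [h]
  simpa only [Mode.toR3, PiLp.toLp_apply, Int.cast_inj] using h1

/-- `∑ |k|⁻⁴` converges over `ℤ³`, because `4 > 3`; the term `k = 0` is `0⁻¹ = 0`. -/
theorem summable_norm_toR3 : Summable fun k : Mode => ‖k.toR3‖⁻¹ ^ 4 := by
  obtain ⟨b, hb⟩ : ∃ b : Module.Basis (Fin 3) ℝ R3, ∀ i, b i = EuclideanSpace.single i 1 :=
    ⟨(EuclideanSpace.basisFun (Fin 3) ℝ).toBasis, fun i => by simp⟩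
  have hmem : ∀ k : Mode, k.toR3 ∈ Submodule.span ℤ (Set.range b) := by
    intro k
    have : k.toR3 = ∑ i, k i • b i := by
      ext j
      fin_cases j <;> simp [Mode.toR3, hb, Fin.sum_univ_three]
    rw [this]
    exact Submodule.sum_mem _ fun i _ =>
      Submodule.smul_mem _ _ (Submodule.subset_span (mem_range_self i))
  have hrank : Module.finrank ℤ (Submodule.span ℤ (Set.range b)) = 3 := by
    rw [Module.finrank_eq_card_basis (b.restrictScalars ℤ), Fintype.card_fin]
  have hs := ZLattice.summable_norm_pow_inv (Submodule.span ℤ (Set.range b)) 4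
    (by rw [hrank]; norm_num)
  have h1 := hs.comp_injective (i := fun k : Mode => ⟨k.toR3, hmem k⟩)
    fun k n h => Mode.toR3_injective (congrArg Subtype.val h)
  refine h1.congr fun k => ?_
  simp only [Function.comp_apply, inv_pow]
  rfl

section Kernel

variable {B₀ : ℝ} {μ : R3 → ℝ}

theorem continuous_modeKernel (hμ : IsEquilibrium B₀ μ) (k : Mode) :
    Continuous (modeKernel B₀ μ k) := by
  have h1 := continuous_gyro B₀ k.toR3
  exact (hμ.continuous_velFourier.comp h1).mul
    (Complex.continuous_ofReal.comp (continuous_const.inner h1))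

theorem exists_velFourier_bound (hμ : IsEquilibrium B₀ μ) :
    ∃ C, 0 ≤ C ∧ ∀ ξ, ‖velFourier μ ξ‖ ≤ C := by
  obtain ⟨C, hC0, hC⟩ := hμ.exists_velFourier_decay
  refine ⟨C, hC0, fun ξ => le_trans ?_ (hC ξ)⟩
  exact le_mul_of_one_le_left (norm_nonneg _) (by nlinarith [norm_nonneg ξ])

/-- Growth of the mode kernels, relative to `|k|²` and uniform in `k`. -/
theorem exists_modeKernel_growth (hB : 0 < B₀) (hμ : IsEquilibrium B₀ μ) :
    ∃ c, 0 ≤ c ∧ ∀ k t, 0 ≤ t → ‖modeKernel B₀ μ k t‖ ≤ ‖k.toR3‖ ^ 2 * c * Real.exp t := by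
  obtain ⟨C, hC0, hC⟩ := exists_velFourier_bound hμ
  have hB' : 0 < B₀⁻¹ := by positivity
  refine ⟨C * (B₀⁻¹ + 1), by positivity, fun k t ht => ?_⟩
  have h1 : |inner ℝ k.toR3 (act (gyro B₀ t) k.toR3)| ≤ ‖k.toR3‖ ^ 2 * (B₀⁻¹ + 1) * Real.exp t := by
    rw [inner_gyro, norm_sq_R3]
    have h2 : |B₀⁻¹ * Real.sin (B₀ * t) * (k.toR3 0 ^ 2 + k.toR3 1 ^ 2)|
        ≤ B₀⁻¹ * (k.toR3 0 ^ 2 + k.toR3 1 ^ 2) := by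
      rw [abs_mul, abs_mul, abs_of_pos hB',
          abs_of_nonneg (by positivity : (0:ℝ) ≤ k.toR3 0 ^ 2 + k.toR3 1 ^ 2)]
      gcongr
      exact mul_le_of_le_one_right hB'.le (Real.abs_sin_le_one _)
    have h3 : |t * k.toR3 2 ^ 2| = t * k.toR3 2 ^ 2 := abs_of_nonneg (by positivity)
    refine (abs_add_le _ _).trans ?_
    rw [h3]
    have h4 : 1 + t ≤ Real.exp t := by linarith [Real.add_one_le_exp t]
    calc |B₀⁻¹ * Real.sin (B₀ * t) * (k.toR3 0 ^ 2 + k.toR3 1 ^ 2)| + t * k.toR3 2 ^ 2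
        ≤ (k.toR3 0 ^ 2 + k.toR3 1 ^ 2 + k.toR3 2 ^ 2) * (B₀⁻¹ + 1) * (1 + t) := by
          have p0 := sq_nonneg (k.toR3 2)
          have p1 : 0 ≤ k.toR3 0 ^ 2 + k.toR3 1 ^ 2 := by positivity
          have q1 : 0 ≤ (k.toR3 0 ^ 2 + k.toR3 1 ^ 2) * (B₀⁻¹ * t + 1 + t) := by positivity
          have q2 : 0 ≤ k.toR3 2 ^ 2 * (B₀⁻¹ * (1 + t) + 1) := by positivity
          linarith
      _ ≤ _ := by gcongr
  rw [modeKernel, norm_mul, Complex.norm_real, Real.norm_eq_abs]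
  calc _ ≤ C * (‖k.toR3‖ ^ 2 * (B₀⁻¹ + 1) * Real.exp t) :=
        mul_le_mul (hC _) h1 (abs_nonneg _) hC0
    _ = _ := by ring

/-- Decay of the kernel of a mode that is not perpendicular to the magnetic field. -/
theorem exists_modeKernel_decay (hμ : IsEquilibrium B₀ μ) :
    ∃ C, 0 ≤ C ∧ ∀ k : Mode, k 2 ≠ 0 → ∀ t, 0 ≤ t →
      ‖modeKernel B₀ μ k t‖ ≤ C * ‖k.toR3‖ / (1 + t) := by
  obtain ⟨C, hC0, hC⟩ := hμ.exists_velFourier_decay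
  refine ⟨2 * C, by positivity, fun k hk t ht => ?_⟩
  set ξ := act (gyro B₀ t) k.toR3 with hξ
  have h1 : t ≤ ‖ξ‖ := by
    have h2 : |ξ 2| ≤ ‖ξ‖ := PiLp.norm_apply_le ξ 2
    have h3 : (1 : ℝ) ≤ |k.toR3 2| := by
      have : (1 : ℝ) ≤ |(k 2 : ℝ)| := by exact_mod_cast Int.one_le_abs hk
      simpa [Mode.toR3] using this
    rw [hξ, gyro_two, abs_mul, abs_of_nonneg ht] at h2
    exact (le_mul_of_one_le_right ht h3).trans h2
  rw [modeKernel, norm_mul, Complex.norm_real, Real.norm_eq_abs, le_div_iff₀ (by positivity)]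
  have h4 : ‖ξ‖ * (1 + t) ≤ 2 * (1 + ‖ξ‖ ^ 2) := by nlinarith [norm_nonneg ξ, sq_nonneg (‖ξ‖ - 1)]
  calc ‖velFourier μ ξ‖ * |inner ℝ k.toR3 ξ| * (1 + t)
      ≤ ‖velFourier μ ξ‖ * (‖k.toR3‖ * ‖ξ‖) * (1 + t) := by
        gcongr; exact abs_real_inner_le_norm _ _
    _ = ‖velFourier μ ξ‖ * ‖k.toR3‖ * (‖ξ‖ * (1 + t)) := by ring
    _ ≤ ‖velFourier μ ξ‖ * ‖k.toR3‖ * (2 * (1 + ‖ξ‖ ^ 2)) := by gcongr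
    _ = 2 * ‖k.toR3‖ * ((1 + ‖ξ‖ ^ 2) * ‖velFourier μ ξ‖) := by ring
    _ ≤ 2 * ‖k.toR3‖ * C := by gcongr; exact hC ξ
    _ = 2 * C * ‖k.toR3‖ := by ring

theorem continuous_gyro_entry (B₀ : ℝ) (i j : Fin 3) : Continuous fun t => gyro B₀ t i j := by
  fin_cases i <;> fin_cases j <;> simp [gyro, block, rot] <;> fun_prop

/-- The Laplace integrals of the kernel converge in the open right half-plane: the transform of `μ`
is bounded, and `R̃` grows linearly. -/
theorem laplaceConv_kernelEntry (hB : 0 < B₀) (hμ : IsEquilibrium B₀ μ) (k : Mode) {l : ℂ}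
    (hl : 0 < l.re) (i j : Fin 3) : LaplaceConv (kernelEntry B₀ μ k i j) l := by
  obtain ⟨C, hC0, hC⟩ := exists_velFourier_bound hμ
  have hB' : 0 < B₀⁻¹ := by positivity
  have hc : Continuous (kernelEntry B₀ μ k i j) :=
    (hμ.continuous_velFourier.comp (continuous_gyro B₀ k.toR3)).mul
      (Complex.continuous_ofReal.comp (continuous_gyro_entry B₀ i j))
  set s := l.re / 2 with hs
  have hs0 : 0 < s := by positivity
  refine laplaceConv_of_growth hc.continuousOn (C := C * (2 * B₀⁻¹ + s⁻¹)) (s := s)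
    (fun t ht => ?_) (by rw [hs]; linarith)
  rw [kernelEntry, norm_mul, Complex.norm_real, Real.norm_eq_abs, mul_assoc]
  refine mul_le_mul (hC _) ?_ (abs_nonneg _) hC0
  refine (norm_gyro_entry_le B₀ t ht.le hB i j).trans ?_
  have h1 : s * t ≤ Real.exp (s * t) := by linarith [Real.add_one_le_exp (s * t)]
  have h2 : 1 ≤ Real.exp (s * t) := Real.one_le_exp (by positivity)
  have h3 : t = s⁻¹ * (s * t) := by field_simp
  rw [add_mul]
  refine add_le_add (le_mul_of_one_le_right (by positivity) h2) ?_
  conv_lhs => rw [h3]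
  gcongr

theorem modeKernel_eq_sum (B₀ : ℝ) (μ : R3 → ℝ) (k : Mode) (t : ℝ) :
    modeKernel B₀ μ k t = ∑ i, ∑ j, (k i : ℂ) * k j * kernelEntry B₀ μ k i j t := by
  have h1 : inner ℝ k.toR3 (act (gyro B₀ t) k.toR3)
      = ∑ i, ∑ j, (k i : ℝ) * k j * gyro B₀ t i j := by
    simp only [PiLp.inner_apply, act, Matrix.mulVec, dotProduct, Mode.toR3, RCLike.inner_apply,
      conj_trivial]
    refine Finset.sum_congr rfl fun i _ => ?_
    rw [Finset.sum_mul]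
    refine Finset.sum_congr rfl fun j _ => ?_
    ring
  rw [modeKernel, h1]
  push_cast
  rw [Finset.mul_sum]
  refine Finset.sum_congr rfl fun i _ => ?_
  rw [Finset.mul_sum]
  refine Finset.sum_congr rfl fun j _ => ?_
  rw [kernelEntry]
  ring

/-- The dispersion function is `|k|²` plus the Laplace transform of the scalar mode kernel. -/
theorem dispersion_eq {k : Mode} {l : ℂ} (h : ∀ i j, LaplaceConv (kernelEntry B₀ μ k i j) l) :
    LaplaceConv (modeKernel B₀ μ k) l ∧
      dispersion B₀ μ k l = ((‖k.toR3‖ ^ 2 : ℝ) : ℂ) + laplace (modeKernel B₀ μ k) l := by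
  have hpt : ∀ t : ℝ, Complex.exp (-l * t) * modeKernel B₀ μ k t
      = ∑ i, ∑ j, (k i : ℂ) * k j * (Complex.exp (-l * t) * kernelEntry B₀ μ k i j t) := by
    intro t
    rw [modeKernel_eq_sum, Finset.mul_sum]
    refine Finset.sum_congr rfl fun i _ => ?_
    rw [Finset.mul_sum]
    refine Finset.sum_congr rfl fun j _ => ?_
    ring
  have hi : ∀ i j, IntegrableOn (fun t : ℝ => (k i : ℂ) * k j *
      (Complex.exp (-l * t) * kernelEntry B₀ μ k i j t)) (Ioi 0) := fun i j =>
    Integrable.const_mul (h i j) _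
  constructor
  · simp only [LaplaceConv, hpt]
    exact integrable_finsetSum _ fun i _ => integrable_finsetSum _ fun j _ => hi i j
  · have h2 : laplace (modeKernel B₀ μ k) l
        = ∑ i, ∑ j, (k i : ℂ) * k j * laplace (kernelEntry B₀ μ k i j) l := by
      simp only [laplace, hpt]
      rw [integral_finsetSum _ fun i _ => integrable_finsetSum _ fun j _ => hi i j]
      refine Finset.sum_congr rfl fun i _ => ?_
      rw [integral_finsetSum _ fun j _ => hi i j]
      refine Finset.sum_congr rfl fun j _ => ?_
      rw [integral_const_mul]
    have h3 : ((‖k.toR3‖ ^ 2 : ℝ) : ℂ) = ∑ i, (k i : ℂ) * k i := by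
      rw [norm_sq_R3]
      simp [Mode.toR3, Fin.sum_univ_three]
      ring
    rw [dispersion, Matrix.add_mulVec, Matrix.one_mulVec, dotProduct_add, h2, h3]
    congr 1
    simp only [dotProduct, Matrix.mulVec, kernelLaplace, Matrix.of_apply]
    refine Finset.sum_congr rfl fun i _ => ?_
    rw [Finset.mul_sum]
    refine Finset.sum_congr rfl fun j _ => ?_
    ring

/-- For a mode perpendicular to the magnetic field the kernel is periodic and odd, so that the
Penrose condition forces it to vanish. -/
theorem modeKernel_eq_zero (hB : 0 < B₀) (hμ : IsEquilibrium B₀ μ) {k : Mode} (hk : k 2 = 0)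
    {κ : ℝ} (hκ : 0 < κ) (hP : ∀ l : ℂ, 0 < l.re → κ ≤ ‖dispersion B₀ μ k l‖) {t : ℝ} (ht : 0 < t) :
    modeKernel B₀ μ k t = 0 := by
  have hk' : k.toR3 2 = 0 := by simp [Mode.toR3, hk]
  have hper : ∀ t, modeKernel B₀ μ k (t + 2 * Real.pi / B₀) = modeKernel B₀ μ k t := by
    intro t
    rw [modeKernel, modeKernel, gyro_add_period hB.ne' t hk']
  have hodd : ∀ t, modeKernel B₀ μ k (-t) = -modeKernel B₀ μ k t := by
    intro t
    rw [modeKernel, modeKernel, inner_gyro, inner_gyro, gyro_neg B₀ t hk',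
      hμ.velFourier_axisRotation hB.ne', mul_neg, Real.sin_neg, hk']
    push_cast
    ring
  refine periodic_kernel_eq_zero (by positivity) (continuous_modeKernel hμ k) hper hodd
    (a := ‖k.toR3‖ ^ 2) hκ (fun l hl => ?_) t ht
  rw [← (dispersion_eq (laplaceConv_kernelEntry hB hμ k hl)).2]
  exact hP l hl

end Kernel

section Source

variable {B₀ : ℝ} {f₀ : R3 → R3 → ℝ}

theorem continuous_torusFourier_freeDensity (hf₀ : IsInitialDatum f₀) (k : Mode) :
    Continuous fun t => torusFourier (freeDensity B₀ f₀ t) k := by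
  simp only [torusFourier_freeDensity B₀ hf₀.phaseDecay]
  exact (hf₀.phaseDecay.continuous_phaseFourier k).comp (continuous_gyro B₀ k.toR3)

/-- Decay of the free-streaming density in `k` and, for modes that are not perpendicular to the
magnetic field, in time. -/
theorem exists_freeDensity_decay (B₀ : ℝ) (hf₀ : IsInitialDatum f₀) :
    ∃ C, 0 ≤ C ∧ ∀ (k : Mode) t, 0 ≤ t →
      ‖torusFourier (freeDensity B₀ f₀ t) k‖ ≤ C / (1 + ‖k.toR3‖ ^ 2) ∧
      (k 2 ≠ 0 → ‖torusFourier (freeDensity B₀ f₀ t) k‖ ≤ C / (1 + ‖k.toR3‖ ^ 2) / (1 + t)) := by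
  obtain ⟨C, hC0, hC⟩ := hf₀.phaseDecay.exists_decay
  refine ⟨C, hC0, fun k t ht => ?_⟩
  have h1 := hC k (act (gyro B₀ t) k.toR3)
  rw [← torusFourier_freeDensity B₀ hf₀.phaseDecay, gyro_two, abs_mul, abs_of_nonneg ht] at h1
  set N := ‖torusFourier (freeDensity B₀ f₀ t) k‖ with hN
  have hN0 : 0 ≤ N := norm_nonneg _
  constructor
  · rw [le_div_iff₀ (by positivity)]
    refine le_trans ?_ h1
    have : 0 ≤ (1 + ‖k.toR3‖ ^ 2) * (t * |k.toR3 2|) * N := by positivity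
    linarith
  · intro hk
    have h3 : (1 : ℝ) ≤ |k.toR3 2| := by
      have : (1 : ℝ) ≤ |(k 2 : ℝ)| := by exact_mod_cast Int.one_le_abs hk
      simpa [Mode.toR3] using this
    rw [div_div, le_div_iff₀ (by positivity), mul_comm]
    refine le_trans ?_ h1
    gcongr
    exact le_mul_of_one_le_right ht h3

end Source

/-! ### The electric energy -/

section Energy

variable {B₀ : ℝ} {μ : R3 → ℝ} {f₀ : R3 → R3 → ℝ} {f : ℝ → R3 → R3 → ℝ} {U : ℝ → R3 → ℝ}

/-- Exponential growth of the potential, at a rate uniform in the mode. -/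
theorem IsSolution.exists_growth (hB : 0 < B₀) (h : IsSolution B₀ μ f₀ f U)
    (hμ : IsEquilibrium B₀ μ) (hf₀ : IsInitialDatum f₀) :
    ∃ σ, 0 ≤ σ ∧ ∀ k : Mode, k ≠ 0 → ∃ C, ∀ t, 0 ≤ t →
      ‖torusFourier (U t) k‖ ≤ C * Real.exp (σ * t) := by
  obtain ⟨c, hc0, hc⟩ := exists_modeKernel_growth hB hμ
  obtain ⟨C, hC0, hC⟩ := exists_freeDensity_decay B₀ hf₀
  refine ⟨1 + 2 * c + 1, by positivity, fun k hk => ⟨_, volterra_growth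
    (a := ‖k.toR3‖ ^ 2) (c := c) (K := modeKernel B₀ μ k)
    (pow_pos (norm_pos_iff.2 (Mode.toR3_ne_zero hk)) 2) hc0
    (fun t ht => h.volterra hB.ne' hμ hf₀ k ht)
    (h.continuousOn_torusFourier (Mode.toR3_ne_zero hk)) (fun t ht => hc k t ht)
    (fun t ht => (hC k t ht).1)⟩⟩

theorem IsSolution.modeEnergy_eq (h : IsSolution B₀ μ f₀ f U) {t : ℝ} (ht : 0 ≤ t) (k : Mode) :
    modeEnergy U t k = 1 / 2 * (‖k.toR3‖ ^ 2 * ‖torusFourier (U t) k‖ ^ 2) := by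
  have h1 : ∀ j, torusFourier (fun x => field U t x j) k
      = -(Complex.I * (k.toR3 j : ℝ)) * torusFourier (U t) k := by
    intro j
    have := h.torusFourier_inner_field ht k (unitVec j)
    simp only [inner_unitVec] at this
    exact this
  rw [modeEnergy, norm_sq_R3]
  simp only [h1, norm_mul, norm_neg, Complex.norm_I, one_mul, Complex.norm_real, mul_pow,
    Real.norm_eq_abs, sq_abs, Fin.sum_univ_three]
  ring

/-- Under the Penrose condition for the mode `k`, `|k|³ |Û|` is bounded, uniformly in time and in the
mode. -/
theorem IsSolution.exists_penrose_bound (hB : 0 < B₀) (h : IsSolution B₀ μ f₀ f U)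
    (hμ : IsEquilibrium B₀ μ) (hf₀ : IsInitialDatum f₀) {κ : ℝ} (hκ : 0 < κ) :
    ∃ D, 0 ≤ D ∧ ∀ k : Mode, k ≠ 0 → (∀ l : ℂ, 0 < l.re → κ ≤ ‖dispersion B₀ μ k l‖) →
      ∀ t, 0 ≤ t → ‖k.toR3‖ ^ 2 * ‖torusFourier (U t) k‖ ≤ D * ‖k.toR3‖⁻¹ := by
  obtain ⟨σ, hσ, hgrow⟩ := h.exists_growth hB hμ hf₀
  obtain ⟨A, hA0, hA⟩ := exists_modeKernel_decay hμ
  obtain ⟨C, hC0, hC⟩ := exists_freeDensity_decay B₀ hf₀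
  refine ⟨C * (1 + A / κ), by positivity, fun k hk hP t ht => ?_⟩
  have hk1 := Mode.one_le_norm hk
  have hk0 : 0 < ‖k.toR3‖ := by linarith
  have hV : ∀ t, 0 ≤ t → ((‖k.toR3‖ ^ 2 : ℝ) : ℂ) * torusFourier (U t) k
      + ∫ s in (0 : ℝ)..t, modeKernel B₀ μ k (t - s) * torusFourier (U s) k
      = torusFourier (freeDensity B₀ f₀ t) k := fun t ht => h.volterra hB.ne' hμ hf₀ k ht
  have hdiff : ‖((‖k.toR3‖ ^ 2 : ℝ) : ℂ) * torusFourier (U t) k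
      - torusFourier (freeDensity B₀ f₀ t) k‖ ≤ A * ‖k.toR3‖ * (C / (1 + ‖k.toR3‖ ^ 2)) / κ := by
    by_cases hk2 : k 2 = 0
    · have hz : ∫ s in (0 : ℝ)..t, modeKernel B₀ μ k (t - s) * torusFourier (U s) k = 0 := by
        rw [intervalIntegral.integral_of_le ht, ← integral_Ioc_eq_integral_Ioo.symm]
        refine setIntegral_eq_zero_of_forall_eq_zero fun s hs => ?_
        rw [modeKernel_eq_zero hB hμ hk2 hκ hP (by linarith [hs.2]), zero_mul]
      have := hV t ht
      rw [hz, add_zero] at this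
      rw [this, sub_self, norm_zero]
      positivity
    · obtain ⟨G, hG⟩ := hgrow k hk
      refine volterra_penrose_bound hκ (by positivity) (by positivity) hV
        (h.continuousOn_torusFourier (Mode.toR3_ne_zero hk))
        (continuous_modeKernel hμ k).continuousOn
        (continuous_torusFourier_freeDensity hf₀ k).continuousOn
        (fun t ht => hA k hk2 t ht) (fun t ht => (hC k t ht).2 hk2) hG hσ (fun l hl => ?_) t ht
      rw [← (dispersion_eq (laplaceConv_kernelEntry hB hμ k hl)).2]
      exact hP l hl
  have hS := (hC k t ht).1
  have hsum : ‖k.toR3‖ ^ 2 * ‖torusFourier (U t) k‖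
      ≤ A * ‖k.toR3‖ * (C / (1 + ‖k.toR3‖ ^ 2)) / κ + C / (1 + ‖k.toR3‖ ^ 2) := by
    have h1 : ‖k.toR3‖ ^ 2 * ‖torusFourier (U t) k‖
        = ‖((‖k.toR3‖ ^ 2 : ℝ) : ℂ) * torusFourier (U t) k‖ := by
      rw [norm_mul, Complex.norm_real, Real.norm_of_nonneg (by positivity)]
    rw [h1]
    refine le_trans ?_ (add_le_add hdiff hS)
    have h2 := norm_add_le (((‖k.toR3‖ ^ 2 : ℝ) : ℂ) * torusFourier (U t) k
      - torusFourier (freeDensity B₀ f₀ t) k) (torusFourier (freeDensity B₀ f₀ t) k)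
    rw [sub_add_cancel] at h2
    exact h2
  refine hsum.trans ?_
  have h2 : C / (1 + ‖k.toR3‖ ^ 2) ≤ C / ‖k.toR3‖ ^ 2 := by
    gcongr
    linarith
  calc A * ‖k.toR3‖ * (C / (1 + ‖k.toR3‖ ^ 2)) / κ + C / (1 + ‖k.toR3‖ ^ 2)
      ≤ A * ‖k.toR3‖ * (C / ‖k.toR3‖ ^ 2) / κ + C / ‖k.toR3‖ ^ 2 * ‖k.toR3‖ := by
        gcongr
        exact h2.trans (le_mul_of_one_le_right (by positivity) hk1)
    _ = C * (1 + A / κ) * ‖k.toR3‖⁻¹ := by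
        field_simp
        ring

theorem IsSolution.energyOn_bounded (hB : 0 < B₀) (h : IsSolution B₀ μ f₀ f U)
    (hμ : IsEquilibrium B₀ μ) (hf₀ : IsInitialDatum f₀)
    {K : Set Mode} (hK : 0 ∉ K) {κ : ℝ} (hκ : 0 < κ)
    (hP : ∀ k ∈ K, ∀ l : ℂ, 0 < l.re → κ ≤ ‖dispersion B₀ μ k l‖) :
    ∃ C : ℝ, ∀ t, 0 ≤ t → energyOn U K t ≤ ENNReal.ofReal C := by
  obtain ⟨D, hD0, hD⟩ := h.exists_penrose_bound hB hμ hf₀ hκ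
  set b : Mode → ℝ := fun k => 1 / 2 * D ^ 2 * ‖k.toR3‖⁻¹ ^ 4 with hb
  have hbs : Summable b := summable_norm_toR3.mul_left _
  have hb0 : ∀ k, 0 ≤ b k := fun k => by simp only [hb]; positivity
  refine ⟨1 / (2 * Real.pi) ^ 3 * ∑' k, b k, fun t ht => ?_⟩
  rw [energyOn, ENNReal.ofReal_mul (by positivity), ENNReal.ofReal_tsum_of_nonneg hb0 hbs]
  gcongr
  refine le_trans ?_ (ENNReal.tsum_comp_le_tsum_of_injective (f := ((↑) : K → Mode))
    Subtype.val_injective fun k => ENNReal.ofReal (b k))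
  refine ENNReal.tsum_le_tsum fun k => ENNReal.ofReal_le_ofReal ?_
  have hk : (k : Mode) ≠ 0 := fun h0 => hK (h0 ▸ k.2)
  have hk0 : 0 < ‖(k : Mode).toR3‖ := by linarith [Mode.one_le_norm hk]
  have h1 := hD k hk (hP k k.2) t ht
  rw [h.modeEnergy_eq ht]
  have h2 : ‖(k : Mode).toR3‖ ^ 2 * ‖torusFourier (U t) k‖ ^ 2
      = (‖(k : Mode).toR3‖ ^ 2 * ‖torusFourier (U t) k‖) ^ 2 * ‖(k : Mode).toR3‖⁻¹ ^ 2 := by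
    field_simp
  rw [h2]
  simp only [hb]
  calc 1 / 2 * ((‖(k : Mode).toR3‖ ^ 2 * ‖torusFourier (U t) k‖) ^ 2 * ‖(k : Mode).toR3‖⁻¹ ^ 2)
      ≤ 1 / 2 * ((D * ‖(k : Mode).toR3‖⁻¹) ^ 2 * ‖(k : Mode).toR3‖⁻¹ ^ 2) := by gcongr
    _ = 1 / 2 * D ^ 2 * ‖(k : Mode).toR3‖⁻¹ ^ 4 := by ring

/-- By Parseval, and because the mean of the field vanishes, the nonzero modes carry the whole
electric energy. -/
theorem IsSolution.energyOn_ne_zero (h : IsSolution B₀ μ f₀ f U) {t : ℝ} (ht : 0 ≤ t) :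
    energyOn U {k | k ≠ 0} t = ENNReal.ofReal (energy U t) := by
  have hcont : Continuous (field U t) :=
    h.continuous_field.comp_continuous (f := fun x : R3 => (t, x)) (by fun_prop)
      fun x => ⟨ht, mem_univ _⟩
  have hj : ∀ j, HasSum (fun k => ‖torusFourier (fun x => field U t x j) k‖ ^ 2)
      ((2 * Real.pi) ^ 3 * ∫ x in cell, field U t x j ^ 2) := fun j =>
    hasSum_norm_torusFourier_sq (fun k x => by simp only [h.field_periodic ht]) (by fun_prop)
  have hsum : HasSum (modeEnergy U t) ((2 * Real.pi) ^ 3 * energy U t) := by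
    have h1 := (hasSum_sum (s := Finset.univ) fun j _ => hj j).mul_left (1 / 2)
    have h2 : (2 * Real.pi) ^ 3 * energy U t
        = 1 / 2 * ∑ j : Fin 3, (2 * Real.pi) ^ 3 * ∫ x in cell, field U t x j ^ 2 := by
      have h3 : ∫ x in cell, ‖field U t x‖ ^ 2 = ∑ j : Fin 3, ∫ x in cell, field U t x j ^ 2 := by
        rw [← integral_finsetSum]
        · congr 1
          ext x
          rw [norm_sq_R3, Fin.sum_univ_three]
        · intro j _
          have hc : Continuous fun x => field U t x j ^ 2 := by fun_prop
          exact hc.continuousOn.integrableOn_compact isCompact_cell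
      rw [energy, h3, ← Finset.mul_sum]
      ring
    rw [h2]
    exact h1
  have h0 : modeEnergy U t 0 = 0 := by
    rw [h.modeEnergy_eq ht]
    have : Mode.toR3 0 = 0 := by ext i; simp [Mode.toR3]
    simp [this]
  have hnn : ∀ k, 0 ≤ modeEnergy U t k := fun k => by
    rw [modeEnergy]; positivity
  rw [energyOn, tsum_subtype_eq_of_support_subset (f := fun k => ENNReal.ofReal (modeEnergy U t k)),
    ← ENNReal.ofReal_tsum_of_nonneg hnn hsum.summable, hsum.tsum_eq,
    ← ENNReal.ofReal_mul (by positivity)]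
  · congr 1
    field_simp
  · intro k hk hk0
    apply hk
    simp only [hk0, h0, ENNReal.ofReal_zero]

end Energy

end MagnetizedVP

end

open MagnetizedVP in
theorem proposition2 (B₀ : ℝ) (hB : 0 < B₀)
    (μ : R3 → ℝ) (hμ : IsEquilibrium B₀ μ)
    (f₀ : R3 → R3 → ℝ) (hf₀ : IsInitialDatum f₀)
    (f : ℝ → R3 → R3 → ℝ) (U : ℝ → R3 → ℝ) (hsol : IsSolution B₀ μ f₀ f U) :
    -- the dispersion relation, in a half-plane where all the Laplace integrals converge
    (∃ σ : ℝ, 0 ≤ σ ∧ ∀ (k : Mode) (l : ℂ), σ < l.re →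
      (∀ i j, LaplaceConv (kernelEntry B₀ μ k i j) l) ∧
      LaplaceConv (fun t => torusFourier (freeDensity B₀ f₀ t) k) l ∧
      (k ≠ 0 → LaplaceConv (fun t => torusFourier (U t) k) l) ∧
      dispersion B₀ μ k l * laplace (fun t => torusFourier (U t) k) l
        = laplace (fun t => torusFourier (freeDensity B₀ f₀ t) k) l) ∧
    -- the dispersion relation, wherever the transforms on its left-hand side converge
    (∀ (k : Mode) (l : ℂ),
      (∀ i j, LaplaceConv (kernelEntry B₀ μ k i j) l) →
      LaplaceConv (fun t => torusFourier (U t) k) l →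
      LaplaceConv (fun t => torusFourier (freeDensity B₀ f₀ t) k) l ∧
      dispersion B₀ μ k l * laplace (fun t => torusFourier (U t) k) l
        = laplace (fun t => torusFourier (freeDensity B₀ f₀ t) k) l) ∧
    -- on the open right half-plane the dispersion function is given by convergent integrals
    (∀ (k : Mode) (l : ℂ), 0 < l.re → ∀ i j, LaplaceConv (kernelEntry B₀ μ k i j) l) ∧
    -- the Penrose condition bounds the electric energy
    (∀ κ₀ : ℝ, 0 < κ₀ →
      (∀ k : Mode, k ≠ 0 → ∀ l : ℂ, 0 < l.re → κ₀ ≤ ‖dispersion B₀ μ k l‖) →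
      ∃ C : ℝ, ∀ t : ℝ, 0 ≤ t → energy U t ≤ C) ∧
    -- the same for any set of nonzero modes
    (∀ (K : Set Mode) (κ₀ : ℝ), 0 ∉ K → 0 < κ₀ →
      (∀ k ∈ K, ∀ l : ℂ, 0 < l.re → κ₀ ≤ ‖dispersion B₀ μ k l‖) →
      ∃ C : ℝ, ∀ t : ℝ, 0 ≤ t → energyOn U K t ≤ ENNReal.ofReal C) := by
  have hpart : ∀ (k : Mode) (l : ℂ), (∀ i j, LaplaceConv (kernelEntry B₀ μ k i j) l) →
      LaplaceConv (fun t => torusFourier (U t) k) l →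
      LaplaceConv (fun t => torusFourier (freeDensity B₀ f₀ t) k) l ∧
      dispersion B₀ μ k l * laplace (fun t => torusFourier (U t) k) l
        = laplace (fun t => torusFourier (freeDensity B₀ f₀ t) k) l := by
    intro k l hent hU
    obtain ⟨hK, hP⟩ := dispersion_eq hent
    rw [hP]
    exact laplace_volterra (fun t ht => hsol.volterra hB.ne' hμ hf₀ k ht) hK hU
  have henergy : ∀ (K : Set Mode) (κ₀ : ℝ), 0 ∉ K → 0 < κ₀ →
      (∀ k ∈ K, ∀ l : ℂ, 0 < l.re → κ₀ ≤ ‖dispersion B₀ μ k l‖) →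
      ∃ C : ℝ, ∀ t : ℝ, 0 ≤ t → energyOn U K t ≤ ENNReal.ofReal C :=
    fun K κ₀ hK hκ hP => hsol.energyOn_bounded hB hμ hf₀ hK hκ hP
  refine ⟨?_, hpart, fun k l hl => laplaceConv_kernelEntry hB hμ k hl, fun κ₀ hκ hP => ?_, henergy⟩
  · obtain ⟨σ, hσ, hgrow⟩ := hsol.exists_growth hB hμ hf₀
    refine ⟨σ, hσ, fun k l hl => ?_⟩
    have hent := laplaceConv_kernelEntry hB hμ k (hσ.trans_lt hl)
    by_cases hk : k = 0
    · -- The potential is fixed by the equation up to a constant only, so its mean may have no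
      -- Laplace transform; both sides of the identity vanish nevertheless.
      subst hk
      have hS : ∀ t ∈ Ioi (0 : ℝ),
          Complex.exp (-l * t) * torusFourier (freeDensity B₀ f₀ t) 0 = 0 := by
        intro t ht
        have h1 : Mode.toR3 0 = 0 := by ext i; simp [Mode.toR3]
        rw [← hsol.volterra hB.ne' hμ hf₀ 0 (le_of_lt ht)]
        simp [modeKernel, h1]
      refine ⟨hent, ?_, fun h => absurd rfl h, ?_⟩
      · exact integrableOn_zero.congr_fun (fun t ht => (hS t ht).symm) measurableSet_Ioi
      · rw [laplace, laplace, setIntegral_eq_zero_of_forall_eq_zero hS]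
        simp [dispersion, dotProduct]
    · obtain ⟨C, hC⟩ := hgrow k hk
      have hU : LaplaceConv (fun t => torusFourier (U t) k) l :=
        laplaceConv_of_growth
          ((hsol.continuousOn_torusFourier (Mode.toR3_ne_zero hk)).mono Ioi_subset_Ici_self)
          (fun t ht => hC t (le_of_lt ht)) hl
      exact ⟨hent, (hpart k l hent hU).1, fun _ => hU, (hpart k l hent hU).2⟩
  · obtain ⟨C, hC⟩ := henergy {k | k ≠ 0} κ₀ (fun h => h rfl) hκ hP
    refine ⟨max C 0, fun t ht => ?_⟩
    have h1 := hC t ht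
    rw [hsol.energyOn_ne_zero ht, ENNReal.ofReal_le_ofReal_iff'] at h1
    exact h1.elim (fun h => h.trans (le_max_left _ _)) fun h => h.trans (le_max_right _ _)
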